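/- **Setting.** Let $(X_i,W_i,H_i,Y_i(0),Y_i(1))_{i\ge 1}$ be i.i.d., with covariates $X_i\in\mathbb R^d$ having finite second moments, treatment $W_i\in\{0,1\}$, study label $H_i\in\{1,\dots,K\}$, and observed outcome $Y_i=Y_i(W_i)$. Put $\rho_k=P(H_i=k)>0$, assume $0<P(W_i=1\mid H_i=k)<1$, and assume that within each study (conditionally on $H_i=k$) $W_i$ is independent of $(X_i,Y_i(0),Y_i(1))$. The law of $X_i$ given $H_i=k$ may depend on $k$ arbitrarily. With $X_i'=(1,X_i)$, assume $Y_i(w)=X_i'\theta^{(w)}+\varepsilon_i(w)$, $w\in\{0,1\}$, where $\varepsilon_i(w)\in L^2$ and, in every study, $E(\varepsilon_i(w)\mid X_i)=0$ and $V(\varepsilon_i(w)\mid X_i)=\sigma^2>0$. Let $\tau=E(Y(1)-Y(0))$ and $\tau_k=E(Y(1)-Y(0)\mid H=k)$. **Estimators** (from the first $n$ units). Let $n_k$, $n^{(w)}$, $n_k^{(w)}$ be the numbers of units in study $k$, in arm $w$, and in both; let $X'^{(w)},Y^{(w)}$ and $X_k'^{(w)},Y_k^{(w)}$ be the corresponding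 augmented design matrices and outcome vectors. Let $\hat\theta_{\rm pool}^{(w)}$ and $\hat\theta_k^{(w)}$ be the ordinary least squares estimators on $(X'^{(w)},Y^{(w)})$ and $(X_k'^{(w)},Y_k^{(w)})$, let $\Sigma_k^{(w)}=\sigma^2(X_k'^{(w)\top}X_k'^{(w)})^{-1}$, and $$\hat\theta_{\text{1S-SW}}^{(w)}=\sum_k\frac{n_k^{(w)}}{n^{(w)}}\hat\theta_k^{(w)},\qquad \hat\theta_{\text{1S-IVW}}^{(w)}=\Big(\sum_k(\Sigma_k^{(w)})^{-1}\Big)^{-1}\sum_k(\Sigma_k^{(w)})^{-1}\hat\theta_k^{(w)}.$$ $\hat\theta_{\rm GD}^{(w)}$ is the limit, as the number of rounds tends to infinity, of full-batch federated averaging on the mean squared error (weights $n_k^{(w)}/n^{(w)}$, one local step per round, arbitrary fixed initial value), with any measurable, possibly data-dependent, learning rate $0<\eta<2/L$, where $L$ is the largest eigenvalue of the Hessian $\frac{2}{n^{(w)}}X'^{(w)\top}X'^{(w)}$ of the pooled loss. Finally $\hat\tau_{\rm pool}=\frac1n\sum_i X_i'(\hat\theta_{\rm pool}^{(1)}-\hat\theta_{\rm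 pool}^{(0)})$, and for $a\in\{\text{GD},\text{1S-SW},\text{1S-IVW}\}$ $$\hat\tau_a=\sum_k\frac{n_k}{n}\cdot\frac1{n_k}\sum_{i:H_i=k}X_i'(\hat\theta_a^{(1)}-\hat\theta_a^{(0)}).$$ **Local Full Rank** ($\mathrm{LFR}_n$) is the event that $\operatorname{rank}(X_k'^{(w)\top}X_k'^{(w)})=d+1$ for all $k$ and $w$. Assume $P(\mathrm{LFR}_n)>0$ for some $n$. A *full rank design event* is an event $S$ with $P(S)>0$, determined by $(X_i,W_i,H_i)_{i\le n}$, on which $\mathrm{LFR}_n$ holds almost surely (for example $S=\mathrm{LFR}_n$). **Proposition.** One has $P(\mathrm{LFR}_n)\to1$, and the following hold. 1. *Unbiasedness.* Let $S$ be a full rank design event for the first $n$ units and let $a\in\{\text{1S-SW},\text{1S-IVW}\}$. - $E(\hat\theta_{a}^{(w)}\mid S)=\theta^{(w)}$, coordinate by coordinate, whenever the coordinate is integrable given $S$. - If $\hat\tau_a$ is integrable given $S$, then $E(\hat\tau_a\mid S)=E(m_n\mid S)$ with $m_n=\frac1n\sum_{i\le n}X_i'(\theta^{(1)}-\theta^{(0)})$;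 and, for $n\ge1$, $m_n$ is integrable with $E(m_n)=\tau$. - If $S$ is the event that the first $n$ units have a given allocation to studies and arms, and $\hat\tau_a$ is integrable given $S$, then $E(\hat\tau_a\mid S)=\sum_k\frac{n_k}{n}\tau_k$; and, for $n\ge1$, $E\big(\sum_k\frac{n_k}{n}\tau_k\big)=\tau$ over the unrestricted sampling of study labels. - If $S_n$ are full rank design events for all large $n$, $P(S_n)\to1$, and $\hat\tau_a$ is integrable given $S_n$ for all large $n$, then $E(\hat\tau_a\mid S_n)\to\tau$. 2. *Variance of the outcome parameters.* For $w\in\{0,1\}$ and every full rank design event $S$, with variances taken given $S$, $$V(\hat\theta^{(w)}_{\rm pool})=V(\hat\theta^{(w)}_{\rm GD})=V(\hat\theta^{(w)}_{\text{1S-IVW}})\preceq V(\hat\theta^{(w)}_{\text{1S-SW}})$$ in the Loewner order: for every vector $v$ the variances, in $[0,\infty]$, of $v^\top\hat\theta^{(w)}$ compare in this way; and if $\hat\theta^{(w)}_{\text{1S-SW}}$ has finite second moments given $S$, then so do the other three estimators, and the covariance matrices compare in this way. 3. *Asymptotic variance of the ATE estimators.* There are finite $V,V_{\rm SW}\ge0$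 with $V\le V_{\rm SW}$ such that $\sqrt n(\hat\tau-\tau)\to\mathcal N(0,V)$ in distribution for $\hat\tau=\hat\tau_{\rm pool},\hat\tau_{\rm GD},\hat\tau_{\text{1S-IVW}}$, and $\sqrt n(\hat\tau_{\text{1S-SW}}-\tau)\to\mathcal N(0,V_{\rm SW})$ in distribution. That is, $\mathbb V^\infty(\hat\tau_{\rm pool})=\mathbb V^\infty(\hat\tau_{\rm GD})=\mathbb V^\infty(\hat\tau_{\text{1S-IVW}})\le\mathbb V^\infty(\hat\tau_{\text{1S-SW}})$. -/

import Mathlib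

open MeasureTheory ProbabilityTheory Filter Topology Matrix
open scoped NNReal ENNReal

noncomputable section

/-- Covariate vector augmented with an intercept, `x' = (1, x)`. -/
def augment {d : ℕ} (x : Fin d → ℝ) : Fin (d + 1) → ℝ := Fin.cons 1 x

/-- A data set of `n` observed units: covariates, treatment arm, study, observed outcome. -/
structure Sample (n d K : ℕ) where
  x : Fin n → Fin d → ℝ
  arm : Fin n → Fin 2
  study : Fin n → Fin K
  y : Fin n → ℝ

/-- The two weightings used to federate the local outcome parameters. -/
inductive Federation where
  | SW
  | IVW

namespace Sample

variable {n d K : ℕ} (D : Sample n d K)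

/-- Units of study `k`; there are `n_k` of them. -/
def inStudy (k : Fin K) : Finset (Fin n) := {i | D.study i = k}

/-- Units in arm `w`; there are `n^(w)` of them. -/
def inArm (w : Fin 2) : Finset (Fin n) := {i | D.arm i = w}

/-- Units of study `k` in arm `w`; there are `n_k^(w)` of them. -/
def inCell (k : Fin K) (w : Fin 2) : Finset (Fin n) := {i | D.study i = k ∧ D.arm i = w}

/-- `X'ᵀ X'`, where `X'` is the augmented design matrix with rows indexed by `s`. -/
def gram (s : Finset (Fin n)) : Matrix (Fin (d + 1)) (Fin (d + 1)) ℝ :=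
  ∑ i ∈ s, vecMulVec (augment (D.x i)) (augment (D.x i))

/-- `X'ᵀ y` for the rows indexed by `s`. -/
def moment (s : Finset (Fin n)) : Fin (d + 1) → ℝ := ∑ i ∈ s, D.y i • augment (D.x i)

/-- Ordinary least squares on the rows indexed by `s`. -/
def ols (s : Finset (Fin n)) : Fin (d + 1) → ℝ := (D.gram s)⁻¹ *ᵥ D.moment s

/-- Every study and arm has an augmented design matrix of full column rank. -/
def LocalFullRank : Prop := ∀ k w, (D.gram (D.inCell k w)).rank = d + 1

def thetaPool (w : Fin 2) : Fin (d + 1) → ℝ := D.ols (D.inArm w)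

def thetaLocal (k : Fin K) (w : Fin 2) : Fin (d + 1) → ℝ := D.ols (D.inCell k w)

/-- Sampling covariance `σ² (X'ᵀ X')⁻¹` of the local estimate. -/
def localCov (σ : ℝ) (k : Fin K) (w : Fin 2) : Matrix (Fin (d + 1)) (Fin (d + 1)) ℝ :=
  σ ^ 2 • (D.gram (D.inCell k w))⁻¹

/-- One-shot federated outcome parameters. -/
def thetaOneShot (σ : ℝ) : Federation → Fin 2 → Fin (d + 1) → ℝ
  | .SW, w => ∑ k, (((D.inCell k w).card : ℝ) / (D.inArm w).card) • D.thetaLocal k w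
  | .IVW, w => (∑ k, (D.localCov σ k w)⁻¹)⁻¹ *ᵥ ∑ k, (D.localCov σ k w)⁻¹ *ᵥ D.thetaLocal k w

/-- Full-batch gradient `-(2/|s|) X'ᵀ (y - X' θ)` of the mean squared error on the rows `s`. -/
def mseGrad (s : Finset (Fin n)) (θ : Fin (d + 1) → ℝ) : Fin (d + 1) → ℝ :=
  -((2 / (s.card : ℝ)) • (D.moment s - D.gram s *ᵥ θ))

/-- `E` local gradient steps with learning rate `η` on the rows `s`. -/
def localUpdate (η : ℝ) (E : ℕ) (s : Finset (Fin n)) (θ : Fin (d + 1) → ℝ) : Fin (d + 1) → ℝ :=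
  (fun t => t - η • D.mseGrad s t)^[E] θ

/-- Federated averaging in arm `w`: `T` rounds of `E` local steps from the initial value `θ₀`. -/
def fedAvg (w : Fin 2) (η : ℝ) (E : ℕ) (θ₀ : Fin (d + 1) → ℝ) (T : ℕ) : Fin (d + 1) → ℝ :=
  (fun t => ∑ k, (((D.inCell k w).card : ℝ) / (D.inArm w).card) •
    D.localUpdate η E (D.inCell k w) t)^[T] θ₀

/-- `0 < η < 2 / L`, with `L` the smoothness constant of the pooled mean squared error in arm `w`,
that is, the largest eigenvalue of its Hessian `(2 / n^(w)) X'ᵀ X'`. -/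
def IsLearningRate (w : Fin 2) (η : ℝ) : Prop :=
  0 < η ∧ ∀ L : ℝ, Module.End.HasEigenvalue
    (Matrix.toLin' ((2 / ((D.inArm w).card : ℝ)) • D.gram (D.inArm w))) L → η * L < 2

/-- Output of federated averaging with one local step per round, as the number of rounds grows. -/
def thetaGD (η : Fin 2 → ℝ) (θ₀ : Fin (d + 1) → ℝ) (w : Fin 2) : Fin (d + 1) → ℝ :=
  limUnder atTop (D.fedAvg w (η w) 1 θ₀)

/-- Pooled G-formula estimate of the average treatment effect. -/
def tauPool : ℝ :=
  1 / (n : ℝ) * ∑ i, (augment (D.x i) ⬝ᵥ D.thetaPool 1 - augment (D.x i) ⬝ᵥ D.thetaPool 0)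

/-- Local treatment effect estimate in study `k` from given outcome parameters `t`. -/
def tauStudy (t : Fin 2 → Fin (d + 1) → ℝ) (k : Fin K) : ℝ :=
  1 / ((D.inStudy k).card : ℝ) *
    ∑ i ∈ D.inStudy k, (augment (D.x i) ⬝ᵥ t 1 - augment (D.x i) ⬝ᵥ t 0)

/-- Sample-size weighted aggregation of the local treatment effect estimates. -/
def tauFed (t : Fin 2 → Fin (d + 1) → ℝ) : ℝ :=
  ∑ k, ((D.inStudy k).card : ℝ) / n * D.tauStudy t k

def tauOneShot (σ : ℝ) (agg : Federation) : ℝ := D.tauFed (D.thetaOneShot σ agg)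

def tauGD (η : Fin 2 → ℝ) (θ₀ : Fin (d + 1) → ℝ) : ℝ := D.tauFed (D.thetaGD η θ₀)

end Sample

/-- The random variables of the trial: for unit `i`, covariates `X i`, treatment `W i`, study `H i`
and potential outcomes `Y i w` under the arms `w = 0, 1`. -/
structure Trial (Ω : Type*) (d K : ℕ) where
  X : ℕ → Ω → Fin d → ℝ
  W : ℕ → Ω → Fin 2
  H : ℕ → Ω → Fin K
  Y : ℕ → Fin 2 → Ω → ℝ

namespace Trial

variable {Ω : Type*} {d K : ℕ} (T : Trial Ω d K)

/-- Data set of the first `n` units; the observed outcome is the potential outcome under the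
treatment received. -/
def sample (n : ℕ) (ω : Ω) : Sample n d K where
  x i := T.X i ω
  arm i := T.W i ω
  study i := T.H i ω
  y i := T.Y i (T.W i ω) ω

/-- Noise of the linear model `Y(w) = c^(w) + X β^(w) + ε(w)`, `θ w = (c^(w), β^(w))`. -/
def noise (θ : Fin 2 → Fin (d + 1) → ℝ) (w : Fin 2) (ω : Ω) : ℝ :=
  T.Y 0 w ω - augment (T.X 0 ω) ⬝ᵥ θ w

variable [MeasurableSpace Ω]

/-- `K` Bernoulli trials whose covariate distributions may differ arbitrarily between studies, with
a common homoscedastic linear outcome model in each arm. Conditioning on study `k` means passing to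
the conditional probability given `H = k`. -/
structure IsCovariateShiftRCT (P : Measure Ω) (θ : Fin 2 → Fin (d + 1) → ℝ) (σ : ℝ) : Prop where
  measurable_X : ∀ i, Measurable (T.X i)
  measurable_W : ∀ i, Measurable (T.W i)
  measurable_H : ∀ i, Measurable (T.H i)
  measurable_Y : ∀ i w, Measurable (T.Y i w)
  indep : iIndepFun (fun i ω => (T.X i ω, T.W i ω, T.H i ω, fun w => T.Y i w ω)) P
  identDistrib : ∀ i, IdentDistrib
    (fun ω => (T.X i ω, T.W i ω, T.H i ω, fun w => T.Y i w ω))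
    (fun ω => (T.X 0 ω, T.W 0 ω, T.H 0 ω, fun w => T.Y 0 w ω)) P P
  study_pos : ∀ k, 0 < P (T.H 0 ⁻¹' {k})
  /-- Positivity: `0 < P(W = w | H = k)` for both arms. -/
  arm_pos : ∀ k w, 0 < P[|T.H 0 ⁻¹' {k}] (T.W 0 ⁻¹' {w})
  /-- Randomization within each study. -/
  randomized : ∀ k, IndepFun (T.W 0) (fun ω => (T.X 0 ω, fun w => T.Y 0 w ω)) P[|T.H 0 ⁻¹' {k}]
  memLp_X : MemLp (T.X 0) 2 P
  sigma_pos : 0 < σ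
  memLp_noise : ∀ w, MemLp (T.noise θ w) 2 P
  /-- `E(ε(w) | X) = 0` in every study. -/
  noise_mean : ∀ k w, (P[|T.H 0 ⁻¹' {k}])[T.noise θ w | MeasurableSpace.comap (T.X 0) inferInstance]
    =ᵐ[P[|T.H 0 ⁻¹' {k}]] fun _ => 0
  /-- `V(ε(w) | X) = σ²` in every study. -/
  noise_var : ∀ k w,
    (P[|T.H 0 ⁻¹' {k}])[fun ω => T.noise θ w ω ^ 2 | MeasurableSpace.comap (T.X 0) inferInstance]
    =ᵐ[P[|T.H 0 ⁻¹' {k}]] fun _ => σ ^ 2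

/-- Average treatment effect `E(Y(1) - Y(0))`. -/
def ate (P : Measure Ω) : ℝ := ∫ ω, (T.Y 0 1 ω - T.Y 0 0 ω) ∂P

/-- Average treatment effect `E(Y(1) - Y(0) | H = k)` of study `k`. -/
def studyATE (P : Measure Ω) (k : Fin K) : ℝ :=
  ∫ ω, (T.Y 0 1 ω - T.Y 0 0 ω) ∂(P[|T.H 0 ⁻¹' {k}])

/-- The event that local full rank holds for the first `n` units. -/
def fullRank (n : ℕ) : Set Ω := {ω | (T.sample n ω).LocalFullRank}

/-- The σ-algebra of the design `(X_i, W_i, H_i)`, `i < n`. -/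
abbrev design (n : ℕ) : MeasurableSpace Ω :=
  MeasurableSpace.comap (fun ω (i : Fin n) => (T.X i ω, T.W i ω, T.H i ω)) inferInstance

/-- An event of positive probability that is determined by the design of the first `n` units and on
which local full rank holds almost surely. -/
structure IsFullRankDesignEvent (P : Measure Ω) (n : ℕ) (S : Set Ω) : Prop where
  measurableSet : MeasurableSet[T.design n] S
  pos : P S ≠ 0
  fullRank : ∀ᵐ ω ∂P, ω ∈ S → ω ∈ T.fullRank n

/-- The event that the first `n` units are allocated to the studies `h` and the arms `a`. -/
def allocation (n : ℕ) (h : Fin n → Fin K) (a : Fin n → Fin 2) : Set Ω :=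
  {ω | ∀ i : Fin n, T.H i ω = h i ∧ T.W i ω = a i}

/-- Average over the first `n` units of the treatment effect `X'_i (θ 1 - θ 0)` given `X_i`. -/
def sampleATE (θ : Fin 2 → Fin (d + 1) → ℝ) (n : ℕ) (ω : Ω) : ℝ :=
  1 / (n : ℝ) * ∑ i : Fin n, augment (T.X i ω) ⬝ᵥ (θ 1 - θ 0)

end Trial

/-- Covariance matrix of a random vector. -/
def covMatrix {Ω : Type*} [MeasurableSpace Ω] {m : ℕ} (t : Ω → Fin m → ℝ) (Q : Measure Ω) :
    Matrix (Fin m) (Fin m) ℝ :=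
  Matrix.of fun i j => covariance (fun ω => t ω i) (fun ω => t ω j) Q

/-- `√n (t n - τ)` converges in distribution to the normal law with mean `0` and variance `V`. -/
def HasAsymptoticVariance {Ω : Type*} [MeasurableSpace Ω] (P : Measure Ω) [IsProbabilityMeasure P]
    (t : ℕ → Ω → ℝ) (τ : ℝ) (V : ℝ≥0) : Prop :=
  TendstoInDistribution (fun (n : ℕ) ω => Real.sqrt n * (t n ω - τ)) atTop (id : ℝ → ℝ)
    (fun _ => P) (gaussianReal 0 V)

end

set_option linter.unusedSectionVars false

/-! On the full rank event every estimator is the truth plus a linear combination of residuals. In a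
direction `v`, a one-shot estimate equals `v ⬝ᵥ θ w` plus a sum of `c i * residual i`, where `c i`
depends on the design `(X, W, H)` alone (`IsCovariateShiftRCT.dotProduct_thetaOneShot`). Given the
design, the residuals have mean zero, variance `σ ^ 2` and vanishing correlations
(`condExp_residual`, `condExp_residual_sq`, `condExp_residual_mul`): randomization within studies
transfers the assumptions on `ε(w)` to the observed arm, and independence of units does the rest.
Unbiasedness follows, and the variance is the mean of `σ ^ 2 * ∑ c i ^ 2`. The coefficients contain
inverse Gram matrices without assumed moments, so these identities are proved on events where the
coefficients are bounded and then passed to the limit; variances live in `[0, ∞]`.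

Three of the estimators coincide on full rank. Inverse variance weights are `σ⁻²` times the local
Gram matrices, so the local normal equations add up to the pooled ones. One local step per round,
averaged over studies, is one gradient step on the pooled loss, which contracts to the pooled
minimizer. The comparison with sample-size weights is the Gauss–Markov inequality
`Matrix.sum_dotProduct_inv_sum_le`, applied design by design.

The federated treatment effect uses the random direction `meanX`, which is again determined by the
design, so the finite sample argument persists. For the asymptotics, `n` times the coefficients
converge almost surely by the law of large numbers. Replacing them by their limits costs a
normalized residual sum with vanishing coefficients. Since those coefficients depend on the whole
sample, the cost is bounded by their size times one scale `noiseScale` that is bounded in `L²`,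
hence it vanishes in probability. The central limit theorem for the influence function then gives
the normal limit, whose variance is a common term plus a quadratic form in the limit coefficients.
The same Gauss–Markov inequality, now with expected Gram matrices, compares the two variances. -/

/-! ### Matrices: contraction of gradient descent and the Gauss–Markov inequality. -/

theorem Matrix.IsSymm.inv_mulVec_dotProduct {m : Type*} [Fintype m] [DecidableEq m]
    {A : Matrix m m ℝ} (hA : A.IsSymm) (u v : m → ℝ) : (A⁻¹ *ᵥ u) ⬝ᵥ v = u ⬝ᵥ (A⁻¹ *ᵥ v) := by
  rw [dotProduct_mulVec, ← mulVec_transpose, hA.inv.eq]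

theorem Matrix.PosDef.isUnit_det {m : Type*} [Fintype m] [DecidableEq m]
    {A : Matrix m m ℝ} (hA : A.PosDef) : IsUnit A.det :=
  (A.isUnit_iff_isUnit_det).1 hA.isUnit

/-- Gradient descent for a positive definite quadratic form with a small enough step contracts. -/
theorem Matrix.PosDef.tendsto_iterate_sub_smul_mulVec {m : Type*} [Fintype m] [DecidableEq m]
    {A : Matrix m m ℝ} (hA : A.PosDef) {η : ℝ} (hη : 0 < η)
    (hlt : ∀ L : ℝ, Module.End.HasEigenvalue (Matrix.toLin' A) L → η * L < 2) (u : m → ℝ) :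
    Tendsto (fun N => (fun t => t - η • A *ᵥ t)^[N] u) atTop (𝓝 0) := by
  have hH := hA.isHermitian
  set b := hH.eigenvectorBasis
  set c : m → ℝ := fun j => b.repr (WithLp.toLp 2 u) j
  set lam := hH.eigenvalues
  have hu : u = ∑ j, c j • (b j).ofLp := by
    have := congrArg WithLp.ofLp (b.sum_repr (WithLp.toLp 2 u))
    simpa [c] using this.symm
  -- In an eigenbasis of `A` each step multiplies coordinate `j` by `1 - η * lam j`.
  have hiter : ∀ N, (fun t => t - η • A *ᵥ t)^[N] u
      = ∑ j, ((1 - η * lam j) ^ N * c j) • (b j).ofLp := by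
    intro N
    induction N with
    | zero => simpa using hu
    | succ N ih =>
      rw [Function.iterate_succ_apply', ih, Matrix.mulVec_sum, Finset.smul_sum,
        ← Finset.sum_sub_distrib]
      refine Finset.sum_congr rfl fun j _ => ?_
      rw [Matrix.mulVec_smul, hH.mulVec_eigenvectorBasis j]
      ext i
      simp only [Pi.sub_apply, Pi.smul_apply, smul_eq_mul, b, lam]
      ring
  have hlam : ∀ j, |1 - η * lam j| < 1 := by
    intro j
    have h0 : 0 < lam j := hA.eigenvalues_pos j
    have h2 : η * lam j < 2 := by
      refine hlt _ (Module.End.hasEigenvalue_of_hasEigenvector (x := (b j).ofLp) ⟨?_, ?_⟩)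
      · rw [Module.End.mem_eigenspace_iff, Matrix.toLin'_apply]
        exact hH.mulVec_eigenvectorBasis j
      · intro h
        have hb := b.orthonormal.ne_zero j
        exact hb (by ext i; simpa using congrFun h i)
    rw [abs_lt]
    constructor <;> nlinarith [mul_pos hη h0]
  simp_rw [hiter]
  have : Tendsto (fun N => ∑ j, ((1 - η * lam j) ^ N * c j) • (b j).ofLp) atTop
      (𝓝 (∑ j, ((0 : ℝ) * c j) • (b j).ofLp)) :=
    tendsto_finsetSum _ fun j _ =>
      ((tendsto_pow_atTop_nhds_zero_of_abs_lt_one (hlam j)).mul_const _).smul_const _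
  simpa using this

/-- **Gauss–Markov**: among the combinations `∑ k, c k • (M k)⁻¹ *ᵥ v` with `∑ k, c k = 1`, none has
a smaller quadratic form than the inverse variance weighted one. -/
theorem Matrix.sum_dotProduct_inv_sum_le {ι m : Type*} [Fintype ι] [Nonempty ι] [Fintype m]
    [DecidableEq m] {M : ι → Matrix m m ℝ} (hM : ∀ k, (M k).PosDef) {c : ι → ℝ}
    (hc : ∑ k, c k = 1) (v : m → ℝ) :
    ∑ k, ((∑ k, M k)⁻¹ *ᵥ v) ⬝ᵥ M k *ᵥ ((∑ k, M k)⁻¹ *ᵥ v) ≤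
      ∑ k, (c k • (M k)⁻¹ *ᵥ v) ⬝ᵥ M k *ᵥ (c k • (M k)⁻¹ *ᵥ v) := by
  have hS : (∑ k, M k).PosDef :=
    Matrix.posDef_sum Finset.univ_nonempty fun k _ => hM k
  set u := (∑ k, M k)⁻¹ *ᵥ v with hu
  -- With `a k` for the vector `c k • (M k)⁻¹ *ᵥ v`, the cross terms `u ⬝ᵥ M k *ᵥ a k` sum to `u ⬝ᵥ
  -- v`, and so do the terms `u ⬝ᵥ M k *ᵥ u`. Hence the gap between the two sides is the sum of the
  -- forms `M k` at `a k - u`.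
  have hMu : ∀ k, M k *ᵥ (c k • (M k)⁻¹ *ᵥ v) = c k • v := fun k => by
    rw [Matrix.mulVec_smul, Matrix.mulVec_mulVec, Matrix.mul_nonsing_inv _ (hM k).isUnit_det,
      Matrix.one_mulVec]
  have h1 : ∑ k, u ⬝ᵥ M k *ᵥ (c k • (M k)⁻¹ *ᵥ v) = u ⬝ᵥ v := by
    simp_rw [hMu, dotProduct_smul, smul_eq_mul]
    rw [← Finset.sum_mul, hc, one_mul]
  have h2 : ∑ k, u ⬝ᵥ M k *ᵥ u = u ⬝ᵥ v := by
    rw [← dotProduct_sum, ← Matrix.sum_mulVec]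
    conv_lhs => rw [hu]
    rw [Matrix.mulVec_mulVec, Matrix.mul_nonsing_inv _ hS.isUnit_det, Matrix.one_mulVec]
  have h3 : ∀ k, u ⬝ᵥ M k *ᵥ (c k • (M k)⁻¹ *ᵥ v) = (c k • (M k)⁻¹ *ᵥ v) ⬝ᵥ M k *ᵥ u := by
    intro k
    have hs : (M k)ᵀ = M k := by simpa [Matrix.IsHermitian] using (hM k).isHermitian
    rw [dotProduct_mulVec, ← mulVec_transpose, hs, dotProduct_comm]
  have h4 : 0 ≤ ∑ k, (c k • (M k)⁻¹ *ᵥ v - u) ⬝ᵥ M k *ᵥ (c k • (M k)⁻¹ *ᵥ v - u) :=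
    Finset.sum_nonneg fun k _ => by
      simpa using (hM k).posSemidef.dotProduct_mulVec_nonneg (c k • (M k)⁻¹ *ᵥ v - u)
  simp only [Matrix.mulVec_sub, dotProduct_sub, sub_dotProduct, Finset.sum_sub_distrib, ← h3] at h4
  linarith

/-! ### A fixed sample: normal equations, linear representation, agreement of estimators. -/

namespace Sample

variable {n d K : ℕ} (D : Sample n d K)

theorem gram_mulVec (s : Finset (Fin n)) (v : Fin (d + 1) → ℝ) :
    D.gram s *ᵥ v = ∑ i ∈ s, (augment (D.x i) ⬝ᵥ v) • augment (D.x i) := by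
  simp [gram, Matrix.sum_mulVec, Matrix.vecMulVec_mulVec]

theorem dotProduct_gram_mulVec (s : Finset (Fin n)) (u v : Fin (d + 1) → ℝ) :
    u ⬝ᵥ D.gram s *ᵥ v = ∑ i ∈ s, (u ⬝ᵥ augment (D.x i)) * (v ⬝ᵥ augment (D.x i)) := by
  rw [gram_mulVec, dotProduct_sum]
  refine Finset.sum_congr rfl fun i _ => ?_
  rw [dotProduct_smul, smul_eq_mul, dotProduct_comm v]
  ring

theorem gram_isSymm (s : Finset (Fin n)) : (D.gram s).IsSymm := by
  ext i j
  simp [gram, Matrix.sum_apply, vecMulVec_apply, mul_comm]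

theorem gram_posSemidef (s : Finset (Fin n)) : (D.gram s).PosSemidef := by
  refine Matrix.posSemidef_sum s fun i _ => ?_
  simpa using Matrix.posSemidef_vecMulVec_self_star (augment (D.x i))

/-- Full rank makes the matrix surjective, hence invertible, and an invertible positive semidefinite
matrix is positive definite. -/
theorem gram_posDef_of_rank {s : Finset (Fin n)} (h : (D.gram s).rank = d + 1) :
    (D.gram s).PosDef := by
  refine ((D.gram_posSemidef s).posDef_iff_isUnit).2 ?_
  rw [← Matrix.mulVec_surjective_iff_isUnit]
  have : LinearMap.range (D.gram s).mulVecLin = ⊤ := by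
    apply Submodule.eq_top_of_finrank_eq
    simpa [Matrix.rank] using h
  exact LinearMap.range_eq_top.1 this

theorem sum_inArm {M : Type*} [AddCommMonoid M] (w : Fin 2) (f : Fin n → M) :
    ∑ i ∈ D.inArm w, f i = ∑ k, ∑ i ∈ D.inCell k w, f i := by
  rw [← Finset.sum_fiberwise (D.inArm w) D.study f]
  refine Finset.sum_congr rfl fun k _ => Finset.sum_congr ?_ fun _ _ => rfl
  ext i
  simp [inArm, inCell, and_comm]

theorem gram_inArm (w : Fin 2) : D.gram (D.inArm w) = ∑ k, D.gram (D.inCell k w) :=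
  D.sum_inArm w _

theorem moment_inArm (w : Fin 2) : D.moment (D.inArm w) = ∑ k, D.moment (D.inCell k w) :=
  D.sum_inArm w _

theorem card_inArm (w : Fin 2) :
    ((D.inArm w).card : ℝ) = ∑ k, ((D.inCell k w).card : ℝ) := by
  simpa using D.sum_inArm w (fun _ => (1 : ℝ))

theorem card_inCell_pos {k : Fin K} {w : Fin 2} (h : (D.gram (D.inCell k w)).rank = d + 1) :
    0 < ((D.inCell k w).card : ℝ) := by
  rw [Nat.cast_pos, Finset.card_pos, Finset.nonempty_iff_ne_empty]
  intro h0
  simp [h0, gram] at h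

variable {D}

theorem LocalFullRank.posDef_inCell (h : D.LocalFullRank) (k : Fin K) (w : Fin 2) :
    (D.gram (D.inCell k w)).PosDef := D.gram_posDef_of_rank (h k w)

theorem LocalFullRank.posDef_inArm [NeZero K] (h : D.LocalFullRank) (w : Fin 2) :
    (D.gram (D.inArm w)).PosDef := by
  refine Matrix.PosDef.of_dotProduct_mulVec_pos (D.gram_posSemidef _).isHermitian fun v hv => ?_
  rw [gram_inArm, Matrix.sum_mulVec, dotProduct_sum]
  exact Finset.sum_pos (fun k _ => (h.posDef_inCell k w).dotProduct_mulVec_pos hv)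
    ⟨0, Finset.mem_univ _⟩

theorem LocalFullRank.card_inArm_pos [NeZero K] (h : D.LocalFullRank) (w : Fin 2) :
    0 < ((D.inArm w).card : ℝ) := by
  rw [card_inArm]
  exact Finset.sum_pos (fun k _ => D.card_inCell_pos (h k w)) ⟨0, Finset.mem_univ _⟩

variable (D)

/-- Coefficient vectors that express a federated least squares estimate in direction `v` as a
linear combination of the outcomes: unit `i` of study `k` in arm `w` has coefficient
`weight agg w k v ⬝ᵥ augment (x i)`. -/
noncomputable def weight : Federation → Fin 2 → Fin K → (Fin (d + 1) → ℝ) → Fin (d + 1) → ℝ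
  | .SW, w, k, v => (((D.inCell k w).card : ℝ) / (D.inArm w).card) • (D.gram (D.inCell k w))⁻¹ *ᵥ v
  | .IVW, w, _, v => (D.gram (D.inArm w))⁻¹ *ᵥ v

/-- The vector `t` is arbitrary here; at the true parameter the last sum carries only noise. -/
theorem moment_eq (s : Finset (Fin n)) (t : Fin (d + 1) → ℝ) :
    D.moment s = D.gram s *ᵥ t + ∑ i ∈ s, (D.y i - augment (D.x i) ⬝ᵥ t) • augment (D.x i) := by
  rw [gram_mulVec, ← Finset.sum_add_distrib, moment]
  refine Finset.sum_congr rfl fun i _ => ?_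
  rw [← add_smul]
  congr 1
  ring

/-- Symmetry of the Gram matrix moves its inverse onto `v`, so that the residuals enter with
coefficients free of outcomes. -/
theorem dotProduct_ols {s : Finset (Fin n)} (h : IsUnit (D.gram s).det) (v t : Fin (d + 1) → ℝ) :
    v ⬝ᵥ D.ols s = v ⬝ᵥ t + ∑ i ∈ s, (((D.gram s)⁻¹ *ᵥ v) ⬝ᵥ augment (D.x i)) *
      (D.y i - augment (D.x i) ⬝ᵥ t) := by
  rw [ols, D.moment_eq s t, Matrix.mulVec_add, Matrix.mulVec_mulVec, Matrix.nonsing_inv_mul _ h,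
    Matrix.one_mulVec, dotProduct_add, ← (D.gram_isSymm s).inv_mulVec_dotProduct, dotProduct_sum]
  congr 1
  refine Finset.sum_congr rfl fun i _ => ?_
  rw [dotProduct_smul, smul_eq_mul, mul_comm]

variable {D}

/-- The inverse local covariance is `σ⁻²` times the local Gram matrix, and the latter turns the
local estimate back into its moment vector. Grams and moments add over studies, and the powers of
`σ` cancel. -/
theorem LocalFullRank.thetaOneShot_IVW [NeZero K] (h : D.LocalFullRank) {σ : ℝ} (hσ : 0 < σ)
    (w : Fin 2) : D.thetaOneShot σ .IVW w = D.thetaPool w := by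
  have h1 : ∀ k, (D.localCov σ k w)⁻¹ = (σ ^ 2)⁻¹ • D.gram (D.inCell k w) := by
    intro k
    have hu := (h.posDef_inCell k w).isUnit_det
    apply Matrix.inv_eq_left_inv
    rw [localCov, Matrix.smul_mul, Matrix.mul_smul, smul_smul, Matrix.mul_nonsing_inv _ hu,
      inv_mul_cancel₀ (by positivity), one_smul]
  have hs : (∑ k, (D.localCov σ k w)⁻¹)⁻¹ = σ ^ 2 • (D.gram (D.inArm w))⁻¹ := by
    apply Matrix.inv_eq_left_inv
    simp_rw [h1]
    rw [← Finset.smul_sum, ← gram_inArm, Matrix.smul_mul, Matrix.mul_smul, smul_smul,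
      Matrix.nonsing_inv_mul _ (h.posDef_inArm w).isUnit_det, mul_inv_cancel₀ (by positivity),
      one_smul]
  have hk : ∀ k, (D.localCov σ k w)⁻¹ *ᵥ D.thetaLocal k w =
      (σ ^ 2)⁻¹ • D.moment (D.inCell k w) := by
    intro k
    rw [h1, thetaLocal, ols, Matrix.smul_mulVec, Matrix.mulVec_mulVec,
      Matrix.mul_nonsing_inv _ (h.posDef_inCell k w).isUnit_det, Matrix.one_mulVec]
  simp_rw [thetaOneShot, hk, hs]
  rw [← Finset.smul_sum, ← moment_inArm, Matrix.smul_mulVec, Matrix.mulVec_smul, smul_smul,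
    mul_inv_cancel₀ (by positivity), one_smul, thetaPool, ols]

/-- For sample-size weights the term `v ⬝ᵥ t` survives unchanged because the shares of the studies
in an arm sum to one. -/
theorem LocalFullRank.dotProduct_thetaOneShot [NeZero K] (h : D.LocalFullRank) {σ : ℝ}
    (hσ : 0 < σ) (agg : Federation) (w : Fin 2) (v t : Fin (d + 1) → ℝ) :
    v ⬝ᵥ D.thetaOneShot σ agg w = v ⬝ᵥ t + ∑ i ∈ D.inArm w,
      (D.weight agg w (D.study i) v ⬝ᵥ augment (D.x i)) * (D.y i - augment (D.x i) ⬝ᵥ t) := by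
  cases agg with
  | IVW =>
    rw [h.thetaOneShot_IVW hσ]
    exact D.dotProduct_ols (h.posDef_inArm w).isUnit_det v t
  | SW =>
    have h1 : ∑ k, ((D.inCell k w).card : ℝ) / (D.inArm w).card = 1 := by
      rw [← Finset.sum_div, ← card_inArm, div_self (h.card_inArm_pos w).ne']
    rw [thetaOneShot, dotProduct_sum, sum_inArm]
    conv_rhs => rw [← one_mul (v ⬝ᵥ t), ← h1, Finset.sum_mul, ← Finset.sum_add_distrib]
    refine Finset.sum_congr rfl fun k _ => ?_
    rw [dotProduct_smul, thetaLocal, D.dotProduct_ols (h.posDef_inCell k w).isUnit_det v t,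
      smul_eq_mul, mul_add, Finset.mul_sum]
    congr 1
    refine Finset.sum_congr rfl fun i hi => ?_
    have hk : D.study i = k := by simp only [inCell, Finset.mem_filter] at hi; exact hi.2.1
    rw [weight, hk, smul_dotProduct, smul_eq_mul, mul_assoc]

theorem sum_sq_weight (agg : Federation) (w : Fin 2) (v : Fin (d + 1) → ℝ) :
    ∑ i ∈ D.inArm w, (D.weight agg w (D.study i) v ⬝ᵥ augment (D.x i)) ^ 2 =
      ∑ k, D.weight agg w k v ⬝ᵥ D.gram (D.inCell k w) *ᵥ D.weight agg w k v := by
  rw [sum_inArm]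
  refine Finset.sum_congr rfl fun k _ => ?_
  rw [dotProduct_gram_mulVec]
  refine Finset.sum_congr rfl fun i hi => ?_
  have hk : D.study i = k := by simp only [inCell, Finset.mem_filter] at hi; exact hi.2.1
  rw [hk, sq]

/-- Gauss–Markov with the local Gram matrices as `M k` and the shares of the studies in the arm as
`c k`. -/
theorem LocalFullRank.sum_sq_weight_le [NeZero K] (h : D.LocalFullRank) (w : Fin 2)
    (v : Fin (d + 1) → ℝ) :
    ∑ i ∈ D.inArm w, (D.weight .IVW w (D.study i) v ⬝ᵥ augment (D.x i)) ^ 2 ≤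
      ∑ i ∈ D.inArm w, (D.weight .SW w (D.study i) v ⬝ᵥ augment (D.x i)) ^ 2 := by
  rw [sum_sq_weight, sum_sq_weight]
  simp only [weight]
  rw [gram_inArm]
  refine Matrix.sum_dotProduct_inv_sum_le (fun k => h.posDef_inCell k w) ?_ v
  rw [← Finset.sum_div, ← card_inArm, div_self (h.card_inArm_pos w).ne']

/-- The deviation from the pooled estimate evolves by `t ↦ t - η • A *ᵥ t`, where `A` is the Hessian
of the pooled loss. -/
theorem LocalFullRank.thetaGD_eq [NeZero K] (h : D.LocalFullRank) {η : Fin 2 → ℝ} {w : Fin 2}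
    (hη : D.IsLearningRate w (η w)) (θ₀ : Fin (d + 1) → ℝ) :
    D.thetaGD η θ₀ w = D.thetaPool w := by
  have hw := h.card_inArm_pos w
  set A : Matrix (Fin (d + 1)) (Fin (d + 1)) ℝ :=
    (2 / ((D.inArm w).card : ℝ)) • D.gram (D.inArm w) with hA
  have hApos : A.PosDef := (h.posDef_inArm w).smul (by positivity)
  have hG : D.gram (D.inArm w) *ᵥ D.thetaPool w = D.moment (D.inArm w) := by
    rw [thetaPool, ols, Matrix.mulVec_mulVec,
      Matrix.mul_nonsing_inv _ (h.posDef_inArm w).isUnit_det, Matrix.one_mulVec]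
  have hstep : ∀ t, ∑ k, (((D.inCell k w).card : ℝ) / (D.inArm w).card) •
      D.localUpdate (η w) 1 (D.inCell k w) t =
      D.thetaPool w + ((t - D.thetaPool w) - η w • A *ᵥ (t - D.thetaPool w)) := by
    intro t
    -- The aggregation weight cancels the factor `1 / n_k^(w)` of the local gradient; this needs a
    -- nonempty cell.
    have hk : ∀ k, (((D.inCell k w).card : ℝ) / (D.inArm w).card) •
        D.localUpdate (η w) 1 (D.inCell k w) t =
        (((D.inCell k w).card : ℝ) / (D.inArm w).card) • t + (η w * (2 / (D.inArm w).card)) •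
          (D.moment (D.inCell k w) - D.gram (D.inCell k w) *ᵥ t) := by
      intro k
      have hc := D.card_inCell_pos (h k w)
      ext i
      simp only [localUpdate, Function.iterate_one, mseGrad, Pi.smul_apply, Pi.sub_apply,
        Pi.neg_apply, Pi.add_apply, smul_eq_mul]
      field_simp
      ring
    simp_rw [hk]
    rw [Finset.sum_add_distrib, ← Finset.sum_smul, ← Finset.sum_div, ← card_inArm,
      div_self hw.ne', one_smul, ← Finset.smul_sum, Finset.sum_sub_distrib, ← moment_inArm,
      ← Matrix.sum_mulVec, ← gram_inArm, hA, Matrix.smul_mulVec, Matrix.mulVec_sub, hG]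
    ext i
    simp only [Pi.smul_apply, Pi.sub_apply, Pi.add_apply, smul_eq_mul]
    ring
  have hiter : ∀ N, D.fedAvg w (η w) 1 θ₀ N = D.thetaPool w +
      (fun t => t - η w • A *ᵥ t)^[N] (θ₀ - D.thetaPool w) := by
    intro N
    induction N with
    | zero => simp [fedAvg]
    | succ N ih =>
      rw [fedAvg, Function.iterate_succ_apply', ← fedAvg, ih, hstep, Function.iterate_succ_apply']
      simp
  refine Tendsto.limUnder_eq ?_
  have := (hApos.tendsto_iterate_sub_smul_mulVec hη.1 hη.2 (θ₀ - D.thetaPool w)).const_add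
    (D.thetaPool w)
  rw [add_zero] at this
  exact this.congr fun N => (hiter N).symm

variable (D)

/-- The weight `n_k / n` cancels the local average `1 / n_k`; an empty study contributes zero to
both sides. -/
theorem tauFed_eq (t : Fin 2 → Fin (d + 1) → ℝ) :
    D.tauFed t = 1 / (n : ℝ) * ∑ i, augment (D.x i) ⬝ᵥ (t 1 - t 0) := by
  rw [← Finset.sum_fiberwise Finset.univ D.study, Finset.mul_sum, tauFed]
  refine Finset.sum_congr rfl fun k _ => ?_
  have hf : Finset.univ.filter (fun i => D.study i = k) = D.inStudy k := rfl
  rw [hf, tauStudy]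
  simp_rw [dotProduct_sub]
  rcases Finset.eq_empty_or_nonempty (D.inStudy k) with h0 | h0
  · simp [h0]
  · have : ((D.inStudy k).card : ℝ) ≠ 0 := by
      exact_mod_cast (Finset.card_pos.2 h0).ne'
    field_simp

theorem tauPool_eq : D.tauPool = D.tauFed D.thetaPool := by
  rw [tauFed_eq, tauPool]
  simp_rw [dotProduct_sub]

end Sample

/-! ### Measurability of the estimators. -/

section MatrixMeasurability

variable {Ω m : Type*} [MeasurableSpace Ω] [Fintype m] [DecidableEq m]

theorem Measurable.matrix_det {A : Ω → Matrix m m ℝ} (hA : ∀ i j, Measurable fun ω => A ω i j) :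
    Measurable fun ω => (A ω).det := by
  simp_rw [Matrix.det_apply']
  exact Finset.measurable_fun_sum _ fun p _ =>
    (Finset.measurable_fun_prod _ fun i _ => hA _ _).const_mul _

/-- Cramer's rule: determinant and adjugate are polynomial in the entries, and the formula also
covers singular matrices, where the inverse is zero by convention. -/
theorem Measurable.matrix_inv {A : Ω → Matrix m m ℝ} (hA : ∀ i j, Measurable fun ω => A ω i j)
    (i j : m) : Measurable fun ω => (A ω)⁻¹ i j := by
  simp_rw [Matrix.inv_def, Ring.inverse_eq_inv', Matrix.smul_apply, Matrix.adjugate_apply]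
  refine (Measurable.matrix_det hA).inv.smul (Measurable.matrix_det fun a b => ?_)
  by_cases h : a = j
  · subst h; simp
  · simpa [Matrix.updateRow_ne h] using hA a b

theorem Measurable.dotProduct {Ω m : Type*} [MeasurableSpace Ω] [Fintype m] {u v : Ω → m → ℝ}
    (hu : Measurable u) (hv : Measurable v) :
    Measurable fun ω => u ω ⬝ᵥ v ω :=
  Finset.measurable_fun_sum _ fun i _ =>
    ((measurable_pi_apply i).comp hu).mul ((measurable_pi_apply i).comp hv)

theorem Measurable.matrix_mulVec {Ω m : Type*} [MeasurableSpace Ω] [Fintype m]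
    {A : Ω → Matrix m m ℝ} {v : Ω → m → ℝ}
    (hA : ∀ i j, Measurable fun ω => A ω i j) (hv : Measurable v) :
    Measurable fun ω => A ω *ᵥ v ω :=
  measurable_pi_lambda _ fun i => Measurable.dotProduct (measurable_pi_lambda _ (hA i)) hv

end MatrixMeasurability

theorem measurable_augment {d : ℕ} : Measurable (augment : (Fin d → ℝ) → Fin (d + 1) → ℝ) := by
  refine measurable_pi_lambda _ fun j => ?_
  refine Fin.cases ?_ (fun j => ?_) j
  · simp [augment]
  · simpa [augment] using measurable_pi_apply j

/-- Random samples whose covariates, arms and studies are measurable. -/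
structure MeasurableDesign {Ω : Type*} [MeasurableSpace Ω] {n d K : ℕ} (D : Ω → Sample n d K) :
    Prop where
  x : ∀ i, Measurable fun ω => (D ω).x i
  arm : ∀ i, Measurable fun ω => (D ω).arm i
  study : ∀ i, Measurable fun ω => (D ω).study i

namespace MeasurableDesign

variable {Ω : Type*} [MeasurableSpace Ω] {n d K : ℕ} {D : Ω → Sample n d K}

theorem measurable_sum_inCell (hD : MeasurableDesign D) (k : Fin K) (w : Fin 2)
    {f : Fin n → Ω → ℝ} (hf : ∀ i, Measurable (f i)) :
    Measurable fun ω => ∑ i ∈ (D ω).inCell k w, f i ω := by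
  simp_rw [Sample.inCell, Finset.sum_filter]
  refine Finset.measurable_fun_sum _ fun i _ => Measurable.ite ?_ (hf i) measurable_const
  exact (hD.study i (measurableSet_singleton k)).inter (hD.arm i (measurableSet_singleton w))

theorem measurable_sum_inArm (hD : MeasurableDesign D) (w : Fin 2)
    {f : Fin n → Ω → ℝ} (hf : ∀ i, Measurable (f i)) :
    Measurable fun ω => ∑ i ∈ (D ω).inArm w, f i ω := by
  simp_rw [Sample.sum_inArm]
  exact Finset.measurable_fun_sum _ fun k _ => hD.measurable_sum_inCell k w hf

theorem measurable_card_inCell (hD : MeasurableDesign D) (k : Fin K) (w : Fin 2) :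
    Measurable fun ω => (((D ω).inCell k w).card : ℝ) := by
  simpa using hD.measurable_sum_inCell k w (f := fun _ _ => 1) fun _ => measurable_const

theorem measurable_card_inArm (hD : MeasurableDesign D) (w : Fin 2) :
    Measurable fun ω => (((D ω).inArm w).card : ℝ) := by
  simpa using hD.measurable_sum_inArm w (f := fun _ _ => 1) fun _ => measurable_const

theorem measurable_augment (hD : MeasurableDesign D) (i : Fin n) :
    Measurable fun ω => augment ((D ω).x i) :=
  _root_.measurable_augment.comp (hD.x i)

theorem measurable_augment_apply (hD : MeasurableDesign D) (i : Fin n) (j : Fin (d + 1)) :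
    Measurable fun ω => augment ((D ω).x i) j :=
  (measurable_pi_apply j).comp (hD.measurable_augment i)

theorem measurable_gram_inCell (hD : MeasurableDesign D) (k : Fin K) (w : Fin 2)
    (a b : Fin (d + 1)) : Measurable fun ω => (D ω).gram ((D ω).inCell k w) a b := by
  simp_rw [Sample.gram, Matrix.sum_apply, vecMulVec_apply]
  exact hD.measurable_sum_inCell k w fun i =>
    (hD.measurable_augment_apply i a).mul (hD.measurable_augment_apply i b)

theorem measurable_gram_inArm (hD : MeasurableDesign D) (w : Fin 2)
    (a b : Fin (d + 1)) : Measurable fun ω => (D ω).gram ((D ω).inArm w) a b := by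
  simp_rw [Sample.gram_inArm, Matrix.sum_apply]
  exact Finset.measurable_fun_sum _ fun k _ => hD.measurable_gram_inCell k w a b

theorem measurable_weight (hD : MeasurableDesign D) (agg : Federation) (w : Fin 2) (k : Fin K)
    {v : Ω → Fin (d + 1) → ℝ} (hv : Measurable v) :
    Measurable fun ω => (D ω).weight agg w k (v ω) := by
  cases agg with
  | SW =>
    exact ((hD.measurable_card_inCell k w).div (hD.measurable_card_inArm w)).smul
      (Measurable.matrix_mulVec (Measurable.matrix_inv (hD.measurable_gram_inCell k w)) hv)
  | IVW => exact Measurable.matrix_mulVec (Measurable.matrix_inv (hD.measurable_gram_inArm w)) hv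

/-- The study is a random index, so the expression is split over its finitely many values. -/
theorem measurable_weight_study (hD : MeasurableDesign D) (agg : Federation) (w : Fin 2)
    (i : Fin n) {v : Ω → Fin (d + 1) → ℝ} (hv : Measurable v) :
    Measurable fun ω => (D ω).weight agg w ((D ω).study i) (v ω) := by
  have : (fun ω => (D ω).weight agg w ((D ω).study i) (v ω)) =
      fun ω => ∑ k, if (D ω).study i = k then (D ω).weight agg w k (v ω) else 0 := by
    funext ω; simp
  rw [this]
  exact Finset.measurable_fun_sum _ fun k _ => Measurable.ite
    (hD.study i (measurableSet_singleton k)) (hD.measurable_weight agg w k hv) measurable_const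

theorem measurable_moment_inCell (hD : MeasurableDesign D) (hy : ∀ i, Measurable fun ω => (D ω).y i)
    (k : Fin K) (w : Fin 2) :
    Measurable fun ω => (D ω).moment ((D ω).inCell k w) := by
  refine measurable_pi_lambda _ fun a => ?_
  simp_rw [Sample.moment, Finset.sum_apply, Pi.smul_apply, smul_eq_mul]
  exact hD.measurable_sum_inCell k w fun i => (hy i).mul (hD.measurable_augment_apply i a)

theorem measurable_thetaLocal (hD : MeasurableDesign D) (hy : ∀ i, Measurable fun ω => (D ω).y i)
    (k : Fin K) (w : Fin 2) :
    Measurable fun ω => (D ω).thetaLocal k w :=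
  Measurable.matrix_mulVec (Measurable.matrix_inv (hD.measurable_gram_inCell k w))
    (hD.measurable_moment_inCell hy k w)

theorem measurable_thetaPool (hD : MeasurableDesign D) (hy : ∀ i, Measurable fun ω => (D ω).y i)
    (w : Fin 2) : Measurable fun ω => (D ω).thetaPool w := by
  refine Measurable.matrix_mulVec (Measurable.matrix_inv (hD.measurable_gram_inArm w)) ?_
  simp_rw [Sample.moment_inArm]
  exact Finset.measurable_fun_sum _ fun k _ => hD.measurable_moment_inCell hy k w

theorem measurable_thetaOneShot (hD : MeasurableDesign D) (hy : ∀ i, Measurable fun ω => (D ω).y i)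
    (σ : ℝ) (agg : Federation) (w : Fin 2) :
    Measurable fun ω => (D ω).thetaOneShot σ agg w := by
  cases agg with
  | SW =>
    exact Finset.measurable_fun_sum _ fun k _ =>
      ((hD.measurable_card_inCell k w).div (hD.measurable_card_inArm w)).smul
        (hD.measurable_thetaLocal hy k w)
  | IVW =>
    have hc : ∀ k i j, Measurable fun ω => ((D ω).localCov σ k w)⁻¹ i j := fun k =>
      Measurable.matrix_inv fun i j =>
        (Measurable.matrix_inv (hD.measurable_gram_inCell k w) i j).const_smul (σ ^ 2)
    refine Measurable.matrix_mulVec (Measurable.matrix_inv fun i j => ?_) ?_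
    · simp_rw [Matrix.sum_apply]
      exact Finset.measurable_fun_sum _ fun k _ => hc k i j
    · exact Finset.measurable_fun_sum _ fun k _ =>
        Measurable.matrix_mulVec (hc k) (hD.measurable_thetaLocal hy k w)

/-- The iterates are measurable by induction, and `limUnder` preserves measurability even where the
sequence diverges, so nothing is needed off the full rank event. -/
theorem measurable_thetaGD (hD : MeasurableDesign D) (hy : ∀ i, Measurable fun ω => (D ω).y i)
    {η : Ω → Fin 2 → ℝ} (hη : Measurable η) (θ₀ : Fin (d + 1) → ℝ)
    (w : Fin 2) : Measurable fun ω => (D ω).thetaGD (η ω) θ₀ w := by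
  have hηw : Measurable fun ω => η ω w := (measurable_pi_apply w).comp hη
  refine (StronglyMeasurable.limUnder fun N => Measurable.stronglyMeasurable ?_).measurable
  induction N with
  | zero => exact measurable_const
  | succ N ih =>
    simp_rw [Sample.fedAvg, Function.iterate_succ_apply'] at ih ⊢
    refine Finset.measurable_fun_sum _ fun k _ =>
      ((hD.measurable_card_inCell k w).div (hD.measurable_card_inArm w)).smul ?_
    simp_rw [Sample.localUpdate, Function.iterate_one, Sample.mseGrad]
    refine ih.sub (hηw.smul ((measurable_const.div (hD.measurable_card_inCell k w)).smul
      ((hD.measurable_moment_inCell hy k w).sub ?_)).neg)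
    exact Measurable.matrix_mulVec (hD.measurable_gram_inCell k w) ih

theorem measurable_tauFed (hD : MeasurableDesign D) {t : Ω → Fin 2 → Fin (d + 1) → ℝ}
    (ht : ∀ w, Measurable fun ω => t ω w) : Measurable fun ω => (D ω).tauFed (t ω) := by
  simp_rw [Sample.tauFed_eq]
  exact (Finset.measurable_fun_sum _ fun i _ =>
    Measurable.dotProduct (hD.measurable_augment i) ((ht 1).sub (ht 0))).const_mul _

end MeasurableDesign

/-! ### The sample as a random object, and the design σ-algebra. -/

namespace Trial

variable {Ω : Type*} {d K : ℕ} (T : Trial Ω d K)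

/-- Since `MeasurableDesign` does not involve outcomes, it holds for the smaller σ-algebra too; this
is what makes the coefficients of the residuals measurable with respect to the design. -/
theorem measurableDesign_sample_design (n : ℕ) :
    @MeasurableDesign Ω (T.design n) n d K (T.sample n) := by
  let : MeasurableSpace Ω := T.design n
  have h (i : Fin n) : Measurable fun ω => (T.X i ω, T.W i ω, T.H i ω) :=
    (measurable_pi_apply i).comp (comap_measurable
      (fun ω (i : Fin n) => (T.X i ω, T.W i ω, T.H i ω)))
  exact ⟨fun i => (h i).fst, fun i => (h i).snd.fst, fun i => (h i).snd.snd⟩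

variable [MeasurableSpace Ω] {P : Measure Ω} {θ : Fin 2 → Fin (d + 1) → ℝ} {σ : ℝ} {T}

namespace IsCovariateShiftRCT

theorem measurableDesign_sample (hT : T.IsCovariateShiftRCT P θ σ) (n : ℕ) :
    MeasurableDesign (T.sample n) :=
  ⟨fun i => hT.measurable_X i, fun i => hT.measurable_W i, fun i => hT.measurable_H i⟩

theorem measurable_observed (hT : T.IsCovariateShiftRCT P θ σ) (i : ℕ) :
    Measurable fun ω => T.Y i (T.W i ω) ω := by
  have : (fun ω => T.Y i (T.W i ω) ω) = fun ω => ∑ w, if T.W i ω = w then T.Y i w ω else 0 := by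
    ext ω; simp
  rw [this]
  exact Finset.measurable_fun_sum _ fun w _ => Measurable.ite
    (hT.measurable_W i (measurableSet_singleton w)) (hT.measurable_Y i w) measurable_const

theorem design_le (hT : T.IsCovariateShiftRCT P θ σ) (n : ℕ) : T.design n ≤ ‹MeasurableSpace Ω› :=
  (measurable_pi_lambda (fun ω (i : Fin n) => (T.X i ω, T.W i ω, T.H i ω)) fun i =>
    (hT.measurable_X i).prodMk ((hT.measurable_W i).prodMk (hT.measurable_H i))).comap_le

end IsCovariateShiftRCT

end Trial

/-! ### Integrals under conditional probabilities and over generated σ-algebras. -/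

section Cond

variable {Ω : Type*} [MeasurableSpace Ω] {P : Measure Ω} [IsProbabilityMeasure P] {S : Set Ω}

theorem MeasureTheory.Integrable.cond_of_ne_zero {f : Ω → ℝ} (hf : Integrable f P) (hS : P S ≠ 0) :
    Integrable f P[|S] :=
  hf.restrict.smul_measure (ENNReal.inv_ne_top.2 hS)

theorem integrable_cond_iff {f : Ω → ℝ} (hS : P S ≠ 0) :
    Integrable f P[|S] ↔ IntegrableOn f S P :=
  integrable_smul_measure (ENNReal.inv_ne_zero.2 (measure_ne_top P S)) (ENNReal.inv_ne_top.2 hS)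

theorem integral_cond (f : Ω → ℝ) : ∫ ω, f ω ∂P[|S] = (P.real S)⁻¹ * ∫ ω in S, f ω ∂P := by
  rw [ProbabilityTheory.cond, integral_smul_measure, smul_eq_mul, ENNReal.toReal_inv]
  rfl

theorem lintegral_cond (f : Ω → ℝ≥0∞) : ∫⁻ ω, f ω ∂P[|S] = (P S)⁻¹ * ∫⁻ ω in S, f ω ∂P := by
  rw [ProbabilityTheory.cond, lintegral_smul_measure, smul_eq_mul]

end Cond

/-- A function whose integrals over the preimages of all rectangles vanish integrates to zero over
every event of the generated `σ`-algebra. -/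
theorem setIntegral_comap_pi_eq_zero {Ω ι β : Type*} [Finite ι] [mβ : MeasurableSpace β]
    {mΩ : MeasurableSpace Ω} {P : Measure Ω} {φ : Ω → ι → β} (hφ : Measurable φ) {f : Ω → ℝ}
    (hf : Integrable f P)
    (h : ∀ B : ι → Set β, (∀ i, MeasurableSet (B i)) →
      ∫ ω in φ ⁻¹' Set.univ.pi B, f ω ∂P = 0)
    {A : Set Ω} (hA : MeasurableSet[MeasurableSpace.comap φ inferInstance] A) :
    ∫ ω in A, f ω ∂P = 0 := by
  obtain ⟨A, hA, rfl⟩ := hA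
  refine MeasurableSpace.induction_on_inter (C := fun A _ => ∫ ω in φ ⁻¹' A, f ω ∂P = 0)
    generateFrom_pi.symm isPiSystem_pi (by simp) ?_ ?_ ?_ A hA
  · rintro _ ⟨B, hB, rfl⟩
    exact h B fun i => hB i (Set.mem_univ i)
  · intro A hA ih
    have h1 := integral_add_compl (hφ hA) hf
    -- The whole space is a rectangle, so the total integral vanishes, which settles complements.
    have h2 := h (fun _ => Set.univ) fun _ => MeasurableSet.univ
    simp only [Set.pi_univ, Set.preimage_univ, Measure.restrict_univ] at h2
    rw [ih, h2, zero_add] at h1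
    exact h1
  · intro A hd hA ih
    rw [Set.preimage_iUnion, integral_iUnion (fun i => hφ (hA i))
      (fun i j hij => (hd hij).preimage φ) hf.integrableOn]
    simp [ih]

/-! ### Residuals of the observed outcomes of single units. -/

namespace Trial

variable {Ω : Type*} {d K : ℕ} (T : Trial Ω d K)

/-- Everything that is recorded about unit `i`. -/
def unit (i : ℕ) (ω : Ω) : (Fin d → ℝ) × Fin 2 × Fin K × (Fin 2 → ℝ) :=
  (T.X i ω, T.W i ω, T.H i ω, fun w => T.Y i w ω)

/-- Covariates, arm and study of unit `i`. -/
def unitDesign (i : ℕ) (ω : Ω) : (Fin d → ℝ) × Fin 2 × Fin K := (T.X i ω, T.W i ω, T.H i ω)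

/-- Residual of the observed outcome of unit `i`. -/
def residual (θ : Fin 2 → Fin (d + 1) → ℝ) (i : ℕ) (ω : Ω) : ℝ :=
  T.Y i (T.W i ω) ω - augment (T.X i ω) ⬝ᵥ θ (T.W i ω)

variable [MeasurableSpace Ω] {P : Measure Ω} [IsProbabilityMeasure P]
  {θ : Fin 2 → Fin (d + 1) → ℝ} {σ : ℝ} {T}

namespace IsCovariateShiftRCT

theorem measurable_unit (hT : T.IsCovariateShiftRCT P θ σ) (i : ℕ) : Measurable (T.unit i) :=
  (hT.measurable_X i).prodMk ((hT.measurable_W i).prodMk ((hT.measurable_H i).prodMk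
    (measurable_pi_lambda _ fun w => hT.measurable_Y i w)))

theorem measurable_unitDesign (hT : T.IsCovariateShiftRCT P θ σ) (i : ℕ) :
    Measurable (T.unitDesign i) :=
  (hT.measurable_X i).prodMk ((hT.measurable_W i).prodMk (hT.measurable_H i))

theorem measurable_augment_X (hT : T.IsCovariateShiftRCT P θ σ) (i : ℕ) :
    Measurable fun ω => augment (T.X i ω) :=
  measurable_augment.comp (hT.measurable_X i)

theorem measurable_noise (hT : T.IsCovariateShiftRCT P θ σ) (w : Fin 2) :
    Measurable (T.noise θ w) :=
  (hT.measurable_Y 0 w).sub (Measurable.dotProduct (hT.measurable_augment_X 0) measurable_const)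

/-- Functions of single units are again independent and identically distributed. -/
theorem iIndepFun_comp_unit (hT : T.IsCovariateShiftRCT P θ σ) {β : Type*} [MeasurableSpace β]
    {g : (Fin d → ℝ) × Fin 2 × Fin K × (Fin 2 → ℝ) → β} (hg : Measurable g) :
    iIndepFun (fun i ω => g (T.unit i ω)) P :=
  hT.indep.comp (fun _ => g) fun _ => hg

theorem identDistrib_comp_unit (hT : T.IsCovariateShiftRCT P θ σ) {β : Type*} [MeasurableSpace β]
    {g : (Fin d → ℝ) × Fin 2 × Fin K × (Fin 2 → ℝ) → β} (hg : Measurable g) (i : ℕ) :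
    IdentDistrib (fun ω => g (T.unit i ω)) (fun ω => g (T.unit 0 ω)) P P :=
  (hT.identDistrib i).comp hg

end IsCovariateShiftRCT

theorem measurable_unit_residual (θ : Fin 2 → Fin (d + 1) → ℝ) :
    Measurable fun z : (Fin d → ℝ) × Fin 2 × Fin K × (Fin 2 → ℝ) =>
      z.2.2.2 z.2.1 - augment z.1 ⬝ᵥ θ z.2.1 := by
  have : (fun z : (Fin d → ℝ) × Fin 2 × Fin K × (Fin 2 → ℝ) =>
      z.2.2.2 z.2.1 - augment z.1 ⬝ᵥ θ z.2.1) = fun z =>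
        ∑ w, if z.2.1 = w then z.2.2.2 w - augment z.1 ⬝ᵥ θ w else 0 := by
    funext z; simp
  rw [this]
  refine Finset.measurable_fun_sum _ fun w _ => Measurable.ite
    (measurable_snd.fst (measurableSet_singleton w)) (.sub ?_ ?_) measurable_const
  · exact (measurable_pi_apply w).comp measurable_snd.snd.snd
  · exact Measurable.dotProduct (measurable_augment.comp measurable_fst) measurable_const

namespace IsCovariateShiftRCT

theorem measurable_residual (hT : T.IsCovariateShiftRCT P θ σ) (i : ℕ) :
    Measurable (T.residual θ i) :=
  (measurable_unit_residual θ).comp (hT.measurable_unit i)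

theorem residual_eq_sum (g : ℝ → ℝ) (ω : Ω) : g (T.residual θ 0 ω) =
    ∑ w, (T.W 0 ⁻¹' {w}).indicator (fun ω => g (T.noise θ w ω)) ω := by
  rw [Finset.sum_eq_single (T.W 0 ω) (fun w _ hw => Set.indicator_of_notMem
    (s := T.W 0 ⁻¹' {w}) (a := ω) (by simpa using Ne.symm hw) _) (by simp)]
  rw [Set.indicator_of_mem (by simp), residual, noise]

theorem integrable_comp_residual_zero (hT : T.IsCovariateShiftRCT P θ σ) {g : ℝ → ℝ}
    (hint : ∀ w, Integrable (fun ω => g (T.noise θ w ω)) P) :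
    Integrable (fun ω => g (T.residual θ 0 ω)) P := by
  simp_rw [residual_eq_sum]
  exact integrable_finsetSum _ fun w _ =>
    (hint w).indicator (hT.measurable_W 0 (measurableSet_singleton w))

theorem memLp_residual (hT : T.IsCovariateShiftRCT P θ σ) (i : ℕ) :
    MemLp (T.residual θ i) 2 P := by
  have h0 : MemLp (T.residual θ 0) 2 P := by
    rw [memLp_two_iff_integrable_sq (hT.measurable_residual 0).aestronglyMeasurable]
    exact hT.integrable_comp_residual_zero (g := fun x => x ^ 2)
      fun w => (hT.memLp_noise w).integrable_sq
  exact ((hT.identDistrib_comp_unit (measurable_unit_residual θ) i).memLp_iff).2 h0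

/-- Split by study and arm. Within a study, randomization makes the indicator of the arm independent
of covariates and noise, so the integral factors; the factor with `g (ε(w))` is an integral over an
event in `X` and vanishes by `h0`. The function `g` will be the identity or `x ↦ x ^ 2 - σ ^ 2`. -/
theorem setIntegral_comp_residual_zero (hT : T.IsCovariateShiftRCT P θ σ) {g : ℝ → ℝ}
    (hg : Measurable g) (hint : ∀ w, Integrable (fun ω => g (T.noise θ w ω)) P)
    (h0 : ∀ k w, (P[|T.H 0 ⁻¹' {k}])[fun ω => g (T.noise θ w ω) |
      MeasurableSpace.comap (T.X 0) inferInstance] =ᵐ[P[|T.H 0 ⁻¹' {k}]] fun _ => 0)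
    {B : Set ((Fin d → ℝ) × Fin 2 × Fin K)} (hB : MeasurableSet B) :
    ∫ ω in T.unitDesign 0 ⁻¹' B, g (T.residual θ 0 ω) ∂P = 0 := by
  have hBm : ∀ k w, MeasurableSet {x : Fin d → ℝ | (x, w, k) ∈ B} := fun k w =>
    (measurable_id.prodMk measurable_const) hB
  have hW : ∀ w, MeasurableSet (T.W 0 ⁻¹' {w}) := fun w =>
    hT.measurable_W 0 (measurableSet_singleton w)
  have hH : ∀ k, MeasurableSet (T.H 0 ⁻¹' {k}) := fun k =>
    hT.measurable_H 0 (measurableSet_singleton k)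
  set F : Fin K → Fin 2 → Ω → ℝ := fun k w ω =>
    ({w} : Set (Fin 2)).indicator (fun _ => (1 : ℝ)) (T.W 0 ω) *
      {x : Fin d → ℝ | (x, w, k) ∈ B}.indicator (fun _ => (1 : ℝ)) (T.X 0 ω) * g (T.noise θ w ω)
    with hF
  have hFi : ∀ k w, Integrable (F k w) P := by
    intro k w
    have : F k w = (T.W 0 ⁻¹' {w} ∩ T.X 0 ⁻¹' {x | (x, w, k) ∈ B}).indicator
        (fun ω => g (T.noise θ w ω)) := by
      funext ω
      by_cases h1 : T.W 0 ω = w <;> by_cases h2 : (T.X 0 ω, w, k) ∈ B <;>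
        simp [hF, Set.indicator_apply, h1, h2]
    rw [this]
    exact (hint w).indicator ((hW w).inter (hT.measurable_X 0 (hBm k w)))
  have hsum : ∀ ω, (T.unitDesign 0 ⁻¹' B).indicator (fun ω => g (T.residual θ 0 ω)) ω =
      ∑ k, ∑ w, (T.H 0 ⁻¹' {k}).indicator (F k w) ω := by
    intro ω
    rw [Finset.sum_eq_single (T.H 0 ω) (fun k _ hk => Finset.sum_eq_zero fun w _ =>
      Set.indicator_of_notMem (fun h => hk h.symm) _) (by simp),
      Finset.sum_eq_single (T.W 0 ω) (fun w _ hw => ?_) (by simp)]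
    · by_cases h : (T.X 0 ω, T.W 0 ω, T.H 0 ω) ∈ B <;>
        simp [hF, Set.indicator_apply, h, unitDesign, residual, noise]
    · simp [hF, Set.indicator_apply, Ne.symm hw]
  rw [← integral_indicator (hT.measurable_unitDesign 0 hB)]
  simp_rw [hsum]
  rw [integral_finsetSum _ fun k _ => integrable_finsetSum _ fun w _ =>
    (hFi k w).indicator (hH k)]
  refine Finset.sum_eq_zero fun k _ => ?_
  rw [integral_finsetSum _ fun w _ => (hFi k w).indicator (hH k)]
  refine Finset.sum_eq_zero fun w _ => ?_
  rw [integral_indicator (hH k)]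
  have hk : P (T.H 0 ⁻¹' {k}) ≠ 0 := (hT.study_pos k).ne'
  have hz : ∫ ω, F k w ω ∂P[|T.H 0 ⁻¹' {k}] = 0 := by
    -- Both factors are functions of the two sides of the randomization assumption, since the noise
    -- is determined by `X` and `Y`.
    have hind : IndepFun (fun ω => ({w} : Set (Fin 2)).indicator (fun _ => (1 : ℝ)) (T.W 0 ω))
        (fun ω => {x : Fin d → ℝ | (x, w, k) ∈ B}.indicator (fun _ => (1 : ℝ)) (T.X 0 ω) *
          g (T.noise θ w ω)) P[|T.H 0 ⁻¹' {k}] := by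
      refine (hT.randomized k).comp
        (φ := fun a => ({w} : Set (Fin 2)).indicator (fun _ => (1 : ℝ)) a)
        (ψ := fun p => {x : Fin d → ℝ | (x, w, k) ∈ B}.indicator (fun _ => (1 : ℝ)) p.1 *
          g (p.2 w - augment p.1 ⬝ᵥ θ w)) (measurable_of_countable _) ?_
      refine .mul ((measurable_const.indicator (hBm k w)).comp measurable_fst)
        (hg.comp (.sub ?_ ?_))
      · exact (measurable_pi_apply w).comp measurable_snd
      · exact Measurable.dotProduct (measurable_augment.comp measurable_fst) measurable_const
    simp_rw [hF, mul_assoc]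
    rw [hind.integral_fun_mul_eq_mul_integral]
    · have h2 : ∫ ω, {x : Fin d → ℝ | (x, w, k) ∈ B}.indicator (fun _ => (1 : ℝ)) (T.X 0 ω) *
          g (T.noise θ w ω) ∂P[|T.H 0 ⁻¹' {k}] =
          ∫ ω in T.X 0 ⁻¹' {x | (x, w, k) ∈ B}, g (T.noise θ w ω) ∂P[|T.H 0 ⁻¹' {k}] := by
        rw [← integral_indicator (hT.measurable_X 0 (hBm k w))]
        congr 1
        funext ω
        by_cases h2 : (T.X 0 ω, w, k) ∈ B <;> simp [h2]
      have hprob := cond_isProbabilityMeasure hk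
      rw [h2, ← setIntegral_condExp (hT.measurable_X 0).comap_le ((hint w).cond_of_ne_zero hk)
        ⟨_, hBm k w, rfl⟩]
      rw [setIntegral_congr_ae (g := fun _ => (0 : ℝ)) (hT.measurable_X 0 (hBm k w))
        ((h0 k w).mono fun ω h _ => h)]
      simp
    · exact ((measurable_of_countable (fun a : Fin 2 => ({w} : Set (Fin 2)).indicator
        (fun _ => (1 : ℝ)) a)).comp (hT.measurable_W 0)).aestronglyMeasurable
    · exact (((measurable_const.indicator (hBm k w)).comp (hT.measurable_X 0)).mul
        (hg.comp (hT.measurable_noise w))).aestronglyMeasurable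
  rw [integral_cond] at hz
  exact (mul_eq_zero.1 hz).resolve_left
    (inv_ne_zero (ENNReal.toReal_ne_zero.2 ⟨hk, measure_ne_top _ _⟩))

end IsCovariateShiftRCT

end Trial

/-! ### Conditional moments of the residuals given the design. -/

namespace Trial

variable {Ω : Type*} {d K : ℕ} {T : Trial Ω d K} [MeasurableSpace Ω] {P : Measure Ω}
  [IsProbabilityMeasure P] {θ : Fin 2 → Fin (d + 1) → ℝ} {σ : ℝ}

namespace IsCovariateShiftRCT

theorem setIntegral_comp_residual (hT : T.IsCovariateShiftRCT P θ σ) {g : ℝ → ℝ}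
    (hg : Measurable g) (hint : ∀ w, Integrable (fun ω => g (T.noise θ w ω)) P)
    (h0 : ∀ k w, (P[|T.H 0 ⁻¹' {k}])[fun ω => g (T.noise θ w ω) |
      MeasurableSpace.comap (T.X 0) inferInstance] =ᵐ[P[|T.H 0 ⁻¹' {k}]] fun _ => 0)
    {B : Set ((Fin d → ℝ) × Fin 2 × Fin K)} (hB : MeasurableSet B) (i : ℕ) :
    ∫ ω in T.unitDesign i ⁻¹' B, g (T.residual θ i ω) ∂P = 0 := by
  have hm : Measurable fun z : (Fin d → ℝ) × Fin 2 × Fin K × (Fin 2 → ℝ) =>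
      {z : (Fin d → ℝ) × Fin 2 × Fin K × (Fin 2 → ℝ) | (z.1, z.2.1, z.2.2.1) ∈ B}.indicator
        (fun z => g (z.2.2.2 z.2.1 - augment z.1 ⬝ᵥ θ z.2.1)) z :=
    (hg.comp (measurable_unit_residual θ)).indicator
      ((measurable_fst.prodMk (measurable_snd.fst.prodMk measurable_snd.snd.fst)) hB)
  have h := (hT.identDistrib_comp_unit hm i).integral_eq
  rw [← hT.setIntegral_comp_residual_zero hg hint h0 hB,
    ← integral_indicator (hT.measurable_unitDesign 0 hB),
    ← integral_indicator (hT.measurable_unitDesign i hB)]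
  exact h

/-- Over a rectangle of unit designs the integral factors by independence, and factor `i` is zero;
rectangles generate the design. Choosing the `r l` among `1`, the identity and `x ↦ x ^ 2 - σ ^ 2`
yields conditional means, mixed moments and variances at once. -/
theorem setIntegral_prod_residual (hT : T.IsCovariateShiftRCT P θ σ) {n : ℕ} (i : Fin n)
    {r : Fin n → ℝ → ℝ} (hr : ∀ l, Measurable (r l))
    (hint : ∀ w, Integrable (fun ω => r i (T.noise θ w ω)) P)
    (h0 : ∀ k w, (P[|T.H 0 ⁻¹' {k}])[fun ω => r i (T.noise θ w ω) |
      MeasurableSpace.comap (T.X 0) inferInstance] =ᵐ[P[|T.H 0 ⁻¹' {k}]] fun _ => 0)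
    (hprod : Integrable (fun ω => ∏ l, r l (T.residual θ l ω)) P)
    {A : Set Ω} (hA : MeasurableSet[T.design n] A) :
    ∫ ω in A, ∏ l, r l (T.residual θ l ω) ∂P = 0 := by
  have hφ : Measurable (fun ω (i : Fin n) => (T.X i ω, T.W i ω, T.H i ω)) :=
    measurable_pi_lambda _ fun i => hT.measurable_unitDesign i
  refine setIntegral_comap_pi_eq_zero hφ hprod (fun B hB => ?_) hA
  rw [← integral_indicator (hφ (MeasurableSet.univ_pi hB))]
  let f : Fin n → (Fin d → ℝ) × Fin 2 × Fin K × (Fin 2 → ℝ) → ℝ := fun l z =>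
    {z : (Fin d → ℝ) × Fin 2 × Fin K × (Fin 2 → ℝ) | (z.1, z.2.1, z.2.2.1) ∈ B l}.indicator
      (fun z => r l (z.2.2.2 z.2.1 - augment z.1 ⬝ᵥ θ z.2.1)) z
  have hf : ∀ l, Measurable (f l) := fun l =>
    ((hr l).comp (measurable_unit_residual θ)).indicator
      ((measurable_fst.prodMk (measurable_snd.fst.prodMk measurable_snd.snd.fst)) (hB l))
  have hind : iIndepFun (fun (l : Fin n) ω => T.unit l ω) P :=
    hT.indep.precomp (g := fun l : Fin n => (l : ℕ)) Fin.val_injective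
  have heq : ∀ ω, ((fun ω (i : Fin n) => (T.X i ω, T.W i ω, T.H i ω)) ⁻¹'
      Set.univ.pi B).indicator (fun ω => ∏ l, r l (T.residual θ l ω)) ω =
      ∏ l, f l (T.unit l ω) := by
    intro ω
    by_cases h : ∀ l : Fin n, (T.X l ω, T.W l ω, T.H l ω) ∈ B l
    · rw [Set.indicator_of_mem (by simpa using h)]
      refine Finset.prod_congr rfl fun l _ => ?_
      simp only [f]
      exact (Set.indicator_of_mem (s := {z : (Fin d → ℝ) × Fin 2 × Fin K × (Fin 2 → ℝ) |
        (z.1, z.2.1, z.2.2.1) ∈ B l}) (a := T.unit l ω) (h l)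
        (fun z => r l (z.2.2.2 z.2.1 - augment z.1 ⬝ᵥ θ z.2.1))).symm
    · rw [Set.indicator_of_notMem (by simpa using h)]
      push Not at h
      obtain ⟨l, hl⟩ := h
      exact (Finset.prod_eq_zero (Finset.mem_univ l) (Set.indicator_of_notMem
        (s := {z : (Fin d → ℝ) × Fin 2 × Fin K × (Fin 2 → ℝ) | (z.1, z.2.1, z.2.2.1) ∈ B l})
        (a := T.unit l ω) hl _)).symm
  simp_rw [heq]
  rw [hind.integral_fun_prod_comp (fun l => (hT.measurable_unit l).aemeasurable)
    fun l => (hf l).aestronglyMeasurable]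
  refine Finset.prod_eq_zero (Finset.mem_univ i) ?_
  rw [← hT.setIntegral_comp_residual (hr i) hint h0 (hB i) i,
    ← integral_indicator (hT.measurable_unitDesign i (hB i))]
  rfl

theorem condExp_residual (hT : T.IsCovariateShiftRCT P θ σ) {n : ℕ} (i : Fin n) :
    P[T.residual θ i | T.design n] =ᵐ[P] 0 := by
  have hint : Integrable (T.residual θ i) P := (hT.memLp_residual i).integrable one_le_two
  refine (ae_eq_condExp_of_forall_setIntegral_eq (hT.design_le n) hint
    (fun _ _ _ => integrableOn_zero) (fun A hA _ => ?_) aestronglyMeasurable_zero).symm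
  have hp : ∀ ω, ∏ l : Fin n, (if l = i then id else fun _ => (1 : ℝ)) (T.residual θ l ω) =
      T.residual θ i ω := by
    intro ω
    rw [Finset.prod_eq_single i (fun l _ hl => by simp [hl]) (by simp)]
    simp
  have := hT.setIntegral_prod_residual i (r := fun l => if l = i then id else fun _ => (1 : ℝ))
    (fun l => by split_ifs <;> fun_prop)
    (fun w => by simpa using (hT.memLp_noise w).integrable one_le_two)
    (fun k w => by simpa using hT.noise_mean k w) (by simpa only [hp] using hint) hA
  simp only [hp] at this
  simp [this]

theorem condExp_residual_mul (hT : T.IsCovariateShiftRCT P θ σ) {n : ℕ} {i j : Fin n}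
    (hij : i ≠ j) : P[fun ω => T.residual θ i ω * T.residual θ j ω | T.design n] =ᵐ[P] 0 := by
  have hint : Integrable (fun ω => T.residual θ i ω * T.residual θ j ω) P :=
    (hT.memLp_residual i).integrable_mul (hT.memLp_residual j)
  refine (ae_eq_condExp_of_forall_setIntegral_eq (hT.design_le n) hint
    (fun _ _ _ => integrableOn_zero) (fun A hA _ => ?_) aestronglyMeasurable_zero).symm
  have hp : ∀ ω, ∏ l : Fin n, (if l = i ∨ l = j then id else fun _ => (1 : ℝ)) (T.residual θ l ω) =
      T.residual θ i ω * T.residual θ j ω := by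
    intro ω
    rw [Finset.prod_eq_mul i j hij (fun l _ hl => by simp [hl.1, hl.2]) (by simp) (by simp)]
    simp
  have := hT.setIntegral_prod_residual i
    (r := fun l => if l = i ∨ l = j then id else fun _ => (1 : ℝ))
    (fun l => by split_ifs <;> fun_prop)
    (fun w => by simpa using (hT.memLp_noise w).integrable one_le_two)
    (fun k w => by simpa using hT.noise_mean k w) (by simpa only [hp] using hint) hA
  simp only [hp] at this
  simp [this]

theorem condExp_residual_sq (hT : T.IsCovariateShiftRCT P θ σ) {n : ℕ} (i : Fin n) :
    P[fun ω => T.residual θ i ω * T.residual θ i ω | T.design n] =ᵐ[P] fun _ => σ ^ 2 := by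
  have hint : Integrable (fun ω => T.residual θ i ω * T.residual θ i ω) P :=
    (hT.memLp_residual i).integrable_mul (hT.memLp_residual i)
  refine (ae_eq_condExp_of_forall_setIntegral_eq (hT.design_le n) hint
    (fun _ _ _ => integrableOn_const) (fun A hA _ => ?_) aestronglyMeasurable_const).symm
  have hp : ∀ ω, ∏ l : Fin n,
      (if l = i then fun x => x ^ 2 - σ ^ 2 else fun _ => (1 : ℝ)) (T.residual θ l ω) =
      T.residual θ i ω * T.residual θ i ω - σ ^ 2 := by
    intro ω
    rw [Finset.prod_eq_single i (fun l _ hl => by simp [hl]) (by simp)]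
    simp [sq]
  have := hT.setIntegral_prod_residual i
    (r := fun l => if l = i then fun x => x ^ 2 - σ ^ 2 else fun _ => (1 : ℝ))
    (fun l => by split_ifs <;> fun_prop)
    (fun w => by
      simp only [if_true]
      exact (hT.memLp_noise w).integrable_sq.sub (integrable_const _))
    (fun k w => by
      have hk : P (T.H 0 ⁻¹' {k}) ≠ 0 := (hT.study_pos k).ne'
      have hprob := cond_isProbabilityMeasure hk
      have h1 := condExp_sub ((hT.memLp_noise w).integrable_sq.cond_of_ne_zero hk)
        (integrable_const (μ := P[|T.H 0 ⁻¹' {k}]) (σ ^ 2))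
        (MeasurableSpace.comap (T.X 0) inferInstance)
      rw [condExp_const (hT.measurable_X 0).comap_le] at h1
      simp only [if_true]
      filter_upwards [h1, hT.noise_var k w] with ω h1 h2
      simp only [Pi.sub_apply, h2, sub_self] at h1
      exact h1)
    (by simp only [hp]; exact hint.sub (integrable_const (σ ^ 2))) hA
  simp only [hp] at this
  rw [integral_sub hint.integrableOn integrableOn_const, sub_eq_zero] at this
  exact this.symm

end IsCovariateShiftRCT

end Trial

/-! ### Sums of residuals with coefficients determined by the design. -/

theorem integral_mul_eq_of_condExp_eq_const {Ω : Type*} {m m0 : MeasurableSpace Ω}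
    {P : Measure Ω} [IsProbabilityMeasure P] (hm : m ≤ m0) {f b : Ω → ℝ} {c C : ℝ}
    (hf : Integrable f P) (hc : P[f | m] =ᵐ[P] fun _ => c) (hb : Measurable[m] b)
    (hC : ∀ ω, |b ω| ≤ C) :
    Integrable (fun ω => b ω * f ω) P ∧ ∫ ω, b ω * f ω ∂P = c * ∫ ω, b ω ∂P := by
  have hint : Integrable (fun ω => b ω * f ω) P :=
    hf.bdd_mul (c := C) (hb.mono hm le_rfl).aestronglyMeasurable (Eventually.of_forall hC)
  refine ⟨hint, ?_⟩
  rw [← integral_condExp hm]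
  have h := condExp_mul_of_stronglyMeasurable_left (m := m) hb.stronglyMeasurable
    (show Integrable (b * f) P from hint) hf
  rw [show (fun ω => b ω * f ω) = b * f from rfl,
    integral_congr_ae (h.trans (EventuallyEq.rfl.mul hc)),
    ← integral_const_mul]
  congr 1
  funext ω
  simp [mul_comm]

namespace Trial

variable {Ω : Type*} {d K : ℕ} {T : Trial Ω d K} [MeasurableSpace Ω] {P : Measure Ω}
  [IsProbabilityMeasure P] {θ : Fin 2 → Fin (d + 1) → ℝ} {σ : ℝ}

namespace IsCovariateShiftRCT

variable {n : ℕ} {c : Fin n → Ω → ℝ} {S : Set Ω}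

theorem integral_sum_bounded_mul_residual (hT : T.IsCovariateShiftRCT P θ σ)
    (hc : ∀ i, Measurable[T.design n] (c i)) {C : ℝ} (hC : ∀ i ω, |c i ω| ≤ C) :
    ∫ ω, ∑ i, c i ω * T.residual θ i ω ∂P = 0 := by
  have h := fun i : Fin n => integral_mul_eq_of_condExp_eq_const (hT.design_le n)
    ((hT.memLp_residual i).integrable one_le_two) (hT.condExp_residual i) (hc i) (hC i)
  rw [integral_finsetSum _ fun i _ => (h i).1]
  exact Finset.sum_eq_zero fun i _ => (h i).2.trans (zero_mul _)

/-- In the expanded square the mixed terms vanish and each diagonal term contributes `σ ^ 2`;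
boundedness allows the coefficients to be pulled out of the conditional expectations. -/
theorem integral_sq_sum_bounded_mul_residual (hT : T.IsCovariateShiftRCT P θ σ)
    (hc : ∀ i, Measurable[T.design n] (c i)) {C : ℝ} (hC : ∀ i ω, |c i ω| ≤ C) :
    Integrable (fun ω => (∑ i, c i ω * T.residual θ i ω) ^ 2) P ∧
      ∫ ω, (∑ i, c i ω * T.residual θ i ω) ^ 2 ∂P = ∫ ω, σ ^ 2 * ∑ i, c i ω ^ 2 ∂P := by
  have hm : ∀ i j, Measurable[T.design n] fun ω => c i ω * c j ω := fun i j => (hc i).mul (hc j)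
  have hb : ∀ i j ω, |c i ω * c j ω| ≤ C * C := fun i j ω => by
    rw [abs_mul]
    exact mul_le_mul (hC i ω) (hC j ω) (abs_nonneg _) ((abs_nonneg _).trans (hC i ω))
  have hint : ∀ i j : Fin n, Integrable (fun ω => T.residual θ i ω * T.residual θ j ω) P :=
    fun i j => (hT.memLp_residual i).integrable_mul (hT.memLp_residual j)
  have hij : ∀ i j, Integrable (fun ω => c i ω * c j ω * (T.residual θ i ω * T.residual θ j ω)) P ∧
      ∫ ω, c i ω * c j ω * (T.residual θ i ω * T.residual θ j ω) ∂P =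
        if i = j then σ ^ 2 * ∫ ω, c i ω ^ 2 ∂P else 0 := by
    intro i j
    split_ifs with h
    · subst h
      have := integral_mul_eq_of_condExp_eq_const (hT.design_le n) (hint i i)
        (hT.condExp_residual_sq i) (hm i i) (hb i i)
      simpa only [sq] using this
    · have := integral_mul_eq_of_condExp_eq_const (hT.design_le n) (hint i j)
        (hT.condExp_residual_mul h) (hm i j) (hb i j)
      exact ⟨this.1, this.2.trans (zero_mul _)⟩
  have hsq : ∀ ω, (∑ i, c i ω * T.residual θ i ω) ^ 2 =
      ∑ i, ∑ j, c i ω * c j ω * (T.residual θ i ω * T.residual θ j ω) := by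
    intro ω
    rw [sq, Finset.sum_mul_sum]
    exact Finset.sum_congr rfl fun i _ => Finset.sum_congr rfl fun j _ => by ring
  simp_rw [hsq]
  refine ⟨integrable_finsetSum _ fun i _ => integrable_finsetSum _ fun j _ => (hij i j).1, ?_⟩
  rw [integral_finsetSum _ fun i _ => integrable_finsetSum _ fun j _ => (hij i j).1]
  simp_rw [Finset.mul_sum]
  rw [integral_finsetSum _ fun i _ => ?_]
  · refine Finset.sum_congr rfl fun i _ => ?_
    rw [integral_finsetSum _ fun j _ => (hij i j).1]
    simp_rw [(hij i _).2]
    rw [Finset.sum_ite_eq, if_pos (Finset.mem_univ i), integral_const_mul]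
  · refine Integrable.const_mul ?_ _
    refine Integrable.of_bound ((((hc i).mono (hT.design_le n) le_rfl).pow_const
      2).aestronglyMeasurable) (C * C) (Eventually.of_forall fun ω => ?_)
    rw [sq]
    exact hb i i ω

/-- Events that exhaust `S` and on which the coefficients are bounded. -/
theorem exists_truncation (hc : ∀ i, Measurable[T.design n] (c i))
    (hS : MeasurableSet[T.design n] S) :
    ∃ A : ℕ → Set Ω, (∀ N, MeasurableSet[T.design n] (A N)) ∧ Monotone A ∧ ⋃ N, A N = S ∧
      ∀ N i ω, |(A N).indicator (c i) ω| ≤ N := by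
  refine ⟨fun N => S ∩ ⋂ i, {ω | |c i ω| ≤ N}, fun N => ?_, fun N M hNM => ?_, ?_, ?_⟩
  · let : MeasurableSpace Ω := T.design n
    exact hS.inter (MeasurableSet.iInter fun i => measurableSet_le (hc i).abs measurable_const)
  · refine Set.inter_subset_inter_right _ (Set.iInter_mono fun i ω h => ?_)
    exact le_trans (Set.mem_ofPred_eq.mp h) (Nat.cast_le.2 hNM)
  · ext ω
    simp only [Set.mem_iUnion, Set.mem_inter_iff, Set.mem_iInter, Set.mem_ofPred_eq]
    constructor
    · rintro ⟨_, h, _⟩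
      exact h
    · intro h
      obtain ⟨N, hN⟩ := exists_nat_ge (∑ i, |c i ω|)
      exact ⟨N, h, fun i => (Finset.single_le_sum (f := fun i => |c i ω|)
        (fun j _ => abs_nonneg _) (Finset.mem_univ i)).trans hN⟩
  · intro N i ω
    by_cases h : ω ∈ S ∩ ⋂ i, {ω | |c i ω| ≤ N}
    · rw [Set.indicator_of_mem h]
      exact Set.mem_iInter.1 h.2 i
    · rw [Set.indicator_of_notMem h]
      simp

/-- Only the sum is assumed integrable, not its terms. On each truncation event the bounded case
applies, and the set integrals converge as these events increase to `S`. -/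
theorem setIntegral_sum_mul_residual (hT : T.IsCovariateShiftRCT P θ σ)
    (hc : ∀ i, Measurable[T.design n] (c i)) (hS : MeasurableSet[T.design n] S)
    (hint : IntegrableOn (fun ω => ∑ i, c i ω * T.residual θ i ω) S P) :
    ∫ ω in S, ∑ i, c i ω * T.residual θ i ω ∂P = 0 := by
  obtain ⟨A, hA, hmono, rfl, hbd⟩ := exists_truncation hc hS
  have hA' : ∀ N, MeasurableSet (A N) := fun N => hT.design_le n _ (hA N)
  refine tendsto_nhds_unique (tendsto_setIntegral_of_monotone hA' hmono hint) ?_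
  refine tendsto_const_nhds.congr fun N => ?_
  rw [← hT.integral_sum_bounded_mul_residual
    (fun i => Measurable.indicator (mβ := inferInstance) (hc i) (hA N)) (hbd N),
    ← integral_indicator (hA' N)]
  congr 1
  funext ω
  by_cases h : ω ∈ A N <;> simp [h]

/-- Monotone convergence along the truncation events; working in `[0, ∞]` removes every moment
condition on the coefficients. -/
theorem setLIntegral_sq_sum_mul_residual (hT : T.IsCovariateShiftRCT P θ σ)
    (hc : ∀ i, Measurable[T.design n] (c i)) (hS : MeasurableSet[T.design n] S) :
    ∫⁻ ω in S, ENNReal.ofReal ((∑ i, c i ω * T.residual θ i ω) ^ 2) ∂P =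
      ∫⁻ ω in S, ENNReal.ofReal (σ ^ 2 * ∑ i, c i ω ^ 2) ∂P := by
  obtain ⟨A, hA, hmono, rfl, hbd⟩ := exists_truncation hc hS
  have hA' : ∀ N, MeasurableSet (A N) := fun N => hT.design_le n _ (hA N)
  rw [setLIntegral_iUnion_of_directed _ hmono.directed_le,
    setLIntegral_iUnion_of_directed _ hmono.directed_le]
  refine iSup_congr fun N => ?_
  have hb : ∀ i, Measurable[T.design n] ((A N).indicator (c i)) := fun i =>
    Measurable.indicator (mβ := inferInstance) (hc i) (hA N)
  obtain ⟨h1, h2⟩ := hT.integral_sq_sum_bounded_mul_residual hb (hbd N)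
  have h3 : Integrable (fun ω => σ ^ 2 * ∑ i, (A N).indicator (c i) ω ^ 2) P := by
    refine Integrable.const_mul (integrable_finsetSum _ fun i _ => ?_) _
    refine Integrable.of_bound ((((hb i).mono (hT.design_le n) le_rfl).pow_const
      2).aestronglyMeasurable) ((N : ℝ) ^ 2) (Eventually.of_forall fun ω => ?_)
    rw [Real.norm_eq_abs, abs_pow]
    exact pow_le_pow_left₀ (abs_nonneg _) (hbd N i ω) 2
  have h4 := congrArg ENNReal.ofReal h2
  rw [ofReal_integral_eq_lintegral_ofReal h1 (Eventually.of_forall fun ω => sq_nonneg _),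
    ofReal_integral_eq_lintegral_ofReal h3 (Eventually.of_forall fun ω => by positivity)] at h4
  rw [← lintegral_indicator (hA' N), ← lintegral_indicator (hA' N)]
  convert h4 using 2 <;>
  · funext ω
    by_cases h : ω ∈ A N <;> simp [h]

end IsCovariateShiftRCT

end Trial

/-! ### Means and extended variances given a full rank design event. -/

/-- The extended variance of a constant plus a mean zero term is the second moment of that term,
also when the latter is not integrable. -/
theorem evariance_eq_lintegral_of_ae_eq_add {Ω : Type*} [MeasurableSpace Ω] {Q : Measure Ω}
    [IsProbabilityMeasure Q] {f R : Ω → ℝ} {c : ℝ} (hf : f =ᵐ[Q] fun ω => c + R ω)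
    (hR : AEStronglyMeasurable R Q) (h0 : Integrable R Q → ∫ ω, R ω ∂Q = 0) :
    evariance f Q = ∫⁻ ω, ENNReal.ofReal (R ω ^ 2) ∂Q := by
  rw [evariance_congr hf]
  by_cases hint : Integrable R Q
  · have hm : ∫ ω, (c + R ω) ∂Q = c := by
      rw [integral_add (integrable_const c) hint, h0 hint]
      simp
    rw [evariance, hm]
    refine lintegral_congr fun ω => ?_
    rw [add_sub_cancel_left, Real.enorm_eq_ofReal_abs, ← ENNReal.ofReal_pow (abs_nonneg _), sq_abs]
  -- Without integrability of `R` both sides are infinite: a finite second moment would make `R`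
  -- integrable.
  · have hL : ¬ MemLp (fun ω => c + R ω) 2 Q := fun h => hint <|
      ((h.integrable one_le_two).sub (integrable_const c)).congr
        (Eventually.of_forall fun ω => add_sub_cancel_left _ _)
    rw [evariance_eq_top (hR.const_add c) hL]
    refine (not_lt_top_iff.1 fun h => hint ?_).symm
    refine MemLp.integrable one_le_two ?_
    rw [memLp_two_iff_integrable_sq hR]
    exact ⟨hR.pow 2, (hasFiniteIntegral_iff_ofReal (Eventually.of_forall fun ω => sq_nonneg _)).2 h⟩

namespace Trial

variable {Ω : Type*} {d K : ℕ} (T : Trial Ω d K)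

/-- Coefficient of the residual of unit `i` in the estimate of `v ⬝ᵥ θ w`. -/
noncomputable def residualCoeff (n : ℕ) (agg : Federation) (w : Fin 2) (v : Fin (d + 1) → ℝ)
    (i : Fin n) (ω : Ω) : ℝ :=
  if T.W i ω = w then (T.sample n ω).weight agg w (T.H i ω) v ⬝ᵥ augment (T.X i ω) else 0

/-- Average of the augmented covariates of the first `n` units. -/
noncomputable def meanX (n : ℕ) (ω : Ω) : Fin (d + 1) → ℝ :=
  (1 / (n : ℝ)) • ∑ i : Fin n, augment (T.X i ω)

theorem sum_residualCoeff_mul (n : ℕ) (agg : Federation) (w : Fin 2) (v : Fin (d + 1) → ℝ)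
    (θ : Fin 2 → Fin (d + 1) → ℝ) (ω : Ω) :
    ∑ i : Fin n, T.residualCoeff n agg w v i ω * T.residual θ i ω =
      ∑ i ∈ (T.sample n ω).inArm w, ((T.sample n ω).weight agg w ((T.sample n ω).study i) v ⬝ᵥ
        augment ((T.sample n ω).x i)) *
          ((T.sample n ω).y i - augment ((T.sample n ω).x i) ⬝ᵥ θ w) := by
  rw [Sample.inArm, Finset.sum_filter]
  refine Finset.sum_congr rfl fun i _ => ?_
  by_cases h : T.W i ω = w
  · have h' : (T.sample n ω).arm i = w := h
    rw [if_pos h', residualCoeff, if_pos h, residual]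
    simp only [sample, h]
  · have h' : ¬ (T.sample n ω).arm i = w := h
    rw [if_neg h', residualCoeff, if_neg h, zero_mul]

theorem sum_sq_residualCoeff (n : ℕ) (agg : Federation) (w : Fin 2) (v : Fin (d + 1) → ℝ) (ω : Ω) :
    ∑ i : Fin n, T.residualCoeff n agg w v i ω ^ 2 =
      ∑ i ∈ (T.sample n ω).inArm w, ((T.sample n ω).weight agg w ((T.sample n ω).study i) v ⬝ᵥ
        augment ((T.sample n ω).x i)) ^ 2 := by
  rw [Sample.inArm, Finset.sum_filter]
  refine Finset.sum_congr rfl fun i _ => ?_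
  by_cases h : T.W i ω = w
  · have h' : (T.sample n ω).arm i = w := h
    rw [if_pos h', residualCoeff, if_pos h]
    rfl
  · have h' : ¬ (T.sample n ω).arm i = w := h
    rw [if_neg h', residualCoeff, if_neg h]
    simp

/-- The direction `v` may be random, so that `meanX` can be inserted for the treatment effect. -/
theorem measurable_residualCoeff (n : ℕ) (agg : Federation) (w : Fin 2)
    {v : Ω → Fin (d + 1) → ℝ} (hv : Measurable[T.design n] v) (i : Fin n) :
    Measurable[T.design n] fun ω => T.residualCoeff n agg w (v ω) i ω := by
  let : MeasurableSpace Ω := T.design n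
  have hD := T.measurableDesign_sample_design n
  exact Measurable.ite (hD.arm i (measurableSet_singleton w))
    (Measurable.dotProduct (hD.measurable_weight_study agg w i hv) (hD.measurable_augment i))
    measurable_const

theorem measurable_meanX (n : ℕ) : Measurable[T.design n] (T.meanX n) := by
  let : MeasurableSpace Ω := T.design n
  have hD := T.measurableDesign_sample_design n
  exact (Finset.measurable_fun_sum _ fun i _ => hD.measurable_augment i).const_smul (1 / (n : ℝ))

theorem tauFed_sample (n : ℕ) (ω : Ω) (t : Fin 2 → Fin (d + 1) → ℝ) :
    (T.sample n ω).tauFed t = T.meanX n ω ⬝ᵥ t 1 - T.meanX n ω ⬝ᵥ t 0 := by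
  rw [Sample.tauFed_eq, ← dotProduct_sub, meanX, smul_dotProduct, sum_dotProduct, smul_eq_mul]
  rfl

theorem sampleATE_eq (θ : Fin 2 → Fin (d + 1) → ℝ) (n : ℕ) (ω : Ω) :
    T.sampleATE θ n ω = T.meanX n ω ⬝ᵥ θ 1 - T.meanX n ω ⬝ᵥ θ 0 := by
  rw [sampleATE, ← dotProduct_sub, meanX, smul_dotProduct, sum_dotProduct, smul_eq_mul]

variable {T} [MeasurableSpace Ω] {P : Measure Ω}
  [IsProbabilityMeasure P] {θ : Fin 2 → Fin (d + 1) → ℝ} {σ : ℝ}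

namespace IsCovariateShiftRCT

theorem neZero (hT : T.IsCovariateShiftRCT P θ σ) : NeZero K := by
  constructor
  rintro rfl
  obtain ⟨ω⟩ := nonempty_of_isProbabilityMeasure P
  exact (T.H 0 ω).elim0

theorem dotProduct_thetaOneShot (hT : T.IsCovariateShiftRCT P θ σ) {n : ℕ} {ω : Ω}
    (h : ω ∈ T.fullRank n) (agg : Federation) (w : Fin 2) (v : Fin (d + 1) → ℝ) :
    v ⬝ᵥ (T.sample n ω).thetaOneShot σ agg w = v ⬝ᵥ θ w +
      ∑ i : Fin n, T.residualCoeff n agg w v i ω * T.residual θ i ω := by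
  have := hT.neZero
  rw [sum_residualCoeff_mul]
  exact Sample.LocalFullRank.dotProduct_thetaOneShot h hT.sigma_pos agg w v (θ w)

/-- Both arms are evaluated in the direction `meanX`. The coefficients remain determined by the
design, so the residual lemmas apply to the treatment effect as they do to the parameters. -/
theorem tauOneShot_eq (hT : T.IsCovariateShiftRCT P θ σ) {n : ℕ} {ω : Ω}
    (h : ω ∈ T.fullRank n) (agg : Federation) :
    (T.sample n ω).tauOneShot σ agg = T.sampleATE θ n ω +
      ∑ i : Fin n, (T.residualCoeff n agg 1 (T.meanX n ω) i ω -
        T.residualCoeff n agg 0 (T.meanX n ω) i ω) * T.residual θ i ω := by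
  simp_rw [sub_mul]
  rw [Sample.tauOneShot, tauFed_sample, sampleATE_eq, hT.dotProduct_thetaOneShot h agg 1,
    hT.dotProduct_thetaOneShot h agg 0, Finset.sum_sub_distrib]
  ring

end IsCovariateShiftRCT

namespace IsFullRankDesignEvent

variable {n : ℕ} {S : Set Ω}

theorem ae_cond (hS : T.IsFullRankDesignEvent P n S) (hT : T.IsCovariateShiftRCT P θ σ) :
    ∀ᵐ ω ∂P[|S], ω ∈ T.fullRank n :=
  Measure.ae_smul_measure ((ae_restrict_iff' (hT.design_le n _ hS.measurableSet)).2 hS.fullRank) _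

theorem integral_sum_mul_residual (hS : T.IsFullRankDesignEvent P n S)
    (hT : T.IsCovariateShiftRCT P θ σ) {c : Fin n → Ω → ℝ}
    (hc : ∀ i, Measurable[T.design n] (c i))
    (hint : Integrable (fun ω => ∑ i, c i ω * T.residual θ i ω) P[|S]) :
    ∫ ω, ∑ i, c i ω * T.residual θ i ω ∂P[|S] = 0 := by
  rw [integral_cond, hT.setIntegral_sum_mul_residual hc hS.measurableSet
    ((integrable_cond_iff hS.pos).1 hint), mul_zero]

theorem lintegral_sq_sum_mul_residual (hS : T.IsFullRankDesignEvent P n S)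
    (hT : T.IsCovariateShiftRCT P θ σ) {c : Fin n → Ω → ℝ}
    (hc : ∀ i, Measurable[T.design n] (c i)) :
    ∫⁻ ω, ENNReal.ofReal ((∑ i, c i ω * T.residual θ i ω) ^ 2) ∂P[|S] =
      ∫⁻ ω, ENNReal.ofReal (σ ^ 2 * ∑ i, c i ω ^ 2) ∂P[|S] := by
  rw [lintegral_cond, lintegral_cond, hT.setLIntegral_sq_sum_mul_residual hc hS.measurableSet]

theorem measurable_sum_mul_residual (hT : T.IsCovariateShiftRCT P θ σ) {c : Fin n → Ω → ℝ}
    (hc : ∀ i, Measurable[T.design n] (c i)) :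
    Measurable fun ω => ∑ i, c i ω * T.residual θ i ω :=
  Finset.measurable_fun_sum _ fun i _ =>
    ((hc i).mono (hT.design_le n) le_rfl).mul (hT.measurable_residual i)

theorem integral_thetaOneShot (hS : T.IsFullRankDesignEvent P n S)
    (hT : T.IsCovariateShiftRCT P θ σ) (agg : Federation) (w : Fin 2) (j : Fin (d + 1))
    (hint : Integrable (fun ω => (T.sample n ω).thetaOneShot σ agg w j) P[|S]) :
    ∫ ω, (T.sample n ω).thetaOneShot σ agg w j ∂P[|S] = θ w j := by
  have hp := cond_isProbabilityMeasure hS.pos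
  have heq : (fun ω => (T.sample n ω).thetaOneShot σ agg w j) =ᵐ[P[|S]] fun ω => θ w j +
      ∑ i : Fin n, T.residualCoeff n agg w (Pi.single j 1) i ω * T.residual θ i ω := by
    filter_upwards [hS.ae_cond hT] with ω hω
    simpa using hT.dotProduct_thetaOneShot hω agg w (Pi.single j 1)
  have hR : Integrable (fun ω => ∑ i : Fin n,
      T.residualCoeff n agg w (Pi.single j 1) i ω * T.residual θ i ω) P[|S] :=
    ((hint.congr heq).sub (integrable_const (θ w j))).congr
      (Eventually.of_forall fun ω => add_sub_cancel_left _ _)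
  rw [integral_congr_ae heq, integral_add (integrable_const _) hR,
    hS.integral_sum_mul_residual hT (T.measurable_residualCoeff n agg w measurable_const) hR]
  simp

theorem evariance_thetaOneShot (hS : T.IsFullRankDesignEvent P n S)
    (hT : T.IsCovariateShiftRCT P θ σ) (agg : Federation) (w : Fin 2) (v : Fin (d + 1) → ℝ) :
    evariance (fun ω => v ⬝ᵥ (T.sample n ω).thetaOneShot σ agg w) P[|S] =
      ∫⁻ ω, ENNReal.ofReal (σ ^ 2 * ∑ i : Fin n, T.residualCoeff n agg w v i ω ^ 2) ∂P[|S] := by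
  have hp := cond_isProbabilityMeasure hS.pos
  have hc := T.measurable_residualCoeff n agg w (v := fun _ => v) measurable_const
  rw [← hS.lintegral_sq_sum_mul_residual hT hc]
  refine evariance_eq_lintegral_of_ae_eq_add (c := v ⬝ᵥ θ w) ?_
    (measurable_sum_mul_residual hT hc).aestronglyMeasurable (hS.integral_sum_mul_residual hT hc)
  filter_upwards [hS.ae_cond hT] with ω hω
  exact hT.dotProduct_thetaOneShot hω agg w v

/-- Both estimates have the same constant as centre, so their variances are means of the conditional
ones, and Gauss–Markov compares the integrands design by design. -/
theorem evariance_IVW_le_SW (hS : T.IsFullRankDesignEvent P n S)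
    (hT : T.IsCovariateShiftRCT P θ σ) (w : Fin 2) (v : Fin (d + 1) → ℝ) :
    evariance (fun ω => v ⬝ᵥ (T.sample n ω).thetaOneShot σ .IVW w) P[|S] ≤
      evariance (fun ω => v ⬝ᵥ (T.sample n ω).thetaOneShot σ .SW w) P[|S] := by
  rw [hS.evariance_thetaOneShot hT, hS.evariance_thetaOneShot hT]
  refine lintegral_mono_ae ?_
  filter_upwards [hS.ae_cond hT] with ω hω
  refine ENNReal.ofReal_le_ofReal (mul_le_mul_of_nonneg_left ?_ (sq_nonneg σ))
  rw [sum_sq_residualCoeff, sum_sq_residualCoeff]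
  have := hT.neZero
  exact Sample.LocalFullRank.sum_sq_weight_le hω w v

theorem thetaPool_ae_eq (hS : T.IsFullRankDesignEvent P n S)
    (hT : T.IsCovariateShiftRCT P θ σ) (w : Fin 2) :
    (fun ω => (T.sample n ω).thetaOneShot σ .IVW w) =ᵐ[P[|S]]
      fun ω => (T.sample n ω).thetaPool w := by
  have := hT.neZero
  filter_upwards [hS.ae_cond hT] with ω hω
  exact Sample.LocalFullRank.thetaOneShot_IVW hω hT.sigma_pos w

theorem thetaGD_ae_eq (hS : T.IsFullRankDesignEvent P n S)
    (hT : T.IsCovariateShiftRCT P θ σ) {η : Ω → Fin 2 → ℝ}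
    (hη : ∀ ω w, (T.sample n ω).IsLearningRate w (η ω w)) (θ₀ : Fin (d + 1) → ℝ) (w : Fin 2) :
    (fun ω => (T.sample n ω).thetaGD (η ω) θ₀ w) =ᵐ[P[|S]]
      fun ω => (T.sample n ω).thetaPool w := by
  have := hT.neZero
  filter_upwards [hS.ae_cond hT] with ω hω
  exact Sample.LocalFullRank.thetaGD_eq hω (hη ω w) θ₀

end IsFullRankDesignEvent

end Trial

/-! ### Covariance matrices and the Loewner order. -/

section Covariance

variable {Ω : Type*} [MeasurableSpace Ω] {m : ℕ} {Q : Measure Ω}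

theorem covMatrix_congr {s t : Ω → Fin m → ℝ} (h : s =ᵐ[Q] t) : covMatrix s Q = covMatrix t Q := by
  have hj : ∀ j, (fun ω => s ω j) =ᵐ[Q] fun ω => t ω j := fun j =>
    h.mono fun ω hω => congrFun hω j
  ext i j
  simp only [covMatrix, Matrix.of_apply, covariance]
  rw [integral_congr_ae (hj i), integral_congr_ae (hj j)]
  refine integral_congr_ae ?_
  filter_upwards [hj i, hj j] with ω hi hj
  rw [hi, hj]

theorem covMatrix_isHermitian (t : Ω → Fin m → ℝ) : (covMatrix t Q).IsHermitian := by
  ext i j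
  simp [covMatrix, covariance_comm]

theorem dotProduct_covMatrix_mulVec [IsProbabilityMeasure Q] {t : Ω → Fin m → ℝ}
    (ht : ∀ j, MemLp (fun ω => t ω j) 2 Q) (v : Fin m → ℝ) :
    v ⬝ᵥ covMatrix t Q *ᵥ v = Var[fun ω => v ⬝ᵥ t ω; Q] := by
  have hv : ∀ j, MemLp (fun ω => v j * t ω j) 2 Q := fun j => (ht j).const_mul _
  have hm : MemLp (fun ω => v ⬝ᵥ t ω) 2 Q := memLp_finsetSum _ fun j _ => hv j
  rw [← covariance_self hm.aestronglyMeasurable.aemeasurable]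
  simp only [dotProduct]
  rw [covariance_fun_sum_fun_sum hv hv]
  refine Finset.sum_congr rfl fun i _ => ?_
  simp only [mulVec, dotProduct, Finset.mul_sum]
  refine Finset.sum_congr rfl fun j _ => ?_
  rw [covariance_const_mul_left, covariance_const_mul_right, covMatrix, Matrix.of_apply]
  ring

/-- The quadratic form of a covariance matrix at `v` is the variance in direction `v`; finite second
moments turn the extended inequality into a real one. -/
theorem covMatrix_sub_posSemidef [IsProbabilityMeasure Q] {s t : Ω → Fin m → ℝ}
    (hs : ∀ j, MemLp (fun ω => s ω j) 2 Q) (ht : ∀ j, MemLp (fun ω => t ω j) 2 Q)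
    (h : ∀ v : Fin m → ℝ, evariance (fun ω => v ⬝ᵥ s ω) Q ≤ evariance (fun ω => v ⬝ᵥ t ω) Q) :
    (covMatrix t Q - covMatrix s Q).PosSemidef := by
  refine Matrix.PosSemidef.of_dotProduct_mulVec_nonneg
    ((covMatrix_isHermitian t).sub (covMatrix_isHermitian s)) fun v => ?_
  rw [star_trivial, Matrix.sub_mulVec, dotProduct_sub, dotProduct_covMatrix_mulVec hs,
    dotProduct_covMatrix_mulVec ht, sub_nonneg]
  have hm : MemLp (fun ω => v ⬝ᵥ t ω) 2 Q := memLp_finsetSum _ fun j _ => (ht j).const_mul _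
  exact ENNReal.toReal_mono hm.evariance_lt_top.ne (h v)

end Covariance

/-! ### Population, study and sample average treatment effects. -/

namespace Trial

variable {Ω : Type*} {d K : ℕ} {T : Trial Ω d K} [MeasurableSpace Ω] {P : Measure Ω}
  [IsProbabilityMeasure P] {θ : Fin 2 → Fin (d + 1) → ℝ} {σ : ℝ}

namespace IsCovariateShiftRCT

theorem memLp_augment_zero (hT : T.IsCovariateShiftRCT P θ σ) (j : Fin (d + 1)) :
    MemLp (fun ω => augment (T.X 0 ω) j) 2 P := by
  refine Fin.cases ?_ (fun j => ?_) j
  · simpa [augment] using memLp_const (1 : ℝ)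
  · simp only [augment, Fin.cons_succ]
    exact (ContinuousLinearMap.proj (R := ℝ) (φ := fun _ : Fin d => ℝ) j).comp_memLp' hT.memLp_X

theorem memLp_augment_dotProduct (hT : T.IsCovariateShiftRCT P θ σ) (v : Fin (d + 1) → ℝ) :
    MemLp (fun ω => augment (T.X 0 ω) ⬝ᵥ v) 2 P :=
  memLp_finsetSum _ fun j _ => (hT.memLp_augment_zero j).mul_const _

theorem integrable_augment_dotProduct (hT : T.IsCovariateShiftRCT P θ σ) (v : Fin (d + 1) → ℝ) :
    Integrable (fun ω => augment (T.X 0 ω) ⬝ᵥ v) P :=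
  (hT.memLp_augment_dotProduct v).integrable one_le_two

theorem measurable_unit_augment_dotProduct (v : Fin (d + 1) → ℝ) :
    Measurable fun z : (Fin d → ℝ) × Fin 2 × Fin K × (Fin 2 → ℝ) => augment z.1 ⬝ᵥ v :=
  Measurable.dotProduct (measurable_augment.comp measurable_fst) measurable_const

theorem measurableSet_study (hT : T.IsCovariateShiftRCT P θ σ) (k : Fin K) :
    MeasurableSet (T.H 0 ⁻¹' {k}) := hT.measurable_H 0 (measurableSet_singleton k)

theorem study_real_ne_zero (hT : T.IsCovariateShiftRCT P θ σ) (k : Fin K) :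
    P.real (T.H 0 ⁻¹' {k}) ≠ 0 :=
  ENNReal.toReal_ne_zero.2 ⟨(hT.study_pos k).ne', measure_ne_top _ _⟩

theorem setIntegral_study (hT : T.IsCovariateShiftRCT P θ σ) (k : Fin K) (f : Ω → ℝ) :
    ∫ ω in T.H 0 ⁻¹' {k}, f ω ∂P = P.real (T.H 0 ⁻¹' {k}) * ∫ ω, f ω ∂P[|T.H 0 ⁻¹' {k}] := by
  rw [integral_cond, mul_inv_cancel_left₀ (hT.study_real_ne_zero k)]

theorem integral_eq_sum_study (hT : T.IsCovariateShiftRCT P θ σ) {f : Ω → ℝ}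
    (hf : Integrable f P) :
    ∫ ω, f ω ∂P = ∑ k, P.real (T.H 0 ⁻¹' {k}) * ∫ ω, f ω ∂P[|T.H 0 ⁻¹' {k}] := by
  simp_rw [← hT.setIntegral_study]
  rw [← integral_iUnion_fintype (fun k => hT.measurableSet_study k)
    (fun i j hij => (Set.disjoint_singleton.2 hij).preimage _) (fun k => hf.integrableOn)]
  rw [← Set.preimage_iUnion, Set.iUnion_of_singleton, Set.preimage_univ, Measure.restrict_univ]

theorem integrable_noise (hT : T.IsCovariateShiftRCT P θ σ) (w : Fin 2) :
    Integrable (T.noise θ w) P := (hT.memLp_noise w).integrable one_le_two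

theorem integral_noise_study (hT : T.IsCovariateShiftRCT P θ σ) (k : Fin K) (w : Fin 2) :
    ∫ ω, T.noise θ w ω ∂P[|T.H 0 ⁻¹' {k}] = 0 := by
  have hp := cond_isProbabilityMeasure (hT.study_pos k).ne'
  rw [← integral_condExp (hT.measurable_X 0).comap_le, integral_congr_ae (hT.noise_mean k w)]
  simp

theorem effect_eq (ω : Ω) : T.Y 0 1 ω - T.Y 0 0 ω =
    augment (T.X 0 ω) ⬝ᵥ (θ 1 - θ 0) + (T.noise θ 1 ω - T.noise θ 0 ω) := by
  rw [noise, noise, dotProduct_sub]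
  ring

/-- The noise of each arm has mean zero in every study, so only the linear part of the effect
remains. -/
theorem studyATE_eq (hT : T.IsCovariateShiftRCT P θ σ) (k : Fin K) :
    T.studyATE P k = ∫ ω, augment (T.X 0 ω) ⬝ᵥ (θ 1 - θ 0) ∂P[|T.H 0 ⁻¹' {k}] := by
  have hk := (hT.study_pos k).ne'
  have hn := fun w => (hT.integrable_noise w).cond_of_ne_zero hk
  have hd : Integrable (fun ω => T.noise θ 1 ω - T.noise θ 0 ω) P[|T.H 0 ⁻¹' {k}] :=
    (hn 1).sub (hn 0)
  simp_rw [studyATE, effect_eq (θ := θ)]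
  rw [integral_add ((hT.integrable_augment_dotProduct _).cond_of_ne_zero hk) hd,
    integral_sub (hn 1) (hn 0), hT.integral_noise_study, hT.integral_noise_study]
  simp

theorem integral_noise (hT : T.IsCovariateShiftRCT P θ σ) (w : Fin 2) :
    ∫ ω, T.noise θ w ω ∂P = 0 := by
  rw [hT.integral_eq_sum_study (hT.integrable_noise w)]
  simp_rw [hT.integral_noise_study]
  simp

theorem ate_eq (hT : T.IsCovariateShiftRCT P θ σ) :
    T.ate P = ∫ ω, augment (T.X 0 ω) ⬝ᵥ (θ 1 - θ 0) ∂P := by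
  have hd : Integrable (fun ω => T.noise θ 1 ω - T.noise θ 0 ω) P :=
    (hT.integrable_noise 1).sub (hT.integrable_noise 0)
  simp_rw [ate, effect_eq (θ := θ)]
  rw [integral_add (hT.integrable_augment_dotProduct _) hd,
    integral_sub (hT.integrable_noise 1) (hT.integrable_noise 0), hT.integral_noise,
    hT.integral_noise]
  simp

theorem ate_eq_sum (hT : T.IsCovariateShiftRCT P θ σ) :
    T.ate P = ∑ k, P.real (T.H 0 ⁻¹' {k}) * T.studyATE P k := by
  rw [hT.ate_eq, hT.integral_eq_sum_study (hT.integrable_augment_dotProduct _)]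
  simp_rw [hT.studyATE_eq]

theorem identDistrib_augment_dotProduct (hT : T.IsCovariateShiftRCT P θ σ) (v : Fin (d + 1) → ℝ)
    (i : ℕ) : IdentDistrib (fun ω => augment (T.X i ω) ⬝ᵥ v) (fun ω => augment (T.X 0 ω) ⬝ᵥ v)
      P P :=
  hT.identDistrib_comp_unit (measurable_unit_augment_dotProduct v) i

theorem integrable_unit_augment_dotProduct (hT : T.IsCovariateShiftRCT P θ σ) (i : ℕ)
    (v : Fin (d + 1) → ℝ) : Integrable (fun ω => augment (T.X i ω) ⬝ᵥ v) P :=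
  (hT.identDistrib_augment_dotProduct v i).integrable_iff.2 (hT.integrable_augment_dotProduct v)

theorem integrable_sampleATE (hT : T.IsCovariateShiftRCT P θ σ) (n : ℕ) :
    Integrable (T.sampleATE θ n) P :=
  Integrable.const_mul (integrable_finsetSum Finset.univ fun (i : Fin n) _ =>
    hT.integrable_unit_augment_dotProduct i (θ 1 - θ 0)) (1 / (n : ℝ))

theorem integral_sampleATE (hT : T.IsCovariateShiftRCT P θ σ) {n : ℕ} (hn : n ≠ 0) :
    ∫ ω, T.sampleATE θ n ω ∂P = T.ate P := by
  have hn' : (n : ℝ) ≠ 0 := Nat.cast_ne_zero.2 hn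
  simp_rw [sampleATE]
  rw [integral_const_mul, integral_finsetSum _ fun (i : Fin n) _ =>
    hT.integrable_unit_augment_dotProduct i (θ 1 - θ 0)]
  simp_rw [fun i : Fin n => (hT.identDistrib_augment_dotProduct (θ 1 - θ 0) i).integral_eq,
    ← hT.ate_eq]
  simp [hn']

theorem integral_sum_studyATE (hT : T.IsCovariateShiftRCT P θ σ) {n : ℕ} (hn : n ≠ 0) :
    ∫ ω, ∑ k, (((T.sample n ω).inStudy k).card : ℝ) / n * T.studyATE P k ∂P = T.ate P := by
  have hn' : (n : ℝ) ≠ 0 := Nat.cast_ne_zero.2 hn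
  have hcard : ∀ k ω, (((T.sample n ω).inStudy k).card : ℝ) =
      ∑ i : Fin n, (T.H i ⁻¹' {k}).indicator (fun _ => (1 : ℝ)) ω := by
    intro k ω
    rw [Sample.inStudy, Finset.card_filter, Nat.cast_sum]
    refine Finset.sum_congr rfl fun i _ => ?_
    by_cases h : T.H i ω = k <;> simp [sample, h]
  have hm : ∀ (i : ℕ) k, MeasurableSet (T.H i ⁻¹' {k}) := fun i k =>
    hT.measurable_H i (measurableSet_singleton k)
  have hi : ∀ k (i : ℕ), Integrable ((T.H i ⁻¹' {k}).indicator (fun _ => (1 : ℝ))) P :=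
    fun k i => (integrable_const 1).indicator (hm i k)
  have hint : ∀ k, ∫ ω, (((T.sample n ω).inStudy k).card : ℝ) ∂P =
      n * P.real (T.H 0 ⁻¹' {k}) := by
    intro k
    simp_rw [hcard]
    rw [integral_finsetSum _ fun (i : Fin n) _ => hi k i]
    have : ∀ i : Fin n, ∫ ω, (T.H i ⁻¹' {k}).indicator (fun _ => (1 : ℝ)) ω ∂P =
        P.real (T.H 0 ⁻¹' {k}) := by
      intro i
      rw [integral_indicator_const _ (hm i k), smul_eq_mul, mul_one, Measure.real, Measure.real]
      congr 1
      exact ((hT.identDistrib_comp_unit (g := fun z => z.2.2.1)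
        measurable_snd.snd.fst i).measure_mem_eq (measurableSet_singleton k))
    simp [this]
  rw [integral_finsetSum _ fun k _ => ?_]
  · rw [hT.ate_eq_sum]
    refine Finset.sum_congr rfl fun k _ => ?_
    rw [integral_mul_const, integral_div, hint, mul_div_cancel_left₀ _ hn']
  · refine Integrable.mul_const (Integrable.div_const ?_ _) _
    simp_rw [hcard]
    exact integrable_finsetSum _ fun i _ => hi k i

/-- By randomization, knowing the arm in addition to the study does not change the mean of the
covariates. -/
theorem setIntegral_cell (hT : T.IsCovariateShiftRCT P θ σ) (k : Fin K) (w : Fin 2) :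
    ∫ ω, (if T.H 0 ω = k ∧ T.W 0 ω = w then 1 else 0) * (augment (T.X 0 ω) ⬝ᵥ (θ 1 - θ 0)) ∂P =
      (∫ ω, (if T.H 0 ω = k ∧ T.W 0 ω = w then (1 : ℝ) else 0) ∂P) * T.studyATE P k := by
  have hind : IndepFun (fun ω => if T.W 0 ω = w then (1 : ℝ) else 0)
      (fun ω => augment (T.X 0 ω) ⬝ᵥ (θ 1 - θ 0)) P[|T.H 0 ⁻¹' {k}] :=
    IndepFun.comp (φ := fun a : Fin 2 => if a = w then (1 : ℝ) else 0)
      (ψ := fun p : (Fin d → ℝ) × (Fin 2 → ℝ) => augment p.1 ⬝ᵥ (θ 1 - θ 0)) (hT.randomized k)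
      (measurable_of_countable _)
      (Measurable.dotProduct (measurable_augment.comp measurable_fst) measurable_const)
  have h1 : ∀ f : Ω → ℝ, ∫ ω, (if T.H 0 ω = k ∧ T.W 0 ω = w then 1 else 0) * f ω ∂P =
      P.real (T.H 0 ⁻¹' {k}) *
        ∫ ω, (if T.W 0 ω = w then 1 else 0) * f ω ∂P[|T.H 0 ⁻¹' {k}] := by
    intro f
    rw [← hT.setIntegral_study, ← integral_indicator (hT.measurableSet_study k)]
    congr 1
    funext ω
    by_cases h : T.H 0 ω = k <;> simp [h]
  have h2 := h1 fun _ => 1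
  simp only [mul_one] at h2
  rw [h1, h2, hind.integral_fun_mul_eq_mul_integral, hT.studyATE_eq, mul_assoc]
  · exact ((measurable_of_countable (fun a : Fin 2 => if a = w then (1 : ℝ) else 0)).comp
      (hT.measurable_W 0)).aestronglyMeasurable
  · exact (Measurable.dotProduct (hT.measurable_augment_X 0) measurable_const).aestronglyMeasurable

/-- The indicator of the allocation is a product over units. Independence reduces the claim to unit
`i`, where `setIntegral_cell` applies; the other factors cancel against the probability of the
allocation. -/
theorem integral_augment_allocation (hT : T.IsCovariateShiftRCT P θ σ) {n : ℕ}
    {h : Fin n → Fin K} {a : Fin n → Fin 2} (h0 : P (T.allocation n h a) ≠ 0) (i : Fin n) :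
    ∫ ω, augment (T.X i ω) ⬝ᵥ (θ 1 - θ 0) ∂P[|T.allocation n h a] = T.studyATE P (h i) := by
  have hind : iIndepFun (fun (l : Fin n) ω => T.unit l ω) P :=
    hT.indep.precomp (g := fun l : Fin n => (l : ℕ)) Fin.val_injective
  let f (l : Fin n) (z : (Fin d → ℝ) × Fin 2 × Fin K × (Fin 2 → ℝ)) : ℝ :=
    if z.2.2.1 = h l ∧ z.2.1 = a l then 1 else 0
  -- The effect sits in factor `i` only, which makes the integrand a product over units.
  let g (l : Fin n) (z : (Fin d → ℝ) × Fin 2 × Fin K × (Fin 2 → ℝ)) : ℝ :=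
    if l = i then augment z.1 ⬝ᵥ (θ 1 - θ 0) else 1
  have hf : ∀ l, Measurable (f l) := fun l => Measurable.ite
    ((measurable_snd.snd.fst (measurableSet_singleton (h l))).inter
      (measurable_snd.fst (measurableSet_singleton (a l)))) measurable_const measurable_const
  have hg : ∀ l, Measurable (g l) := fun l => by
    by_cases hl : l = i
    · simp only [g, hl, if_true]
      exact measurable_unit_augment_dotProduct _
    · simp [g, hl]
  have hA : MeasurableSet (T.allocation n h a) := by
    have : T.allocation n h a = ⋂ l : Fin n, T.H l ⁻¹' {h l} ∩ T.W l ⁻¹' {a l} := by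
      ext ω; simp [allocation]
    rw [this]
    exact MeasurableSet.iInter fun l => (hT.measurable_H l (measurableSet_singleton _)).inter
      (hT.measurable_W l (measurableSet_singleton _))
  have hprodf : ∀ ω, ∏ l, f l (T.unit l ω) = (T.allocation n h a).indicator (fun _ => 1) ω := by
    intro ω
    by_cases hω : ω ∈ T.allocation n h a
    · rw [Set.indicator_of_mem hω]
      exact Finset.prod_eq_one fun l _ => if_pos (hω l)
    · rw [Set.indicator_of_notMem hω]
      simp only [allocation, Set.mem_ofPred_eq, not_forall] at hω
      obtain ⟨l, hl⟩ := hω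
      exact Finset.prod_eq_zero (Finset.mem_univ l) (if_neg hl)
  have hprodg : ∀ ω, ∏ l, g l (T.unit l ω) = augment (T.X i ω) ⬝ᵥ (θ 1 - θ 0) := by
    intro ω
    rw [Finset.prod_eq_single i (fun l _ hl => if_neg hl) (by simp)]
    exact if_pos rfl
  have hreal : P.real (T.allocation n h a) = ∏ l, ∫ ω, f l (T.unit l ω) ∂P := by
    rw [← hind.integral_fun_prod_comp (fun l => (hT.measurable_unit l).aemeasurable)
      fun l => (hf l).aestronglyMeasurable]
    simp_rw [hprodf]
    rw [integral_indicator_const _ hA, smul_eq_mul, mul_one]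
  have hl : ∀ l, ∫ ω, f l (T.unit l ω) * g l (T.unit l ω) ∂P =
      (∫ ω, f l (T.unit l ω) ∂P) * if l = i then T.studyATE P (h i) else 1 := by
    intro l
    rw [(hT.identDistrib_comp_unit (g := fun z => f l z * g l z) ((hf l).mul (hg l)) l).integral_eq,
      (hT.identDistrib_comp_unit (hf l) l).integral_eq]
    by_cases hl : l = i
    · subst hl
      simp only [f, g, if_true]
      exact hT.setIntegral_cell (h l) (a l)
    · simp [g, hl]
  have hset : ∫ ω in T.allocation n h a, augment (T.X i ω) ⬝ᵥ (θ 1 - θ 0) ∂P =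
      P.real (T.allocation n h a) * T.studyATE P (h i) := by
    rw [← integral_indicator hA]
    trans ∫ ω, ∏ l, (f l (T.unit l ω) * g l (T.unit l ω)) ∂P
    · congr 1
      funext ω
      rw [Finset.prod_mul_distrib, hprodf, hprodg]
      by_cases hω : ω ∈ T.allocation n h a <;> simp [hω]
    · rw [hind.integral_fun_prod_comp (f := fun l z => f l z * g l z)
        (fun l => (hT.measurable_unit l).aemeasurable)
        fun l => ((hf l).mul (hg l)).aestronglyMeasurable]
      simp_rw [hl]
      rw [Finset.prod_mul_distrib, ← hreal]
      simp
  rw [integral_cond, hset, inv_mul_cancel_left₀]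
  exact ENNReal.toReal_ne_zero.2 ⟨h0, measure_ne_top _ _⟩

theorem integral_sampleATE_allocation (hT : T.IsCovariateShiftRCT P θ σ) {n : ℕ}
    {h : Fin n → Fin K} {a : Fin n → Fin 2} (h0 : P (T.allocation n h a) ≠ 0) :
    ∫ ω, T.sampleATE θ n ω ∂P[|T.allocation n h a] =
      ∑ k, ((Finset.univ.filter fun i => h i = k).card : ℝ) / n * T.studyATE P k := by
  simp_rw [sampleATE]
  rw [integral_const_mul, integral_finsetSum _ fun (i : Fin n) _ =>
    (hT.integrable_unit_augment_dotProduct i (θ 1 - θ 0)).cond_of_ne_zero h0]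
  simp_rw [hT.integral_augment_allocation h0]
  rw [← Finset.sum_fiberwise Finset.univ h, Finset.mul_sum]
  refine Finset.sum_congr rfl fun k _ => ?_
  rw [Finset.sum_congr rfl fun i hi => by rw [(Finset.mem_filter.1 hi).2], Finset.sum_const,
    nsmul_eq_mul]
  ring

end IsCovariateShiftRCT

namespace IsFullRankDesignEvent

variable {n : ℕ} {S : Set Ω}

/-- The sample effect is integrable without assumption, so integrability of the estimator passes to
the residual sum, whose mean is then zero. -/
theorem integral_tauOneShot (hS : T.IsFullRankDesignEvent P n S)
    (hT : T.IsCovariateShiftRCT P θ σ) (agg : Federation)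
    (hint : Integrable (fun ω => (T.sample n ω).tauOneShot σ agg) P[|S]) :
    ∫ ω, (T.sample n ω).tauOneShot σ agg ∂P[|S] = ∫ ω, T.sampleATE θ n ω ∂P[|S] := by
  have heq : (fun ω => (T.sample n ω).tauOneShot σ agg) =ᵐ[P[|S]] fun ω => T.sampleATE θ n ω +
      ∑ i : Fin n, (T.residualCoeff n agg 1 (T.meanX n ω) i ω -
        T.residualCoeff n agg 0 (T.meanX n ω) i ω) * T.residual θ i ω := by
    filter_upwards [hS.ae_cond hT] with ω hω
    exact hT.tauOneShot_eq hω agg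
  have hm := (hT.integrable_sampleATE n).cond_of_ne_zero hS.pos
  have hR : Integrable (fun ω => ∑ i : Fin n, (T.residualCoeff n agg 1 (T.meanX n ω) i ω -
      T.residualCoeff n agg 0 (T.meanX n ω) i ω) * T.residual θ i ω) P[|S] :=
    ((hint.congr heq).sub hm).congr (Eventually.of_forall fun ω => add_sub_cancel_left _ _)
  rw [integral_congr_ae heq, integral_add hm hR,
    hS.integral_sum_mul_residual hT (c := fun i ω =>
      T.residualCoeff n agg 1 (T.meanX n ω) i ω - T.residualCoeff n agg 0 (T.meanX n ω) i ω)
      (fun i => (T.measurable_residualCoeff n agg 1 (T.measurable_meanX n) i).sub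
        (T.measurable_residualCoeff n agg 0 (T.measurable_meanX n) i)) hR, add_zero]

end IsFullRankDesignEvent

end Trial

/-! ### Laws of large numbers and the probability of full rank. -/

namespace Trial

variable {Ω : Type*} {d K : ℕ} {T : Trial Ω d K} [MeasurableSpace Ω] {P : Measure Ω}
  [IsProbabilityMeasure P] {θ : Fin 2 → Fin (d + 1) → ℝ} {σ : ℝ}

variable (T P) in
/-- Expected Gram matrix of one unit of study `k` in arm `w`. -/
noncomputable def cellGram (k : Fin K) (w : Fin 2) : Matrix (Fin (d + 1)) (Fin (d + 1)) ℝ :=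
  Matrix.of fun a b => ∫ ω, (if T.H 0 ω = k ∧ T.W 0 ω = w then
    augment (T.X 0 ω) a * augment (T.X 0 ω) b else 0) ∂P

variable (T P) in
/-- Probability of study `k` and arm `w`. -/
noncomputable def cellProb (k : Fin K) (w : Fin 2) : ℝ :=
  ∫ ω, (if T.H 0 ω = k ∧ T.W 0 ω = w then 1 else 0) ∂P

variable (T P) in
/-- Expected augmented covariates. -/
noncomputable def expectedX (j : Fin (d + 1)) : ℝ := ∫ ω, augment (T.X 0 ω) j ∂P

variable (T P) in
/-- Almost sure limit of `n • weight`. -/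
noncomputable def limitWeight :
    Federation → Fin 2 → Fin K → (Fin (d + 1) → ℝ) → Fin (d + 1) → ℝ
  | .SW, w, k, v => (T.cellProb P k w / ∑ l, T.cellProb P l w) • (T.cellGram P k w)⁻¹ *ᵥ v
  | .IVW, w, _, v => (∑ l, T.cellGram P l w)⁻¹ *ᵥ v

namespace IsCovariateShiftRCT

theorem ae_tendsto_mean (hT : T.IsCovariateShiftRCT P θ σ)
    {g : (Fin d → ℝ) × Fin 2 × Fin K × (Fin 2 → ℝ) → ℝ} (hg : Measurable g)
    (hint : Integrable (fun ω => g (T.unit 0 ω)) P) :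
    ∀ᵐ ω ∂P, Tendsto (fun n : ℕ => (n : ℝ)⁻¹ * ∑ i : Fin n, g (T.unit i ω)) atTop
      (𝓝 (∫ ω, g (T.unit 0 ω) ∂P)) := by
  have h := strong_law_ae (fun i ω => g (T.unit i ω)) hint
    (fun i j hij => (hT.iIndepFun_comp_unit hg).indepFun hij) (hT.identDistrib_comp_unit hg)
  filter_upwards [h] with ω hω
  simpa only [Finset.sum_range, smul_eq_mul] using hω

theorem measurable_unit_cell {φ : (Fin d → ℝ) → ℝ} (hφ : Measurable φ) (k : Fin K) (w : Fin 2) :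
    Measurable fun z : (Fin d → ℝ) × Fin 2 × Fin K × (Fin 2 → ℝ) =>
      if z.2.2.1 = k ∧ z.2.1 = w then φ z.1 else 0 :=
  Measurable.ite ((measurable_snd.snd.fst (measurableSet_singleton k)).inter
    (measurable_snd.fst (measurableSet_singleton w))) (hφ.comp measurable_fst) measurable_const

theorem integrable_cell (hT : T.IsCovariateShiftRCT P θ σ) {f : Ω → ℝ}
    (hf : Integrable f P) (k : Fin K) (w : Fin 2) :
    Integrable (fun ω => if T.H 0 ω = k ∧ T.W 0 ω = w then f ω else 0) P := by
  have hA : MeasurableSet (T.H 0 ⁻¹' {k} ∩ T.W 0 ⁻¹' {w}) :=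
    (hT.measurable_H 0 (measurableSet_singleton k)).inter
      (hT.measurable_W 0 (measurableSet_singleton w))
  refine (hf.indicator hA).congr (Eventually.of_forall fun ω => ?_)
  by_cases h : T.H 0 ω = k ∧ T.W 0 ω = w
  · simp only [if_pos h, Set.indicator_of_mem (show ω ∈ T.H 0 ⁻¹' {k} ∩ T.W 0 ⁻¹' {w} from h)]
  · simp only [if_neg h, Set.indicator_of_notMem (show ω ∉ T.H 0 ⁻¹' {k} ∩ T.W 0 ⁻¹' {w} from h)]

theorem ae_tendsto_mean_inCell (hT : T.IsCovariateShiftRCT P θ σ) {φ : (Fin d → ℝ) → ℝ}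
    (hφ : Measurable φ) (hint : Integrable (fun ω => φ (T.X 0 ω)) P) (k : Fin K) (w : Fin 2) :
    ∀ᵐ ω ∂P, Tendsto (fun n : ℕ => (n : ℝ)⁻¹ *
      ∑ i ∈ (T.sample n ω).inCell k w, φ ((T.sample n ω).x i)) atTop
      (𝓝 (∫ ω, (if T.H 0 ω = k ∧ T.W 0 ω = w then φ (T.X 0 ω) else 0) ∂P)) := by
  filter_upwards [hT.ae_tendsto_mean (measurable_unit_cell hφ k w) (hT.integrable_cell hint k w)]
    with ω hω
  simp_rw [Sample.inCell, Finset.sum_filter]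
  exact hω

theorem ae_tendsto_card_inCell (hT : T.IsCovariateShiftRCT P θ σ) (k : Fin K) (w : Fin 2) :
    ∀ᵐ ω ∂P, Tendsto (fun n : ℕ => (n : ℝ)⁻¹ * (((T.sample n ω).inCell k w).card : ℝ)) atTop
      (𝓝 (T.cellProb P k w)) := by
  simpa [cellProb] using hT.ae_tendsto_mean_inCell (φ := fun _ => 1) measurable_const
    (integrable_const 1) k w

theorem integrable_augment_mul (hT : T.IsCovariateShiftRCT P θ σ) (a b : Fin (d + 1)) :
    Integrable (fun ω => augment (T.X 0 ω) a * augment (T.X 0 ω) b) P :=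
  (hT.memLp_augment_zero a).integrable_mul (hT.memLp_augment_zero b)

theorem measurable_augment_apply (a : Fin (d + 1)) :
    Measurable fun x : Fin d → ℝ => augment x a :=
  (measurable_pi_apply a).comp measurable_augment

theorem ae_tendsto_gram_inCell (hT : T.IsCovariateShiftRCT P θ σ) (k : Fin K) (w : Fin 2) :
    ∀ᵐ ω ∂P, Tendsto (fun n : ℕ => (n : ℝ)⁻¹ • (T.sample n ω).gram ((T.sample n ω).inCell k w))
      atTop (𝓝 (T.cellGram P k w)) := by
  have h : ∀ a b, ∀ᵐ ω ∂P, Tendsto (fun n : ℕ => ((n : ℝ)⁻¹ •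
      (T.sample n ω).gram ((T.sample n ω).inCell k w)) a b) atTop (𝓝 (T.cellGram P k w a b)) := by
    intro a b
    filter_upwards [hT.ae_tendsto_mean_inCell (φ := fun x => augment x a * augment x b)
      ((measurable_augment_apply a).mul (measurable_augment_apply b))
      (hT.integrable_augment_mul a b) k w] with ω hω
    simp only [Matrix.smul_apply, Sample.gram, Matrix.sum_apply, vecMulVec_apply, smul_eq_mul]
    exact hω
  filter_upwards [ae_all_iff.2 fun a => ae_all_iff.2 fun b => h a b] with ω hω
  exact tendsto_pi_nhds.2 fun a => tendsto_pi_nhds.2 fun b => hω a b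

theorem ae_tendsto_meanX (hT : T.IsCovariateShiftRCT P θ σ) :
    ∀ᵐ ω ∂P, Tendsto (fun n : ℕ => T.meanX n ω) atTop (𝓝 (T.expectedX P)) := by
  have h : ∀ j, ∀ᵐ ω ∂P, Tendsto (fun n : ℕ => T.meanX n ω j) atTop (𝓝 (T.expectedX P j)) := by
    intro j
    filter_upwards [hT.ae_tendsto_mean (g := fun z => augment z.1 j)
      ((measurable_augment_apply j).comp measurable_fst)
      ((hT.memLp_augment_zero j).integrable one_le_two)] with ω hω
    simp only [meanX, one_div, Pi.smul_apply, Finset.sum_apply, smul_eq_mul]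
    exact hω
  filter_upwards [ae_all_iff.2 h] with ω hω
  exact tendsto_pi_nhds.2 hω

theorem dotProduct_cellGram_mulVec (hT : T.IsCovariateShiftRCT P θ σ) (k : Fin K) (w : Fin 2)
    (v : Fin (d + 1) → ℝ) : v ⬝ᵥ T.cellGram P k w *ᵥ v =
      ∫ ω, (if T.H 0 ω = k ∧ T.W 0 ω = w then (v ⬝ᵥ augment (T.X 0 ω)) ^ 2 else 0) ∂P := by
  have hi : ∀ a b, Integrable (fun ω => v a * v b * if T.H 0 ω = k ∧ T.W 0 ω = w then
      augment (T.X 0 ω) a * augment (T.X 0 ω) b else 0) P := fun a b =>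
    (hT.integrable_cell (hT.integrable_augment_mul a b) k w).const_mul _
  have heq : ∀ ω, (if T.H 0 ω = k ∧ T.W 0 ω = w then (v ⬝ᵥ augment (T.X 0 ω)) ^ 2 else 0) =
      ∑ a, ∑ b, v a * v b * if T.H 0 ω = k ∧ T.W 0 ω = w then
        augment (T.X 0 ω) a * augment (T.X 0 ω) b else 0 := by
    intro ω
    split_ifs
    · rw [sq, dotProduct, Finset.sum_mul_sum]
      exact Finset.sum_congr rfl fun a _ => Finset.sum_congr rfl fun b _ => by ring
    · simp
  simp_rw [heq]
  rw [integral_finsetSum _ fun a _ => integrable_finsetSum _ fun b _ => hi a b, dotProduct]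
  refine Finset.sum_congr rfl fun a _ => ?_
  rw [integral_finsetSum _ fun b _ => hi a b, mulVec, dotProduct, Finset.mul_sum]
  refine Finset.sum_congr rfl fun b _ => ?_
  rw [integral_const_mul, cellGram, Matrix.of_apply]
  ring

/-- If the form vanished at some `v ≠ 0`, then almost surely every unit of the cell would have
augmented covariates orthogonal to `v`. All sample Gram matrices of the cell would be singular,
against full rank having positive probability for some `n`. -/
theorem cellGram_posDef (hT : T.IsCovariateShiftRCT P θ σ)
    (hfull : ∃ n, P (T.fullRank n) ≠ 0) (k : Fin K) (w : Fin 2) :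
    (T.cellGram P k w).PosDef := by
  refine Matrix.PosDef.of_dotProduct_mulVec_pos ?_ fun v hv => ?_
  · ext a b
    simp [cellGram, mul_comm]
  rw [star_trivial, hT.dotProduct_cellGram_mulVec]
  have hint : Integrable (fun ω =>
      if T.H 0 ω = k ∧ T.W 0 ω = w then (v ⬝ᵥ augment (T.X 0 ω)) ^ 2 else 0) P := by
    refine hT.integrable_cell ?_ k w
    simp_rw [dotProduct_comm v]
    exact (hT.memLp_augment_dotProduct v).integrable_sq
  have hnn : 0 ≤ fun ω =>
      if T.H 0 ω = k ∧ T.W 0 ω = w then (v ⬝ᵥ augment (T.X 0 ω)) ^ 2 else 0 := fun ω => by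
    simp only [Pi.zero_apply]
    split_ifs <;> positivity
  refine lt_of_le_of_ne (integral_nonneg hnn) fun h0 => ?_
  obtain ⟨n, hn⟩ := hfull
  rw [eq_comm, integral_eq_zero_iff_of_nonneg hnn hint] at h0
  have hφ : Measurable fun x : Fin d → ℝ => (v ⬝ᵥ augment x) ^ 2 :=
    (Measurable.dotProduct measurable_const measurable_augment).pow_const 2
  have hi : ∀ i : ℕ, ∀ᵐ ω ∂P,
      (if T.H i ω = k ∧ T.W i ω = w then (v ⬝ᵥ augment (T.X i ω)) ^ 2 else 0) = 0 := fun i =>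
    (hT.identDistrib_comp_unit (measurable_unit_cell hφ k w) i).symm.ae_snd
      (p := fun x => x = 0) (measurableSet_singleton 0) h0
  refine hn (measure_mono_null (fun ω hω => ?_) (ae_all_iff.2 hi))
  intro hall
  have hpd := Sample.LocalFullRank.posDef_inCell (show (T.sample n ω).LocalFullRank from hω) k w
  have hpos := hpd.dotProduct_mulVec_pos hv
  rw [star_trivial, Sample.dotProduct_gram_mulVec, Sample.inCell, Finset.sum_filter] at hpos
  refine hpos.ne' (Finset.sum_eq_zero fun i _ => ?_)
  rw [← sq]
  exact hall i

/-- Because of the intercept, the probability is a diagonal entry of the expected Gram matrix. -/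
theorem cellProb_pos (hT : T.IsCovariateShiftRCT P θ σ)
    (hfull : ∃ n, P (T.fullRank n) ≠ 0) (k : Fin K) (w : Fin 2) : 0 < T.cellProb P k w := by
  have h := (hT.cellGram_posDef hfull k w).dotProduct_mulVec_pos
    (x := Pi.single 0 1) (by simp)
  simpa [cellGram, cellProb, augment] using h

theorem measurableSet_fullRank (hT : T.IsCovariateShiftRCT P θ σ) (n : ℕ) :
    MeasurableSet (T.fullRank n) := by
  have : T.fullRank n = ⋂ k, ⋂ w,
      {ω | ((T.sample n ω).gram ((T.sample n ω).inCell k w)).det ≠ 0} := by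
    ext ω
    simp only [Set.mem_iInter, Set.mem_ofPred_eq]
    refine ⟨fun h k w => (Sample.LocalFullRank.posDef_inCell h k w).isUnit_det.ne_zero,
      fun h k w => ?_⟩
    rw [Matrix.rank_of_isUnit _ ((Matrix.isUnit_iff_isUnit_det _).2 (h k w).isUnit),
      Fintype.card_fin]
  rw [this]
  exact MeasurableSet.iInter fun k => MeasurableSet.iInter fun w =>
    (Measurable.matrix_det ((hT.measurableDesign_sample n).measurable_gram_inCell k w))
      (measurableSet_singleton 0).compl

/-- The normalized Gram matrices converge to an invertible limit, so their determinants are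
eventually nonzero; normalization only rescales the determinant. -/
theorem ae_eventually_mem_fullRank (hT : T.IsCovariateShiftRCT P θ σ)
    (hfull : ∃ n, P (T.fullRank n) ≠ 0) : ∀ᵐ ω ∂P, ∀ᶠ n in atTop, ω ∈ T.fullRank n := by
  filter_upwards [ae_all_iff.2 fun k => ae_all_iff.2 fun w => hT.ae_tendsto_gram_inCell k w]
    with ω hω
  simp only [fullRank, Sample.LocalFullRank, Set.mem_ofPred_eq, eventually_all]
  intro k w
  have hdet := ((continuous_id.matrix_det).tendsto (T.cellGram P k w)).comp (hω k w)
  filter_upwards [hdet.eventually_ne (hT.cellGram_posDef hfull k w).isUnit_det.ne_zero] with n hn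
  rw [Function.comp_apply, id, Matrix.det_smul] at hn
  rw [Matrix.rank_of_isUnit _ ((Matrix.isUnit_iff_isUnit_det _).2
    (right_ne_zero_of_mul hn).isUnit), Fintype.card_fin]

theorem tendsto_measure_fullRank (hT : T.IsCovariateShiftRCT P θ σ)
    (hfull : ∃ n, P (T.fullRank n) ≠ 0) :
    Tendsto (fun n => P (T.fullRank n)) atTop (𝓝 1) := by
  rw [← measure_univ (μ := P)]
  refine tendsto_measure_of_ae_tendsto_indicator_of_isFiniteMeasure atTop MeasurableSet.univ
    hT.measurableSet_fullRank ?_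
  filter_upwards [hT.ae_eventually_mem_fullRank hfull] with ω hω
  filter_upwards [hω] with n hn
  simp [hn]

/-- The law of large numbers is needed in `L¹`, since the expectations to be controlled are taken
under conditional measures that vary with `n`. -/
theorem tendsto_integral_abs_sampleATE_sub (hT : T.IsCovariateShiftRCT P θ σ) :
    Tendsto (fun n => ∫ ω, |T.sampleATE θ n ω - T.ate P| ∂P) atTop (𝓝 0) := by
  have hg := measurable_unit_augment_dotProduct (d := d) (K := K) (θ 1 - θ 0)
  have h := strong_law_Lp le_rfl ENNReal.one_ne_top
    (fun i ω => augment (T.X i ω) ⬝ᵥ (θ 1 - θ 0))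
    (memLp_one_iff_integrable.2 (hT.integrable_augment_dotProduct _))
    (fun i j hij => (hT.iIndepFun_comp_unit hg).indepFun hij) (hT.identDistrib_comp_unit hg)
  have h' := (ENNReal.tendsto_toReal ENNReal.zero_ne_top).comp h
  rw [ENNReal.toReal_zero] at h'
  refine h'.congr fun n => ?_
  have hi : Integrable (fun ω => T.sampleATE θ n ω - T.ate P) P :=
    (hT.integrable_sampleATE n).sub (integrable_const _)
  have heq : (fun ω => (n : ℝ)⁻¹ • ∑ i ∈ Finset.range n, augment (T.X i ω) ⬝ᵥ (θ 1 - θ 0) -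
      ∫ ω, augment (T.X 0 ω) ⬝ᵥ (θ 1 - θ 0) ∂P) = fun ω => T.sampleATE θ n ω - T.ate P := by
    funext ω
    rw [hT.ate_eq, sampleATE, Finset.sum_range, one_div, smul_eq_mul]
  rw [Function.comp_apply, heq, eLpNorm_one_eq_lintegral_enorm, ← integral_norm_eq_lintegral_enorm
    hi.aestronglyMeasurable]
  rfl

end IsCovariateShiftRCT

/-- The deviation under `P[|S n]` is at most the `L¹` deviation under `P` divided by the probability
of `S n`. -/
theorem tendsto_integral_sampleATE_cond (hT : T.IsCovariateShiftRCT P θ σ) {S : ℕ → Set Ω}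
    (hS : Tendsto (fun n => P (S n)) atTop (𝓝 1)) :
    Tendsto (fun n => ∫ ω, T.sampleATE θ n ω ∂P[|S n]) atTop (𝓝 (T.ate P)) := by
  have hr : Tendsto (fun n => P.real (S n)) atTop (𝓝 1) :=
    (ENNReal.tendsto_toReal ENNReal.one_ne_top).comp hS
  have hb : Tendsto (fun n => (P.real (S n))⁻¹ * ∫ ω, |T.sampleATE θ n ω - T.ate P| ∂P) atTop
      (𝓝 0) := by
    simpa using (hr.inv₀ one_ne_zero).mul hT.tendsto_integral_abs_sampleATE_sub
  refine tendsto_iff_norm_sub_tendsto_zero.2 (squeeze_zero' (Eventually.of_forall fun n =>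
    norm_nonneg _) ?_ hb)
  filter_upwards [hr.eventually_ne one_ne_zero] with n hn
  have hP : P (S n) ≠ 0 := fun h => hn (by simp [Measure.real, h])
  have hp := cond_isProbabilityMeasure hP
  have hi : Integrable (fun ω => T.sampleATE θ n ω - T.ate P) P :=
    (hT.integrable_sampleATE n).sub (integrable_const _)
  have h1 : ∫ ω, T.sampleATE θ n ω ∂P[|S n] - T.ate P =
      ∫ ω, (T.sampleATE θ n ω - T.ate P) ∂P[|S n] := by
    rw [integral_sub ((hT.integrable_sampleATE n).cond_of_ne_zero hP) (integrable_const _)]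
    simp
  rw [h1]
  refine (norm_integral_le_integral_norm _).trans ?_
  rw [integral_cond]
  exact mul_le_mul_of_nonneg_left (setIntegral_le_integral hi.norm
    (Eventually.of_forall fun ω => norm_nonneg _)) (inv_nonneg.2 measureReal_nonneg)

end Trial

/-! ### A criterion for convergence in probability. -/

/-- If `D n / B n` tends to zero almost surely and the second moments of `B n` are bounded, then
`D n` tends to zero in probability. -/
theorem tendstoInMeasure_zero_of_tendsto_div {Ω : Type*} [MeasurableSpace Ω] {P : Measure Ω}
    [IsProbabilityMeasure P] {D B : ℕ → Ω → ℝ} (hD : ∀ n, Measurable (D n))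
    (hB : ∀ n, Measurable (B n)) (hpos : ∀ n ω, 0 < B n ω)
    (h : ∀ᵐ ω ∂P, Tendsto (fun n => D n ω / B n ω) atTop (𝓝 0)) {C : ℝ}
    (hC : ∀ n, ∫⁻ ω, ENNReal.ofReal (B n ω ^ 2) ∂P ≤ ENNReal.ofReal C) :
    TendstoInMeasure P D atTop 0 := by
  have hF : TendstoInMeasure P (fun n ω => D n ω / B n ω) atTop 0 :=
    tendstoInMeasure_of_tendsto_ae (fun n => ((hD n).div (hB n)).aestronglyMeasurable) h
  rw [tendstoInMeasure_iff_measureReal_norm] at hF ⊢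
  intro ε hε
  rw [Metric.tendsto_atTop]
  intro η hη
  -- `C'` is a positive bound above `C`, and `δ` is chosen so that `(ε / δ) ^ 2 = 2 * C' / η`;
  -- Markov's inequality then bounds the probability of `B n ≥ ε / δ` by `η / 2`.
  set C' := |C| + 1 with hC'
  have hC'pos : 0 < C' := by positivity
  set δ := ε * √(η / (2 * C')) with hδ
  have hδpos : 0 < δ := by positivity
  obtain ⟨N, hN⟩ := Metric.tendsto_atTop.1 (hF δ hδpos) (η / 2) (half_pos hη)
  refine ⟨N, fun n hn => ?_⟩
  have h1 := hN n hn
  simp only [Pi.zero_apply, sub_zero, Real.dist_eq, Real.norm_eq_abs,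
    abs_of_nonneg measureReal_nonneg] at h1 ⊢
  have hsub : {ω | ε ≤ |D n ω|} ⊆ {ω | δ ≤ |D n ω / B n ω|} ∪ {ω | ε / δ ≤ B n ω} := by
    intro ω hω
    by_contra hcon
    simp only [Set.mem_union, Set.mem_ofPred_eq, not_or, not_le] at hcon hω
    have h2 : |D n ω| = |D n ω / B n ω| * B n ω := by
      rw [abs_div, abs_of_pos (hpos n ω), div_mul_cancel₀ _ (hpos n ω).ne']
    have h3 : |D n ω / B n ω| * B n ω < δ * (ε / δ) :=
      mul_lt_mul'' hcon.1 hcon.2 (abs_nonneg _) (hpos n ω).le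
    rw [mul_div_cancel₀ _ hδpos.ne'] at h3
    linarith
  have hmarkov : P.real {ω | ε / δ ≤ B n ω} ≤ η / 2 := by
    have hsq : {ω | ε / δ ≤ B n ω} ⊆
        {ω | ENNReal.ofReal ((ε / δ) ^ 2) ≤ ENNReal.ofReal (B n ω ^ 2)} := fun ω hω =>
      ENNReal.ofReal_le_ofReal (pow_le_pow_left₀ (by positivity) hω 2)
    have h2 := mul_meas_ge_le_lintegral₀ (μ := P)
      ((hB n).pow_const 2).ennreal_ofReal.aemeasurable (ENNReal.ofReal ((ε / δ) ^ 2))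
    have h3 : ENNReal.ofReal ((ε / δ) ^ 2) * P {ω | ε / δ ≤ B n ω} ≤ ENNReal.ofReal C' :=
      (mul_le_mul_right (measure_mono hsq) _).trans ((h2.trans (hC n)).trans
        (ENNReal.ofReal_le_ofReal (by linarith [le_abs_self C])))
    have h4 := ENNReal.toReal_mono ENNReal.ofReal_ne_top h3
    rw [ENNReal.toReal_mul, ENNReal.toReal_ofReal (by positivity),
      ENNReal.toReal_ofReal hC'pos.le] at h4
    have h5 : (ε / δ) ^ 2 = 2 * C' / η := by
      rw [hδ, div_mul_eq_div_div, div_self hε.ne', one_div, inv_pow,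
        Real.sq_sqrt (by positivity), inv_div]
    rw [h5] at h4
    change 2 * C' / η * P.real _ ≤ C' at h4
    rw [div_mul_eq_mul_div, div_le_iff₀ hη] at h4
    nlinarith
  calc P.real {ω | ε ≤ |D n ω|}
      ≤ P.real ({ω | δ ≤ |D n ω / B n ω|} ∪ {ω | ε / δ ≤ B n ω}) := measureReal_mono hsub
    _ ≤ _ := measureReal_union_le _ _
    _ < η := by linarith

/-! ### Influence functions and their variance. -/

namespace Trial

variable {Ω : Type*} {d K : ℕ}

variable (T : Trial Ω d K) in
/-- Inner product of the augmented covariates of unit `i` with coefficients that depend on its arm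
and study. -/
def score (α : Fin 2 → Fin K → Fin (d + 1) → ℝ) (i : ℕ) (ω : Ω) : ℝ :=
  α (T.W i ω) (T.H i ω) ⬝ᵥ augment (T.X i ω)

variable {T : Trial Ω d K} [MeasurableSpace Ω] {P : Measure Ω}
  [IsProbabilityMeasure P] {θ : Fin 2 → Fin (d + 1) → ℝ} {σ : ℝ}

variable (T P θ) in
/-- Contribution of unit `i` to the linearization of a treatment effect estimator. -/
noncomputable def influence (α : Fin 2 → Fin K → Fin (d + 1) → ℝ) (i : ℕ) (ω : Ω) : ℝ :=
  augment (T.X i ω) ⬝ᵥ (θ 1 - θ 0) - T.ate P + T.score α i ω * T.residual θ i ω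

theorem measurable_score_design (α : Fin 2 → Fin K → Fin (d + 1) → ℝ) {n : ℕ} (i : Fin n) :
    Measurable[T.design n] (T.score α i) := by
  let : MeasurableSpace Ω := T.design n
  have hD := T.measurableDesign_sample_design n
  exact Measurable.dotProduct ((measurable_of_countable (fun p : Fin 2 × Fin K => α p.1 p.2)).comp
    ((hD.arm i).prodMk (hD.study i))) (hD.measurable_augment i)

theorem measurable_unit_score (α : Fin 2 → Fin K → Fin (d + 1) → ℝ) :
    Measurable fun z : (Fin d → ℝ) × Fin 2 × Fin K × (Fin 2 → ℝ) =>
      α z.2.1 z.2.2.1 ⬝ᵥ augment z.1 :=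
  Measurable.dotProduct ((measurable_of_countable (fun p : Fin 2 × Fin K => α p.1 p.2)).comp
    (measurable_snd.fst.prodMk measurable_snd.snd.fst)) (measurable_augment.comp measurable_fst)

theorem measurable_unit_influence (α : Fin 2 → Fin K → Fin (d + 1) → ℝ) :
    Measurable fun z : (Fin d → ℝ) × Fin 2 × Fin K × (Fin 2 → ℝ) =>
      augment z.1 ⬝ᵥ (θ 1 - θ 0) - T.ate P +
        (α z.2.1 z.2.2.1 ⬝ᵥ augment z.1) * (z.2.2.2 z.2.1 - augment z.1 ⬝ᵥ θ z.2.1) :=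
  ((IsCovariateShiftRCT.measurable_unit_augment_dotProduct _).sub_const _).add
    ((measurable_unit_score α).mul (measurable_unit_residual θ))

theorem score_sq_eq_sum (α : Fin 2 → Fin K → Fin (d + 1) → ℝ) (ω : Ω) :
    T.score α 0 ω ^ 2 = ∑ w, ∑ k,
      if T.H 0 ω = k ∧ T.W 0 ω = w then (α w k ⬝ᵥ augment (T.X 0 ω)) ^ 2 else 0 := by
  rw [Finset.sum_eq_single (T.W 0 ω) (fun w _ hw => Finset.sum_eq_zero fun k _ =>
      if_neg fun h => hw h.2.symm) (by simp),
    Finset.sum_eq_single (T.H 0 ω) (fun k _ hk => if_neg fun h => hk h.1.symm) (by simp),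
    if_pos ⟨rfl, rfl⟩, score]

namespace IsCovariateShiftRCT

theorem integrable_cell_sq (hT : T.IsCovariateShiftRCT P θ σ) (v : Fin (d + 1) → ℝ)
    (k : Fin K) (w : Fin 2) : Integrable (fun ω =>
      if T.H 0 ω = k ∧ T.W 0 ω = w then (v ⬝ᵥ augment (T.X 0 ω)) ^ 2 else 0) P := by
  refine hT.integrable_cell ?_ k w
  simp_rw [dotProduct_comm v]
  exact (hT.memLp_augment_dotProduct v).integrable_sq

theorem measurable_score (hT : T.IsCovariateShiftRCT P θ σ)
    (α : Fin 2 → Fin K → Fin (d + 1) → ℝ) (i : ℕ) : Measurable (T.score α i) :=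
  (measurable_unit_score α).comp (hT.measurable_unit i)

theorem integral_score_sq (hT : T.IsCovariateShiftRCT P θ σ)
    (α : Fin 2 → Fin K → Fin (d + 1) → ℝ) :
    Integrable (fun ω => T.score α 0 ω ^ 2) P ∧
      ∫ ω, T.score α 0 ω ^ 2 ∂P = ∑ w, ∑ k, α w k ⬝ᵥ T.cellGram P k w *ᵥ α w k := by
  simp_rw [score_sq_eq_sum, hT.dotProduct_cellGram_mulVec]
  have hi := fun w k => hT.integrable_cell_sq (α w k) k w
  refine ⟨integrable_finsetSum _ fun w _ => integrable_finsetSum _ fun k _ => hi w k, ?_⟩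
  rw [integral_finsetSum _ fun w _ => integrable_finsetSum _ fun k _ => hi w k]
  exact Finset.sum_congr rfl fun w _ => integral_finsetSum _ fun k _ => hi w k

/-- The sample of size one in `setLIntegral_sq_sum_mul_residual`. -/
theorem lintegral_score_mul_residual_sq (hT : T.IsCovariateShiftRCT P θ σ)
    (α : Fin 2 → Fin K → Fin (d + 1) → ℝ) :
    ∫⁻ ω, ENNReal.ofReal ((T.score α 0 ω * T.residual θ 0 ω) ^ 2) ∂P =
      ENNReal.ofReal (σ ^ 2 * ∫ ω, T.score α 0 ω ^ 2 ∂P) := by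
  have h := hT.setLIntegral_sq_sum_mul_residual (n := 1) (c := fun i => T.score α i)
    (measurable_score_design α) (MeasurableSet.univ (m := T.design 1))
  simp only [Measure.restrict_univ, Finset.univ_unique, Fin.default_eq_zero, Finset.sum_singleton,
    Fin.val_zero] at h
  rw [h, ← ofReal_integral_eq_lintegral_ofReal ((hT.integral_score_sq α).1.const_mul _)
    (Eventually.of_forall fun ω => by positivity), integral_const_mul]

/-- A product of two square integrable functions need not be square integrable; here the constant
conditional variance of the residual gives it. -/
theorem memLp_score_mul_residual (hT : T.IsCovariateShiftRCT P θ σ)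
    (α : Fin 2 → Fin K → Fin (d + 1) → ℝ) :
    MemLp (fun ω => T.score α 0 ω * T.residual θ 0 ω) 2 P := by
  have hm : Measurable fun ω => T.score α 0 ω * T.residual θ 0 ω :=
    (hT.measurable_score α 0).mul (hT.measurable_residual 0)
  refine (memLp_two_iff_integrable_sq hm.aestronglyMeasurable).2
    ⟨(hm.pow_const 2).aestronglyMeasurable, ?_⟩
  rw [hasFiniteIntegral_iff_ofReal (Eventually.of_forall fun ω => sq_nonneg _),
    hT.lintegral_score_mul_residual_sq]
  exact ENNReal.ofReal_lt_top

theorem integral_score_mul_residual_sq (hT : T.IsCovariateShiftRCT P θ σ)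
    (α : Fin 2 → Fin K → Fin (d + 1) → ℝ) :
    ∫ ω, (T.score α 0 ω * T.residual θ 0 ω) ^ 2 ∂P = σ ^ 2 * ∫ ω, T.score α 0 ω ^ 2 ∂P := by
  rw [integral_eq_lintegral_of_nonneg_ae (Eventually.of_forall fun ω => sq_nonneg _)
    (hT.memLp_score_mul_residual α).integrable_sq.aestronglyMeasurable,
    hT.lintegral_score_mul_residual_sq, ENNReal.toReal_ofReal]
  exact mul_nonneg (sq_nonneg σ) (integral_nonneg fun ω => sq_nonneg _)

theorem integral_mul_residual_zero (hT : T.IsCovariateShiftRCT P θ σ) {c : Ω → ℝ}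
    (hc : Measurable[T.design 1] c) (hint : Integrable (fun ω => c ω * T.residual θ 0 ω) P) :
    ∫ ω, c ω * T.residual θ 0 ω ∂P = 0 := by
  have h := hT.setIntegral_sum_mul_residual (n := 1) (c := fun _ => c) (S := Set.univ)
    (fun _ => hc) (MeasurableSet.univ (m := T.design 1))
  simp only [Measure.restrict_univ, Finset.univ_unique, Fin.default_eq_zero, Finset.sum_singleton,
    Fin.val_zero, integrableOn_univ] at h
  exact h hint

theorem memLp_centered (hT : T.IsCovariateShiftRCT P θ σ) :
    MemLp (fun ω => augment (T.X 0 ω) ⬝ᵥ (θ 1 - θ 0) - T.ate P) 2 P :=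
  (hT.memLp_augment_dotProduct _).sub (memLp_const _)

theorem memLp_influence (hT : T.IsCovariateShiftRCT P θ σ)
    (α : Fin 2 → Fin K → Fin (d + 1) → ℝ) : MemLp (T.influence P θ α 0) 2 P :=
  hT.memLp_centered.add (hT.memLp_score_mul_residual α)

theorem integral_influence (hT : T.IsCovariateShiftRCT P θ σ)
    (α : Fin 2 → Fin K → Fin (d + 1) → ℝ) : ∫ ω, T.influence P θ α 0 ω ∂P = 0 := by
  have h2 := (hT.memLp_score_mul_residual α).integrable one_le_two
  simp_rw [influence]
  rw [integral_add (hT.memLp_centered.integrable one_le_two) h2,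
    integral_sub (hT.integrable_augment_dotProduct _) (integrable_const _), ← hT.ate_eq,
    hT.integral_mul_residual_zero (c := T.score α 0) (measurable_score_design α (0 : Fin 1)) h2]
  simp

/-- The covariate part and the noise part are uncorrelated, since the residual has mean zero given
the design of its unit. -/
theorem variance_influence (hT : T.IsCovariateShiftRCT P θ σ)
    (α : Fin 2 → Fin K → Fin (d + 1) → ℝ) :
    Var[T.influence P θ α 0; P] =
      ∫ ω, (augment (T.X 0 ω) ⬝ᵥ (θ 1 - θ 0) - T.ate P) ^ 2 ∂P +
        σ ^ 2 * ∑ w, ∑ k, α w k ⬝ᵥ T.cellGram P k w *ᵥ α w k := by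
  rw [variance_of_integral_eq_zero (hT.memLp_influence α).aestronglyMeasurable.aemeasurable
    (hT.integral_influence α), ← (hT.integral_score_sq α).2, ← hT.integral_score_mul_residual_sq]
  have hc := hT.memLp_centered
  have hs := hT.memLp_score_mul_residual α
  have hcs : Integrable (fun ω => (augment (T.X 0 ω) ⬝ᵥ (θ 1 - θ 0) - T.ate P) *
      (T.score α 0 ω * T.residual θ 0 ω)) P := hc.integrable_mul hs
  have hz : ∫ ω, (augment (T.X 0 ω) ⬝ᵥ (θ 1 - θ 0) - T.ate P) *
      (T.score α 0 ω * T.residual θ 0 ω) ∂P = 0 := by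
    simp_rw [← mul_assoc] at hcs ⊢
    refine hT.integral_mul_residual_zero (c := fun ω =>
      (augment (T.X 0 ω) ⬝ᵥ (θ 1 - θ 0) - T.ate P) * T.score α 0 ω) ?_ hcs
    refine Measurable.mul ?_ (measurable_score_design α (0 : Fin 1))
    let : MeasurableSpace Ω := T.design 1
    exact (Measurable.dotProduct ((T.measurableDesign_sample_design 1).measurable_augment 0)
      measurable_const).sub_const _
  have heq : ∀ ω, T.influence P θ α 0 ω ^ 2 =
      ((augment (T.X 0 ω) ⬝ᵥ (θ 1 - θ 0) - T.ate P) ^ 2 +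
        2 * ((augment (T.X 0 ω) ⬝ᵥ (θ 1 - θ 0) - T.ate P) *
          (T.score α 0 ω * T.residual θ 0 ω))) + (T.score α 0 ω * T.residual θ 0 ω) ^ 2 := by
    intro ω
    rw [influence]
    ring
  simp_rw [heq]
  have hadd : Integrable (fun ω => (augment (T.X 0 ω) ⬝ᵥ (θ 1 - θ 0) - T.ate P) ^ 2 +
      2 * ((augment (T.X 0 ω) ⬝ᵥ (θ 1 - θ 0) - T.ate P) *
        (T.score α 0 ω * T.residual θ 0 ω))) P := hc.integrable_sq.add (hcs.const_mul 2)
  rw [integral_add hadd hs.integrable_sq,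
    integral_add hc.integrable_sq (hcs.const_mul 2), integral_const_mul, hz]
  ring

end IsCovariateShiftRCT

end Trial

/-! ### Limits of inverses, noise sums and the central limit theorem. -/

theorem Matrix.inv_smul_of_ne_zero {m : Type*} [Fintype m] [DecidableEq m] {c : ℝ} (hc : c ≠ 0)
    (A : Matrix m m ℝ) : (c • A)⁻¹ = c⁻¹ • A⁻¹ := by
  by_cases hA : IsUnit A.det
  · apply Matrix.inv_eq_left_inv
    rw [Matrix.smul_mul, Matrix.mul_smul, smul_smul, inv_mul_cancel₀ hc, one_smul,
      Matrix.nonsing_inv_mul _ hA]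
  · have hcA : ¬ IsUnit (c • A).det := by
      rw [isUnit_iff_ne_zero, not_not] at hA ⊢
      rw [Matrix.det_smul, hA, mul_zero]
    rw [Matrix.nonsing_inv_apply_not_isUnit _ hA, Matrix.nonsing_inv_apply_not_isUnit _ hcA,
      smul_zero]

theorem Filter.Tendsto.matrix_inv_mulVec {ι m : Type*} [Fintype m] [DecidableEq m] {l : Filter ι}
    {A : ι → Matrix m m ℝ} {M : Matrix m m ℝ} {v : ι → m → ℝ} {u : m → ℝ}
    (hA : Tendsto A l (𝓝 M)) (hM : IsUnit M.det) (hv : Tendsto v l (𝓝 u)) :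
    Tendsto (fun i => (A i)⁻¹ *ᵥ v i) l (𝓝 (M⁻¹ *ᵥ u)) := by
  have hinv : Tendsto (fun i => (A i)⁻¹) l (𝓝 M⁻¹) := by
    refine (continuousAt_matrix_inv M ?_).tendsto.comp hA
    rw [Ring.inverse_eq_inv']
    exact continuousAt_inv₀ hM.ne_zero
  refine tendsto_pi_nhds.2 fun a => tendsto_finsetSum _ fun b _ => ?_
  exact (tendsto_pi_nhds.1 (tendsto_pi_nhds.1 hinv a) b).mul (tendsto_pi_nhds.1 hv b)

/-- Sign with which the outcome parameters of an arm enter the treatment effect. -/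
def armSign (w : Fin 2) : ℝ := if w = 1 then 1 else -1

theorem armSign_sq (w : Fin 2) : armSign w * armSign w = 1 := by
  unfold armSign
  split_ifs <;> norm_num

namespace Trial

variable {Ω : Type*} {d K : ℕ}

/-- Coefficients that single out one covariate of one arm and study. -/
def unitCoeff (p : Fin 2 × Fin K × Fin (d + 1)) (w : Fin 2) (k : Fin K) : Fin (d + 1) → ℝ :=
  if w = p.1 ∧ k = p.2.1 then Pi.single p.2.2 1 else 0

variable (T : Trial Ω d K)

theorem score_eq_sum (α : Fin 2 → Fin K → Fin (d + 1) → ℝ) (i : ℕ) (ω : Ω) :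
    T.score α i ω = ∑ p : Fin 2 × Fin K × Fin (d + 1),
      α p.1 p.2.1 p.2.2 * T.score (unitCoeff p) i ω := by
  simp_rw [Fintype.sum_prod_type]
  rw [Finset.sum_eq_single (T.W i ω) (fun w _ hw => Finset.sum_eq_zero fun k _ =>
      Finset.sum_eq_zero fun j _ => by simp [score, unitCoeff, Ne.symm hw]) (by simp),
    Finset.sum_eq_single (T.H i ω) (fun k _ hk =>
      Finset.sum_eq_zero fun j _ => by simp [score, unitCoeff, Ne.symm hk]) (by simp), score,
    dotProduct]
  refine Finset.sum_congr rfl fun j _ => ?_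
  simp [score, unitCoeff]

/-- Normalized sum of residuals with coefficients determined by arm, study and covariates. -/
noncomputable def noiseSum (θ : Fin 2 → Fin (d + 1) → ℝ) (α : Fin 2 → Fin K → Fin (d + 1) → ℝ)
    (n : ℕ) (ω : Ω) : ℝ :=
  (√(n : ℝ))⁻¹ * ∑ i : Fin n, T.score α i ω * T.residual θ i ω

/-- Linearity in `α` at a fixed `ω` separates the coefficients from finitely many noise sums that do
not depend on them. -/
theorem noiseSum_eq_sum (θ : Fin 2 → Fin (d + 1) → ℝ) (α : Fin 2 → Fin K → Fin (d + 1) → ℝ)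
    (n : ℕ) (ω : Ω) : T.noiseSum θ α n ω = ∑ p : Fin 2 × Fin K × Fin (d + 1),
      α p.1 p.2.1 p.2.2 * T.noiseSum θ (unitCoeff p) n ω := by
  simp_rw [noiseSum, T.score_eq_sum α, Finset.mul_sum, Finset.sum_mul, Finset.mul_sum]
  rw [Finset.sum_comm]
  exact Finset.sum_congr rfl fun p _ => Finset.sum_congr rfl fun i _ => by ring

/-- Root of one plus the squares of all normalized cell sums of residuals. -/
noncomputable def noiseScale (θ : Fin 2 → Fin (d + 1) → ℝ) (n : ℕ) (ω : Ω) : ℝ :=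
  √(1 + ∑ p : Fin 2 × Fin K × Fin (d + 1), T.noiseSum θ (unitCoeff p) n ω ^ 2)

theorem noiseScale_pos (θ : Fin 2 → Fin (d + 1) → ℝ) (n : ℕ) (ω : Ω) :
    0 < T.noiseScale θ n ω :=
  Real.sqrt_pos.2 (by positivity)

/-- The bound holds for each `ω` and all `α` at once, so coefficients depending on the whole sample
may be inserted. -/
theorem abs_noiseSum_le (θ : Fin 2 → Fin (d + 1) → ℝ) (α : Fin 2 → Fin K → Fin (d + 1) → ℝ)
    (n : ℕ) (ω : Ω) : |T.noiseSum θ α n ω| ≤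
      (∑ p : Fin 2 × Fin K × Fin (d + 1), |α p.1 p.2.1 p.2.2|) * T.noiseScale θ n ω := by
  rw [noiseSum_eq_sum, Finset.sum_mul]
  refine (Finset.abs_sum_le_sum_abs _ _).trans (Finset.sum_le_sum fun p _ => ?_)
  rw [abs_mul]
  refine mul_le_mul_of_nonneg_left (Real.abs_le_sqrt ?_) (abs_nonneg _)
  have := Finset.single_le_sum (f := fun p => T.noiseSum θ (unitCoeff p) n ω ^ 2)
    (fun q _ => sq_nonneg _) (Finset.mem_univ p)
  linarith

variable {T} [MeasurableSpace Ω] {P : Measure Ω}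
  [IsProbabilityMeasure P] {θ : Fin 2 → Fin (d + 1) → ℝ} {σ : ℝ}

namespace IsCovariateShiftRCT

theorem measurable_noiseSum (hT : T.IsCovariateShiftRCT P θ σ)
    (α : Fin 2 → Fin K → Fin (d + 1) → ℝ) (n : ℕ) : Measurable (T.noiseSum θ α n) :=
  (Finset.measurable_fun_sum _ fun (i : Fin n) _ =>
    (hT.measurable_score α i).mul (hT.measurable_residual i)).const_mul _

theorem measurable_noiseScale (hT : T.IsCovariateShiftRCT P θ σ) (n : ℕ) :
    Measurable (T.noiseScale θ n) :=
  ((Finset.measurable_fun_sum _ fun p _ =>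
    (hT.measurable_noiseSum (unitCoeff p) n).pow_const 2).const_add 1).sqrt

/-- The squared normalization cancels the `n` identical second moments; for `n = 0` the left side is
zero, hence an inequality. -/
theorem lintegral_noiseSum_sq_le (hT : T.IsCovariateShiftRCT P θ σ)
    (α : Fin 2 → Fin K → Fin (d + 1) → ℝ) (n : ℕ) :
    ∫⁻ ω, ENNReal.ofReal (T.noiseSum θ α n ω ^ 2) ∂P ≤
      ENNReal.ofReal (σ ^ 2 * ∫ ω, T.score α 0 ω ^ 2 ∂P) := by
  have h := hT.setLIntegral_sq_sum_mul_residual (n := n)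
    (c := fun i ω => (√(n : ℝ))⁻¹ * T.score α i ω)
    (fun i => (measurable_score_design α i).const_mul _) (MeasurableSet.univ (m := T.design n))
  simp only [Measure.restrict_univ, mul_assoc, ← Finset.mul_sum] at h
  have hid : ∀ i : ℕ, IdentDistrib (fun ω => T.score α i ω ^ 2) (fun ω => T.score α 0 ω ^ 2) P P :=
    hT.identDistrib_comp_unit ((measurable_unit_score α).pow_const 2)
  have hint : ∀ i : ℕ, Integrable (fun ω => T.score α i ω ^ 2) P := fun i =>
    (hid i).integrable_iff.2 (hT.integral_score_sq α).1
  have hsum : Integrable (fun ω => σ ^ 2 * ∑ i : Fin n, ((√(n : ℝ))⁻¹ * T.score α i ω) ^ 2) P := by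
    refine Integrable.const_mul (integrable_finsetSum _ fun i _ => ?_) _
    simp_rw [mul_pow]
    exact (hint i).const_mul _
  simp_rw [noiseSum]
  rw [h, ← ofReal_integral_eq_lintegral_ofReal hsum (Eventually.of_forall fun ω => by positivity)]
  refine ENNReal.ofReal_le_ofReal ?_
  simp_rw [mul_pow, ← Finset.mul_sum]
  rw [integral_const_mul, integral_const_mul, integral_finsetSum _ fun (i : Fin n) _ => hint i]
  simp_rw [fun i : Fin n => (hid i).integral_eq]
  refine mul_le_mul_of_nonneg_left ?_ (sq_nonneg σ)
  rw [Finset.sum_const, Finset.card_univ, Fintype.card_fin, nsmul_eq_mul, inv_pow,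
    Real.sq_sqrt n.cast_nonneg, ← mul_assoc]
  refine mul_le_of_le_one_left (integral_nonneg fun ω => sq_nonneg _) ?_
  exact inv_mul_le_one

theorem lintegral_noiseScale_sq_le (hT : T.IsCovariateShiftRCT P θ σ) (n : ℕ) :
    ∫⁻ ω, ENNReal.ofReal (T.noiseScale θ n ω ^ 2) ∂P ≤
      ENNReal.ofReal (1 + ∑ p : Fin 2 × Fin K × Fin (d + 1),
        σ ^ 2 * ∫ ω, T.score (unitCoeff p) 0 ω ^ 2 ∂P) := by
  have hnn : ∀ p : Fin 2 × Fin K × Fin (d + 1),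
      0 ≤ σ ^ 2 * ∫ ω, T.score (unitCoeff p) 0 ω ^ 2 ∂P := fun p =>
    mul_nonneg (sq_nonneg σ) (integral_nonneg fun ω => sq_nonneg _)
  have heq : ∀ ω, ENNReal.ofReal (T.noiseScale θ n ω ^ 2) =
      1 + ∑ p : Fin 2 × Fin K × Fin (d + 1),
        ENNReal.ofReal (T.noiseSum θ (unitCoeff p) n ω ^ 2) := by
    intro ω
    rw [noiseScale, Real.sq_sqrt (by positivity), ENNReal.ofReal_add zero_le_one
      (Finset.sum_nonneg fun p _ => sq_nonneg _), ENNReal.ofReal_one,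
      ENNReal.ofReal_sum_of_nonneg fun p _ => sq_nonneg _]
  simp_rw [heq]
  rw [lintegral_add_left measurable_const, lintegral_finsetSum _ fun p _ =>
    ((hT.measurable_noiseSum (unitCoeff p) n).pow_const 2).ennreal_ofReal,
    ENNReal.ofReal_add zero_le_one (Finset.sum_nonneg fun p _ => hnn p),
    ENNReal.ofReal_sum_of_nonneg fun p _ => hnn p]
  refine add_le_add (by simp) (Finset.sum_le_sum fun p _ => hT.lintegral_noiseSum_sq_le _ n)

theorem iIndepFun_influence (hT : T.IsCovariateShiftRCT P θ σ)
    (α : Fin 2 → Fin K → Fin (d + 1) → ℝ) : iIndepFun (T.influence P θ α) P :=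
  hT.iIndepFun_comp_unit (measurable_unit_influence (T := T) (P := P) (θ := θ) α)

theorem identDistrib_influence (hT : T.IsCovariateShiftRCT P θ σ)
    (α : Fin 2 → Fin K → Fin (d + 1) → ℝ) (i : ℕ) :
    IdentDistrib (T.influence P θ α i) (T.influence P θ α 0) P P :=
  hT.identDistrib_comp_unit (measurable_unit_influence (T := T) (P := P) (θ := θ) α) i

theorem measurable_influence (hT : T.IsCovariateShiftRCT P θ σ)
    (α : Fin 2 → Fin K → Fin (d + 1) → ℝ) (i : ℕ) : Measurable (T.influence P θ α i) :=
  ((Measurable.dotProduct (hT.measurable_augment_X i) measurable_const).sub_const _).add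
    ((hT.measurable_score α i).mul (hT.measurable_residual i))

theorem tendstoInDistribution_sum_influence (hT : T.IsCovariateShiftRCT P θ σ)
    (α : Fin 2 → Fin K → Fin (d + 1) → ℝ) :
    TendstoInDistribution
      (fun (n : ℕ) ω => (√(n : ℝ))⁻¹ * ∑ i : Fin n, T.influence P θ α i ω) atTop (id : ℝ → ℝ)
      (fun _ => P) (gaussianReal 0 Var[T.influence P θ α 0; P].toNNReal) := by
  have hclt := tendstoInDistribution_inv_sqrt_mul_sum_sub
    (P' := gaussianReal 0 Var[T.influence P θ α 0; P].toNNReal) (Y := id)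
    (X := T.influence P θ α) ⟨aemeasurable_id, Measure.map_id⟩ (hT.memLp_influence α)
    (hT.iIndepFun_influence α) (hT.identDistrib_influence α)
  simp only [hT.integral_influence, mul_zero, sub_zero, Finset.sum_range] at hclt
  exact hclt

end IsCovariateShiftRCT

/-- The linearization error is a noise sum with the difference of the coefficients. -/
theorem sqrt_mul_sub_sum_influence {α β : Fin 2 → Fin K → Fin (d + 1) → ℝ} {n : ℕ} (hn : n ≠ 0)
    (ω : Ω) : √(n : ℝ) * (T.sampleATE θ n ω +
        (n : ℝ)⁻¹ * ∑ i : Fin n, T.score β i ω * T.residual θ i ω - T.ate P) -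
      (√(n : ℝ))⁻¹ * ∑ i : Fin n, T.influence P θ α i ω =
    T.noiseSum θ (fun w k => β w k - α w k) n ω := by
  have hnpos : (0 : ℝ) < n := Nat.cast_pos.2 (Nat.pos_of_ne_zero hn)
  have hs : √(n : ℝ) * (n : ℝ)⁻¹ = (√(n : ℝ))⁻¹ := by
    rw [← Real.sqrt_div_self, div_eq_mul_inv]
  have hsn : √(n : ℝ) = (√(n : ℝ))⁻¹ * n := by
    rw [← hs, mul_assoc, inv_mul_cancel₀ hnpos.ne', mul_one]
  have h1 : ∑ i : Fin n, T.influence P θ α i ω =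
      n * (T.sampleATE θ n ω - T.ate P) + ∑ i : Fin n, T.score α i ω * T.residual θ i ω := by
    simp_rw [influence]
    rw [Finset.sum_add_distrib, Finset.sum_sub_distrib, Finset.sum_const, Finset.card_univ,
      Fintype.card_fin, nsmul_eq_mul, sampleATE, mul_sub, ← mul_assoc, mul_one_div_cancel hnpos.ne',
      one_mul]
  have h2 : ∑ i : Fin n, T.score (fun w k => β w k - α w k) i ω * T.residual θ i ω =
      ∑ i : Fin n, T.score β i ω * T.residual θ i ω -
        ∑ i : Fin n, T.score α i ω * T.residual θ i ω := by
    rw [← Finset.sum_sub_distrib]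
    refine Finset.sum_congr rfl fun i _ => ?_
    simp only [score]
    rw [sub_dotProduct, sub_mul]
  rw [noiseSum, h1, h2]
  generalize ∑ i : Fin n, T.score β i ω * T.residual θ i ω = A
  generalize ∑ i : Fin n, T.score α i ω * T.residual θ i ω = B
  generalize T.sampleATE θ n ω = m
  calc _ = √(n : ℝ) * (m - T.ate P) + (√(n : ℝ) * (n : ℝ)⁻¹) * A - (√(n : ℝ))⁻¹ *
        (n * (m - T.ate P) + B) := by ring
    _ = ((√(n : ℝ))⁻¹ * n) * (m - T.ate P) + (√(n : ℝ))⁻¹ * A - (√(n : ℝ))⁻¹ *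
        (n * (m - T.ate P) + B) := by rw [hs, ← hsn]
    _ = _ := by ring

namespace IsCovariateShiftRCT

/-- An estimator that is asymptotically linear with convergent coefficients is asymptotically
normal. -/
theorem hasAsymptoticVariance (hT : T.IsCovariateShiftRCT P θ σ)
    {α : Fin 2 → Fin K → Fin (d + 1) → ℝ} {a : ℕ → Ω → Fin 2 → Fin K → Fin (d + 1) → ℝ}
    (ha : ∀ᵐ ω ∂P, Tendsto (fun n => a n ω) atTop (𝓝 α)) {t : ℕ → Ω → ℝ}
    (ht : ∀ n, Measurable (t n))
    (hrep : ∀ᵐ ω ∂P, ∀ᶠ n : ℕ in atTop, t n ω = T.sampleATE θ n ω +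
      (n : ℝ)⁻¹ * ∑ i : Fin n, T.score (a n ω) i ω * T.residual θ i ω) :
    HasAsymptoticVariance P t (T.ate P) Var[T.influence P θ α 0; P].toNNReal := by
  have hmeas : ∀ n : ℕ, Measurable fun ω => √(n : ℝ) * (t n ω - T.ate P) := fun n =>
    ((ht n).sub_const _).const_mul _
  have hmeas' : ∀ n : ℕ,
      Measurable fun ω => (√(n : ℝ))⁻¹ * ∑ i : Fin n, T.influence P θ α i ω := fun n =>
    (Finset.measurable_fun_sum _ fun (i : Fin n) _ => hT.measurable_influence α i).const_mul _
  refine tendstoInDistribution_of_tendstoInMeasure_sub _ _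
    (hT.tendstoInDistribution_sum_influence α) ?_ fun n => (hmeas n).aemeasurable
  -- Divided by `noiseScale`, the linearization error is at most the sum of the `|a n ω - α|` over
  -- all coordinates, which tends to zero almost surely, while the scale is bounded in `L²`.
  refine tendstoInMeasure_zero_of_tendsto_div (B := T.noiseScale θ)
    (fun n => (hmeas n).sub (hmeas' n))
    hT.measurable_noiseScale (T.noiseScale_pos θ) ?_ hT.lintegral_noiseScale_sq_le
  filter_upwards [ha, hrep] with ω hω hr
  have hsum : Tendsto (fun n => ∑ p : Fin 2 × Fin K × Fin (d + 1),
      |a n ω p.1 p.2.1 p.2.2 - α p.1 p.2.1 p.2.2|) atTop (𝓝 0) := by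
    rw [show (0 : ℝ) = ∑ p : Fin 2 × Fin K × Fin (d + 1),
      |α p.1 p.2.1 p.2.2 - α p.1 p.2.1 p.2.2| by simp]
    exact tendsto_finsetSum _ fun p _ => ((tendsto_pi_nhds.1 (tendsto_pi_nhds.1
      (tendsto_pi_nhds.1 hω p.1) p.2.1) p.2.2).sub_const _).abs
  refine squeeze_zero_norm' ?_ hsum
  filter_upwards [hr, eventually_ne_atTop 0] with n hn hn0
  rw [norm_div, Real.norm_eq_abs, Real.norm_eq_abs, abs_of_pos (T.noiseScale_pos θ n ω),
    div_le_iff₀ (T.noiseScale_pos θ n ω), Pi.sub_apply, Pi.sub_apply, hn,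
    sqrt_mul_sub_sum_influence hn0]
  exact T.abs_noiseSum_le θ (fun w k => a n ω w k - α w k) n ω

end IsCovariateShiftRCT

variable (T) in
/-- Coefficients of a federated treatment effect estimator, scaled by the sample size. -/
noncomputable def tauCoeff (agg : Federation) (n : ℕ) (ω : Ω) (w : Fin 2) (k : Fin K) :
    Fin (d + 1) → ℝ :=
  armSign w • (n : ℝ) • (T.sample n ω).weight agg w k (T.meanX n ω)

variable (T P) in
/-- Almost sure limit of the scaled coefficients. -/
noncomputable def limitTauCoeff (agg : Federation) (w : Fin 2) (k : Fin K) : Fin (d + 1) → ℝ :=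
  armSign w • T.limitWeight P agg w k (T.expectedX P)

namespace IsCovariateShiftRCT

theorem tauOneShot_eq_sum_score (hT : T.IsCovariateShiftRCT P θ σ) {n : ℕ} (hn : n ≠ 0) {ω : Ω}
    (h : ω ∈ T.fullRank n) (agg : Federation) :
    (T.sample n ω).tauOneShot σ agg = T.sampleATE θ n ω +
      (n : ℝ)⁻¹ * ∑ i : Fin n, T.score (T.tauCoeff agg n ω) i ω * T.residual θ i ω := by
  have hn' : (n : ℝ) ≠ 0 := Nat.cast_ne_zero.2 hn
  rw [hT.tauOneShot_eq h, Finset.mul_sum]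
  congr 1
  refine Finset.sum_congr rfl fun i _ => ?_
  rw [← mul_assoc]
  congr 1
  simp only [residualCoeff, score, tauCoeff, smul_dotProduct, smul_eq_mul, armSign]
  by_cases hw : T.W i ω = 1
  · simp [hw, hn']
  · have hw0 : T.W i ω = 0 := by omega
    simp [hw0, hn']

/-- The factor `n` turns inverse Gram matrices into inverses of averages, which converge with
invertible limits; the shares of the studies are ratios of frequencies. -/
theorem ae_tendsto_tauCoeff (hT : T.IsCovariateShiftRCT P θ σ)
    (hfull : ∃ n, P (T.fullRank n) ≠ 0) (agg : Federation) :
    ∀ᵐ ω ∂P, Tendsto (fun n => T.tauCoeff agg n ω) atTop (𝓝 (T.limitTauCoeff P agg)) := by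
  have := hT.neZero
  filter_upwards [ae_all_iff.2 fun k => ae_all_iff.2 fun w => hT.ae_tendsto_gram_inCell k w,
    ae_all_iff.2 fun k => ae_all_iff.2 fun w => hT.ae_tendsto_card_inCell k w,
    hT.ae_tendsto_meanX] with ω hG hc hX
  refine tendsto_pi_nhds.2 fun w => tendsto_pi_nhds.2 fun k => ?_
  refine Tendsto.const_smul ?_ (armSign w)
  cases agg with
  | IVW =>
    have hsum : Tendsto (fun n : ℕ => (n : ℝ)⁻¹ • (T.sample n ω).gram ((T.sample n ω).inArm w))
        atTop (𝓝 (∑ k, T.cellGram P k w)) := by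
      simp_rw [Sample.gram_inArm, Finset.smul_sum]
      exact tendsto_finsetSum _ fun k _ => hG k w
    have hpd : (∑ k, T.cellGram P k w).PosDef := Matrix.posDef_sum Finset.univ_nonempty
      fun k _ => hT.cellGram_posDef hfull k w
    refine (hsum.matrix_inv_mulVec hpd.isUnit_det hX).congr' ?_
    filter_upwards [eventually_ne_atTop 0] with n hn
    rw [Matrix.inv_smul_of_ne_zero (inv_ne_zero (Nat.cast_ne_zero.2 hn)), inv_inv,
      Matrix.smul_mulVec, Sample.weight]
  | SW =>
    have hcard : Tendsto (fun n : ℕ => (n : ℝ)⁻¹ * (((T.sample n ω).inArm w).card : ℝ))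
        atTop (𝓝 (∑ l, T.cellProb P l w)) := by
      simp_rw [Sample.card_inArm, Finset.mul_sum]
      exact tendsto_finsetSum _ fun k _ => hc k w
    have hpos : 0 < ∑ l, T.cellProb P l w :=
      Finset.sum_pos (fun l _ => hT.cellProb_pos hfull l w) Finset.univ_nonempty
    refine (((hc k w).div hcard hpos.ne').smul ((hG k w).matrix_inv_mulVec
      (hT.cellGram_posDef hfull k w).isUnit_det hX)).congr' ?_
    filter_upwards [eventually_ne_atTop 0] with n hn
    rw [Matrix.inv_smul_of_ne_zero (inv_ne_zero (Nat.cast_ne_zero.2 hn)), inv_inv,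
      Matrix.smul_mulVec, Sample.weight, smul_smul, smul_smul, Pi.div_apply,
      mul_div_mul_left _ _ (inv_ne_zero (Nat.cast_ne_zero.2 hn)), mul_comm]

/-- Almost surely full rank holds from some sample size on, so the values of `t` elsewhere do not
affect the limit. -/
theorem hasAsymptoticVariance_of_eq_tauOneShot (hT : T.IsCovariateShiftRCT P θ σ)
    (hfull : ∃ n, P (T.fullRank n) ≠ 0) (agg : Federation) {t : ℕ → Ω → ℝ}
    (ht : ∀ n, Measurable (t n))
    (heq : ∀ n, ∀ ω ∈ T.fullRank n, t n ω = (T.sample n ω).tauOneShot σ agg) :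
    HasAsymptoticVariance P t (T.ate P)
      Var[T.influence P θ (T.limitTauCoeff P agg) 0; P].toNNReal := by
  refine hT.hasAsymptoticVariance (hT.ae_tendsto_tauCoeff hfull agg) ht ?_
  filter_upwards [hT.ae_eventually_mem_fullRank hfull] with ω hω
  filter_upwards [hω, eventually_ne_atTop 0] with n hn hn0
  rw [heq n ω hn, hT.tauOneShot_eq_sum_score hn0 hn]

/-- The covariate term is common and the arm signs square to one. What remains is Gauss–Markov in
each arm, with expected Gram matrices and limiting shares of the studies. -/
theorem variance_influence_IVW_le_SW (hT : T.IsCovariateShiftRCT P θ σ)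
    (hfull : ∃ n, P (T.fullRank n) ≠ 0) :
    Var[T.influence P θ (T.limitTauCoeff P .IVW) 0; P] ≤
      Var[T.influence P θ (T.limitTauCoeff P .SW) 0; P] := by
  have := hT.neZero
  rw [hT.variance_influence, hT.variance_influence]
  refine add_le_add le_rfl (mul_le_mul_of_nonneg_left
    (Finset.sum_le_sum fun w _ => ?_) (sq_nonneg σ))
  have hsign : ∀ agg k, T.limitTauCoeff P agg w k ⬝ᵥ
      T.cellGram P k w *ᵥ T.limitTauCoeff P agg w k =
      T.limitWeight P agg w k (T.expectedX P) ⬝ᵥ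
        T.cellGram P k w *ᵥ T.limitWeight P agg w k (T.expectedX P) := by
    intro agg k
    rw [limitTauCoeff, Matrix.mulVec_smul, smul_dotProduct, dotProduct_smul, smul_smul,
      armSign_sq, one_smul]
  simp_rw [hsign]
  simp only [limitWeight]
  have hpos : 0 < ∑ l, T.cellProb P l w :=
    Finset.sum_pos (fun l _ => hT.cellProb_pos hfull l w) Finset.univ_nonempty
  refine Matrix.sum_dotProduct_inv_sum_le (fun k => hT.cellGram_posDef hfull k w) ?_ _
  rw [← Finset.sum_div, div_self hpos.ne']

end IsCovariateShiftRCT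

end Trial

/-! ### Transfer to the pooled and gradient descent estimators, and the main result. -/

namespace Trial

variable {Ω : Type*} {d K : ℕ} {T : Trial Ω d K} [MeasurableSpace Ω] {P : Measure Ω}
  [IsProbabilityMeasure P] {θ : Fin 2 → Fin (d + 1) → ℝ} {σ : ℝ}

namespace IsFullRankDesignEvent

variable {n : ℕ} {S : Set Ω}

theorem evariance_eq (hS : T.IsFullRankDesignEvent P n S) (hT : T.IsCovariateShiftRCT P θ σ)
    {η : Ω → Fin 2 → ℝ} (hη : ∀ ω w, (T.sample n ω).IsLearningRate w (η ω w))
    (θ₀ : Fin (d + 1) → ℝ) (w : Fin 2) (v : Fin (d + 1) → ℝ) :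
    evariance (fun ω => v ⬝ᵥ (T.sample n ω).thetaPool w) P[|S] =
        evariance (fun ω => v ⬝ᵥ (T.sample n ω).thetaGD (η ω) θ₀ w) P[|S] ∧
      evariance (fun ω => v ⬝ᵥ (T.sample n ω).thetaGD (η ω) θ₀ w) P[|S] =
        evariance (fun ω => v ⬝ᵥ (T.sample n ω).thetaOneShot σ .IVW w) P[|S] := by
  have hGD := hS.thetaGD_ae_eq hT hη θ₀ w
  have hIVW := hS.thetaPool_ae_eq hT w
  exact ⟨evariance_congr (hGD.symm.fun_comp (v ⬝ᵥ ·)),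
    evariance_congr ((hGD.trans hIVW.symm).fun_comp (v ⬝ᵥ ·))⟩

/-- Gauss–Markov in the coordinate directions bounds the extended variances by finite ones, and
finite extended variance amounts to square integrability. -/
theorem memLp_thetaOneShot_IVW (hS : T.IsFullRankDesignEvent P n S)
    (hT : T.IsCovariateShiftRCT P θ σ) (w : Fin 2)
    (h : ∀ j, MemLp (fun ω => (T.sample n ω).thetaOneShot σ .SW w j) 2 P[|S]) (j : Fin (d + 1)) :
    MemLp (fun ω => (T.sample n ω).thetaOneShot σ .IVW w j) 2 P[|S] := by
  have := cond_isProbabilityMeasure hS.pos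
  have hle := hS.evariance_IVW_le_SW hT w (Pi.single j 1)
  simp only [single_one_dotProduct] at hle
  have hm : Measurable fun ω => (T.sample n ω).thetaOneShot σ .IVW w :=
    (hT.measurableDesign_sample n).measurable_thetaOneShot (fun i => hT.measurable_observed i) σ _ w
  exact (evariance_lt_top_iff_memLp ((measurable_pi_apply j).comp hm).aestronglyMeasurable).1
    (hle.trans_lt (h j).evariance_lt_top)

end IsFullRankDesignEvent

namespace IsCovariateShiftRCT

theorem tendsto_integral_tauOneShot_cond (hT : T.IsCovariateShiftRCT P θ σ) {S : ℕ → Set Ω}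
    (agg : Federation) (hS : ∀ᶠ n in atTop, T.IsFullRankDesignEvent P n (S n))
    (hP : Tendsto (fun n => P (S n)) atTop (𝓝 1))
    (hint : ∀ᶠ n in atTop, Integrable (fun ω => (T.sample n ω).tauOneShot σ agg) P[|S n]) :
    Tendsto (fun n => ∫ ω, (T.sample n ω).tauOneShot σ agg ∂(P[|S n])) atTop (𝓝 (T.ate P)) := by
  refine (tendsto_integral_sampleATE_cond hT hP).congr' ?_
  filter_upwards [hS, hint] with n hn hi using (hn.integral_tauOneShot hT agg hi).symm

theorem hasAsymptoticVariance_tauOneShot (hT : T.IsCovariateShiftRCT P θ σ)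
    (hfull : ∃ n, P (T.fullRank n) ≠ 0) (agg : Federation) :
    HasAsymptoticVariance P (fun n ω => (T.sample n ω).tauOneShot σ agg) (T.ate P)
      Var[T.influence P θ (T.limitTauCoeff P agg) 0; P].toNNReal :=
  hT.hasAsymptoticVariance_of_eq_tauOneShot hfull agg
    (fun n => (hT.measurableDesign_sample n).measurable_tauFed fun w =>
      (hT.measurableDesign_sample n).measurable_thetaOneShot
        (fun i => hT.measurable_observed i) σ agg w)
    fun _ _ _ => rfl

theorem hasAsymptoticVariance_tauPool (hT : T.IsCovariateShiftRCT P θ σ)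
    (hfull : ∃ n, P (T.fullRank n) ≠ 0) :
    HasAsymptoticVariance P (fun n ω => (T.sample n ω).tauPool) (T.ate P)
      Var[T.influence P θ (T.limitTauCoeff P .IVW) 0; P].toNNReal := by
  have := hT.neZero
  refine hT.hasAsymptoticVariance_of_eq_tauOneShot hfull .IVW (fun n => ?_) fun n ω hω => ?_
  · simp_rw [Sample.tauPool_eq]
    exact (hT.measurableDesign_sample n).measurable_tauFed fun w =>
      (hT.measurableDesign_sample n).measurable_thetaPool (fun i => hT.measurable_observed i) w
  · rw [Sample.tauPool_eq, Sample.tauOneShot]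
    exact congrArg _ (funext fun w =>
      (Sample.LocalFullRank.thetaOneShot_IVW hω hT.sigma_pos w).symm)

theorem hasAsymptoticVariance_tauGD (hT : T.IsCovariateShiftRCT P θ σ)
    (hfull : ∃ n, P (T.fullRank n) ≠ 0) {η : ℕ → Ω → Fin 2 → ℝ} (hη_meas : ∀ n, Measurable (η n))
    (hη : ∀ n ω w, (T.sample n ω).IsLearningRate w (η n ω w)) (θ₀ : Fin (d + 1) → ℝ) :
    HasAsymptoticVariance P (fun n ω => (T.sample n ω).tauGD (η n ω) θ₀) (T.ate P)
      Var[T.influence P θ (T.limitTauCoeff P .IVW) 0; P].toNNReal := by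
  have := hT.neZero
  refine hT.hasAsymptoticVariance_of_eq_tauOneShot hfull .IVW (fun n => ?_) fun n ω hω => ?_
  · exact (hT.measurableDesign_sample n).measurable_tauFed fun w =>
      (hT.measurableDesign_sample n).measurable_thetaGD (fun i => hT.measurable_observed i)
        (hη_meas n) θ₀ w
  · rw [Sample.tauGD, Sample.tauOneShot]
    exact congrArg _ (funext fun w => (Sample.LocalFullRank.thetaGD_eq hω (hη n ω w) θ₀).trans
      (Sample.LocalFullRank.thetaOneShot_IVW hω hT.sigma_pos w).symm)

end IsCovariateShiftRCT

end Trial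

theorem mainTheorem5 {Ω : Type*} [MeasurableSpace Ω] (P : Measure Ω) [IsProbabilityMeasure P]
    {d K : ℕ} (T : Trial Ω d K) (θ : Fin 2 → Fin (d + 1) → ℝ) (σ : ℝ)
    (hT : T.IsCovariateShiftRCT P θ σ)
    (hfull : ∃ n, P (T.fullRank n) ≠ 0)
    (η : ℕ → Ω → Fin 2 → ℝ) (θ₀ : Fin (d + 1) → ℝ)
    (hη_meas : ∀ n, Measurable (η n))
    (hη : ∀ n ω w, (T.sample n ω).IsLearningRate w (η n ω w)) :
    -- local full rank holds with probability tending to one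
    Tendsto (fun n => P (T.fullRank n)) atTop (𝓝 1) ∧
    -- unbiasedness of the one-shot outcome parameters
    (∀ n S, T.IsFullRankDesignEvent P n S → ∀ (agg : Federation) (w : Fin 2) (j : Fin (d + 1)),
      Integrable (fun ω => (T.sample n ω).thetaOneShot σ agg w j) P[|S] →
      ∫ ω, (T.sample n ω).thetaOneShot σ agg w j ∂(P[|S]) = θ w j) ∧
    -- unbiasedness of the one-shot treatment effect estimators, given the design
    (∀ n S, T.IsFullRankDesignEvent P n S → ∀ agg : Federation,
      Integrable (fun ω => (T.sample n ω).tauOneShot σ agg) P[|S] →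
      ∫ ω, (T.sample n ω).tauOneShot σ agg ∂(P[|S]) = ∫ ω, T.sampleATE θ n ω ∂(P[|S])) ∧
    (∀ n : ℕ, n ≠ 0 →
      Integrable (T.sampleATE θ n) P ∧ ∫ ω, T.sampleATE θ n ω ∂P = T.ate P) ∧
    -- the same, given the allocation to studies and arms
    (∀ (n : ℕ) (h : Fin n → Fin K) (a : Fin n → Fin 2),
      T.IsFullRankDesignEvent P n (T.allocation n h a) → ∀ agg : Federation,
      Integrable (fun ω => (T.sample n ω).tauOneShot σ agg) P[|T.allocation n h a] →
      ∫ ω, (T.sample n ω).tauOneShot σ agg ∂(P[|T.allocation n h a]) =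
        ∑ k, ((Finset.univ.filter fun i => h i = k).card : ℝ) / n * T.studyATE P k) ∧
    (∀ n : ℕ, n ≠ 0 →
      ∫ ω, ∑ k, (((T.sample n ω).inStudy k).card : ℝ) / n * T.studyATE P k ∂P = T.ate P) ∧
    -- the same, for the average treatment effect itself, as the sample grows
    (∀ (S : ℕ → Set Ω) (agg : Federation),
      (∀ᶠ n in atTop, T.IsFullRankDesignEvent P n (S n)) →
      Tendsto (fun n => P (S n)) atTop (𝓝 1) →
      (∀ᶠ n in atTop, Integrable (fun ω => (T.sample n ω).tauOneShot σ agg) P[|S n]) →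
      Tendsto (fun n => ∫ ω, (T.sample n ω).tauOneShot σ agg ∂(P[|S n])) atTop (𝓝 (T.ate P))) ∧
    -- variances of the outcome parameters in every direction, possibly infinite
    (∀ n S, T.IsFullRankDesignEvent P n S → ∀ (w : Fin 2) (v : Fin (d + 1) → ℝ),
      evariance (fun ω => v ⬝ᵥ (T.sample n ω).thetaPool w) P[|S] =
        evariance (fun ω => v ⬝ᵥ (T.sample n ω).thetaGD (η n ω) θ₀ w) P[|S] ∧
      evariance (fun ω => v ⬝ᵥ (T.sample n ω).thetaGD (η n ω) θ₀ w) P[|S] =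
        evariance (fun ω => v ⬝ᵥ (T.sample n ω).thetaOneShot σ .IVW w) P[|S] ∧
      evariance (fun ω => v ⬝ᵥ (T.sample n ω).thetaOneShot σ .IVW w) P[|S] ≤
        evariance (fun ω => v ⬝ᵥ (T.sample n ω).thetaOneShot σ .SW w) P[|S]) ∧
    -- covariance matrices of the outcome parameters in the Loewner order
    (∀ n S, T.IsFullRankDesignEvent P n S → ∀ w : Fin 2,
      (∀ j, MemLp (fun ω => (T.sample n ω).thetaOneShot σ .SW w j) 2 P[|S]) →
      (∀ j, MemLp (fun ω => (T.sample n ω).thetaPool w j) 2 P[|S] ∧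
        MemLp (fun ω => (T.sample n ω).thetaGD (η n ω) θ₀ w j) 2 P[|S] ∧
        MemLp (fun ω => (T.sample n ω).thetaOneShot σ .IVW w j) 2 P[|S]) ∧
      covMatrix (fun ω => (T.sample n ω).thetaPool w) P[|S] =
        covMatrix (fun ω => (T.sample n ω).thetaGD (η n ω) θ₀ w) P[|S] ∧
      covMatrix (fun ω => (T.sample n ω).thetaGD (η n ω) θ₀ w) P[|S] =
        covMatrix (fun ω => (T.sample n ω).thetaOneShot σ .IVW w) P[|S] ∧
      (covMatrix (fun ω => (T.sample n ω).thetaOneShot σ .SW w) P[|S] -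
        covMatrix (fun ω => (T.sample n ω).thetaOneShot σ .IVW w) P[|S]).PosSemidef) ∧
    -- asymptotic variances of the treatment effect estimators
    (∃ V V_SW : ℝ≥0,
      HasAsymptoticVariance P (fun n ω => (T.sample n ω).tauPool) (T.ate P) V ∧
      HasAsymptoticVariance P (fun n ω => (T.sample n ω).tauGD (η n ω) θ₀) (T.ate P) V ∧
      HasAsymptoticVariance P (fun n ω => (T.sample n ω).tauOneShot σ .IVW) (T.ate P) V ∧
      HasAsymptoticVariance P (fun n ω => (T.sample n ω).tauOneShot σ .SW) (T.ate P) V_SW ∧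
      V ≤ V_SW) := by
  refine ⟨hT.tendsto_measure_fullRank hfull,
    fun n S hS agg w j hint => hS.integral_thetaOneShot hT agg w j hint,
    fun n S hS agg hint => hS.integral_tauOneShot hT agg hint,
    fun n hn => ⟨hT.integrable_sampleATE n, hT.integral_sampleATE hn⟩,
    fun n h a hS agg hint =>
      (hS.integral_tauOneShot hT agg hint).trans (hT.integral_sampleATE_allocation hS.pos),
    fun n hn => hT.integral_sum_studyATE hn,
    fun S agg hS hP hint => hT.tendsto_integral_tauOneShot_cond agg hS hP hint,
    fun n S hS w v => ?_, fun n S hS w hSW => ?_,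
    -- The witnesses are the variances of the two limiting influence functions, read off from the
    -- limit theorems.
    _, _, hT.hasAsymptoticVariance_tauPool hfull,
    hT.hasAsymptoticVariance_tauGD hfull hη_meas hη θ₀,
    hT.hasAsymptoticVariance_tauOneShot hfull .IVW, hT.hasAsymptoticVariance_tauOneShot hfull .SW,
    Real.toNNReal_le_toNNReal (hT.variance_influence_IVW_le_SW hfull)⟩
  · obtain ⟨h₁, h₂⟩ := hS.evariance_eq hT (hη n) θ₀ w v
    exact ⟨h₁, h₂, hS.evariance_IVW_le_SW hT w v⟩
  · have := cond_isProbabilityMeasure hS.pos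
    have hGD := hS.thetaGD_ae_eq hT (hη n) θ₀ w
    have hIVW := hS.thetaPool_ae_eq hT w
    have hmem := hS.memLp_thetaOneShot_IVW hT w hSW
    exact ⟨fun j => ⟨(hmem j).ae_eq (hIVW.fun_comp (· j)),
        (hmem j).ae_eq ((hIVW.trans hGD.symm).fun_comp (· j)), hmem j⟩,
      covMatrix_congr hGD.symm, covMatrix_congr (hGD.trans hIVW.symm),
      covMatrix_sub_posSemidef hmem hSW (hS.evariance_IVW_le_SW hT w)⟩
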